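/- Let $n\ge 5$ and $k\ge 3$ be integers, and let $H_4$ be a real number lying strictly between $\dfrac{1}{(\tan\frac{\pi}{k})^{4}}$ and $\dfrac{k^4-4}{n(n-4)}$ (whichever of the two numbers is the larger). Then $H_4>0$, and the unit sphere $S^{n+1}(1)\subset\mathbb{R}^{n+2}$ contains a compact, connected, embedded, smooth $n$-dimensional hypersurface $M$ with constant $4$th mean curvature $H_4$ that is not isometric (with its induced Riemannian metric) to any round sphere $S^n(\rho)$, $\rho>0$, nor to any Clifford hypersurface $S^l(a)\times S^{n-l}(b)$, $1\le l\le n-1$, $a,b>0$, $a^2+b^2=1$. Moreover $M$ can be chosen rotational, that is, of the form $$M=\{(y_1(s)\varphi,\,y_2(s),\,y_3(s)) : s\in\mathbb{R},\ \varphi\in\mathbb{R}^n,\ |\varphi|=1\}$$ for a smooth curve $(y_1,y_2,y_3):\mathbb{R}\to S^2(1)$ parametrized by arc length with $y_1>0$. Here the $4$th mean curvature is defined by $\binom{n}{4}H_4=\sum_{i_1<i_2<i_3<i_4}\lambda_{i_1}\lambda_{i_2}\lambda_{i_3}\lambda_{i_4}$, where $\lambda_1,\dots,\lambda_n$ are the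 principal curvatures of $M$ in $S^{n+1}(1)$. -/

import Mathlib

open scoped ContDiff

/-- Euclidean space `ℝ^d` with its standard inner product. -/
abbrev Euc (d : ℕ) : Type := EuclideanSpace ℝ (Fin d)

/-- `x : U → S` is a (smooth, regular) local parametrization of the subset `S ⊆ ℝ^d` by an open
set `U ⊆ ℝ^n`: it is smooth, its differential is injective at each point, and it is a
homeomorphism of `U` onto a relatively open subset of `S` (it is continuous and injective on `U`
and maps open subsets of `U` onto relatively open subsets of `S`). -/
structure IsLocalParam (n : ℕ) {d : ℕ} (S : Set (Euc d)) (U : Set (Euc n))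
    (x : Euc n → Euc d) : Prop where
  isOpen_source : IsOpen U
  smooth : ContDiffOn ℝ ∞ x U
  immersion : ∀ u ∈ U, Function.Injective (fderiv ℝ x u)
  injOn : Set.InjOn x U
  relOpen : ∀ W : Set (Euc n), IsOpen W → W ⊆ U →
    ∃ V : Set (Euc d), IsOpen V ∧ x '' W = S ∩ V

/-- `S` is an `n`-dimensional embedded smooth submanifold of `ℝ^d`. -/
def IsEmbeddedSubmanifold (n : ℕ) {d : ℕ} (S : Set (Euc d)) : Prop :=
  ∀ p ∈ S, ∃ (U : Set (Euc n)) (x : Euc n → Euc d), IsLocalParam n S U x ∧ p ∈ x '' U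

/-- `M` is an embedded `n`-dimensional hypersurface of the unit sphere `S^{n+1}(1) ⊆ ℝ^{n+2}`. -/
def IsEmbeddedHypersurface (n : ℕ) (M : Set (Euc (n + 2))) : Prop :=
  M ⊆ Metric.sphere (0 : Euc (n + 2)) 1 ∧ IsEmbeddedSubmanifold n M

/-- `ν` is a continuous field, along the hypersurface `M` of the unit sphere, of unit vectors that
are tangent to the sphere and normal to `M`. -/
structure IsUnitNormalField (n : ℕ) (M : Set (Euc (n + 2)))
    (ν : Euc (n + 2) → Euc (n + 2)) : Prop where
  continuousOn : ContinuousOn ν M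
  norm_eq_one : ∀ p ∈ M, ‖ν p‖ = 1
  tangent_sphere : ∀ p ∈ M, inner ℝ p (ν p) = 0
  normal : ∀ (U : Set (Euc n)) (x : Euc n → Euc (n + 2)), IsLocalParam n M U x →
    ∀ u ∈ U, ∀ v : Euc n, inner ℝ (fderiv ℝ x u v) (ν (x u)) = 0

/-- The vectors `dx_u (e i)` form an orthonormal basis of the tangent space `dx_u (ℝ^n)` that
diagonalizes the second fundamental form `(v, w) ↦ ⟪D²x_u (v, w), N⟫` in the direction of the
unit normal `N`; the diagonal entries `κ i` are the principal curvatures. -/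
structure IsPrincipalFrame {n d : ℕ} (x : Euc n → Euc d) (u : Euc n) (N : Euc d)
    (e : Fin n → Euc n) (κ : Fin n → ℝ) : Prop where
  orthonormal : Orthonormal ℝ (fun i => fderiv ℝ x u (e i))
  diagonal : ∀ i j, inner ℝ (fderiv ℝ (fderiv ℝ x) u (e i) (e j)) N = if i = j then κ i else 0

/-- The `m`-th mean curvature of `M` at `p` with respect to the normal field `ν` is `h`:
`C(n,m) h` is the `m`-th elementary symmetric function of the principal curvatures at `p`
(these are determined, up to order, by `M`, `p` and `ν p`). -/
def HasMeanCurvatureAt (n m : ℕ) (M : Set (Euc (n + 2))) (ν : Euc (n + 2) → Euc (n + 2))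
    (p : Euc (n + 2)) (h : ℝ) : Prop :=
  ∃ (U : Set (Euc n)) (x : Euc n → Euc (n + 2)) (u : Euc n) (e : Fin n → Euc n) (κ : Fin n → ℝ),
    IsLocalParam n M U x ∧ u ∈ U ∧ x u = p ∧ IsPrincipalFrame x u (ν p) e κ ∧
      (n.choose m : ℝ) * h =
        ∑ s ∈ Finset.powersetCard m (Finset.univ : Finset (Fin n)), ∏ i ∈ s, κ i

/-- `M`, suitably oriented, has constant `m`-th mean curvature `h`. -/
def HasConstantMeanCurvature (n m : ℕ) (M : Set (Euc (n + 2))) (h : ℝ) : Prop :=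
  ∃ ν : Euc (n + 2) → Euc (n + 2), IsUnitNormalField n M ν ∧
    ∀ p ∈ M, HasMeanCurvatureAt n m M ν p h

/-- `M` is a rotational hypersurface of the unit sphere: it consists of the points
`(y₁(s) φ₁, …, y₁(s) φₙ, y₂(s), y₃(s))` with `φ` in the unit sphere of `ℝ^n`, where
`y = (y₁, y₂, y₃)` is a smooth curve in the unit sphere of `ℝ³`, parametrized by arc length,
which does not meet the axis (`y₁ > 0`). -/
def IsRotational (n : ℕ) (M : Set (Euc (n + 2))) : Prop :=
  ∃ y : ℝ → Euc 3, ContDiff ℝ ∞ y ∧ (∀ s, ‖y s‖ = 1) ∧ (∀ s, ‖deriv y s‖ = 1) ∧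
    (∀ s, 0 < y s 0) ∧
    M = {p | ∃ (s : ℝ) (φ : Euc n), ‖φ‖ = 1 ∧
      (∀ i : Fin n, p (Fin.castAdd 2 i) = y s 0 * φ i) ∧
      p (Fin.natAdd n 0) = y s 1 ∧ p (Fin.natAdd n 1) = y s 2}

/-- The `n`-dimensional submanifolds `S` and `S'`, with their induced Riemannian metrics, are
isometric: there is a smooth bijection of `S` onto `S'` that preserves the lengths of tangent
vectors (such a bijection is automatically a diffeomorphism). -/
def AreIsometric (n : ℕ) {d d' : ℕ} (S : Set (Euc d)) (S' : Set (Euc d')) : Prop :=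
  ∃ f : Euc d → Euc d', Set.BijOn f S S' ∧
    ∀ (U : Set (Euc n)) (x : Euc n → Euc d), IsLocalParam n S U x →
      ContDiffOn ℝ ∞ (f ∘ x) U ∧
        ∀ u ∈ U, ∀ v : Euc n, ‖fderiv ℝ (f ∘ x) u v‖ = ‖fderiv ℝ x u v‖

/-- The Clifford hypersurface `S^l(a) × S^{n-l}(b) ⊆ ℝ^{l+1} × ℝ^{n-l+1} = ℝ^{n+2}`. -/
def cliffordHypersurface (n l : ℕ) (a b : ℝ) : Set (Euc (n + 2)) :=
  {p | (∑ i : Fin (n + 2), if (i : ℕ) ≤ l then p i ^ 2 else 0) = a ^ 2 ∧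
    (∑ i : Fin (n + 2), if (i : ℕ) ≤ l then 0 else p i ^ 2) = b ^ 2}

/-- `M` is nontrivial: it is isometric neither to a round sphere `S^n(ρ)` nor to a Clifford
hypersurface `S^l(a) × S^{n-l}(b)` of the unit sphere, `1 ≤ l ≤ n - 1`, `a² + b² = 1`. -/
def IsNontrivialHypersurface (n : ℕ) (M : Set (Euc (n + 2))) : Prop :=
  (∀ ρ : ℝ, 0 < ρ → ¬ AreIsometric n M (Metric.sphere (0 : Euc (n + 1)) ρ)) ∧
  ∀ (l : ℕ) (a b : ℝ), 1 ≤ l → l + 1 ≤ n → 0 < a → 0 < b → a ^ 2 + b ^ 2 = 1 →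
    ¬ AreIsometric n M (cliffordHypersurface n l a b)

open scoped ContDiff

/-! A rotational hypersurface with profile curve (r, √(1-r²) cos t, √(1-r²) sin t) has principal
curvatures λ = g/r, with multiplicity n-1, and μ, where -g is the r-component of the unit normal.
With μ = dg/dr the equation nH = (n-4)λ⁴ + 4λ³μ becomes (r^(n-4) g⁴)' = nH r^(n-1), so g⁴ = C
r^(-(n-4)) + H r⁴ for a constant C. In arc length r² + r'² + g² = 1, so r moves like a particle of
energy 1 in the potential r² + g². This potential is strictly convex, and r oscillates between two
turning points a < b, which determine C.

Since g > 0, the polar angle t increases along the curve. If half an oscillation advances it by π/k,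
then k oscillations make exactly one turn, and the curve is a closed graph over the polar angle;
this gives embeddedness (`TurningPoints.exists_angularProfile`, `AngularProfile.isLocalParam`).

The half angle depends continuously on a. As a → 0 the profile degenerates to the circle that
generates an umbilic sphere, and the half angle tends to arctan(H^(-1/4))
(`tendsto_halfAngle_zero`). As a and b merge at the equilibrium, which is a Clifford hypersurface,
small oscillations give the limit π/(4 + n(n-4)H)^(1/4) (`tendsto_halfAngle_radius`). The bounds on
H say exactly that π/k lies strictly between the two limits, so the intermediate value theorem
applies (`exists_turningPoints_halfAngle_eq`).

Nontriviality is detected by the scalar curvature. It is an isometry invariant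
(`scalarCurvature_eq`) and is constant on products of round spheres (`scalarCurvature_product`). On
the new hypersurface it is an affine function of λ² + H/λ², which is injective in λ > 0 where λ⁴ >
H, while λ is not constant (`AngularProfile.scalarCurvature_nonconstant`). -/

namespace Rotational

open Real Set Filter Topology MeasureTheory

/-! ### The potential of the profile equation and its convexity -/

/-- The fourth power `C r^{-q} + H r⁴` of the function `normalComp`. -/
noncomputable def radicand (q : ℕ) (H C r : ℝ) : ℝ := C / r ^ q + H * r ^ 4

/-- Along a profile curve with energy constant `C`, the first coordinate of the unit normal, up to
sign, as a function of the first coordinate `r` of the curve. -/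
noncomputable def normalComp (q : ℕ) (H C r : ℝ) : ℝ := √√(radicand q H C r)

/-- The potential: along a profile curve `r'² + potential r = 1`. -/
noncomputable def potential (q : ℕ) (H C r : ℝ) : ℝ := r ^ 2 + √(radicand q H C r)

noncomputable def radicandD (q : ℕ) (H C r : ℝ) : ℝ := -(q * C) / r ^ (q + 1) + 4 * H * r ^ 3

noncomputable def radicandDD (q : ℕ) (H C r : ℝ) : ℝ :=
  q * (q + 1) * C / r ^ (q + 2) + 12 * H * r ^ 2

noncomputable def potentialD (q : ℕ) (H C r : ℝ) : ℝ :=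
  2 * r + radicandD q H C r / (2 * √(radicand q H C r))

noncomputable def potentialDD (q : ℕ) (H C r : ℝ) : ℝ :=
  2 + (2 * radicand q H C r * radicandDD q H C r - radicandD q H C r ^ 2) /
    (4 * (radicand q H C r * √(radicand q H C r)))

/-- The energy constant of the profile curve that has a turning point at height `r`. -/
noncomputable def energyConst (q : ℕ) (H r : ℝ) : ℝ := r ^ q * ((1 - r ^ 2) ^ 2 - H * r ^ 4)

section basics
variable {q : ℕ} {H C r : ℝ}

lemma radicand_pos (hH : 0 < H) (hC : 0 ≤ C) (hr : 0 < r) : 0 < radicand q H C r := by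
  unfold radicand; positivity

lemma hasDerivAt_radicand (hr : r ≠ 0) :
    HasDerivAt (radicand q H C) (radicandD q H C r) r := by
  have h1 := ((hasDerivAt_pow q r).inv (pow_ne_zero q hr)).const_mul C
  have h2 := (hasDerivAt_pow 4 r).const_mul H
  refine ((h1.add h2).congr_deriv ?_).congr_of_eventuallyEq (Eventually.of_forall fun x => ?_)
  · rw [radicandD]
    rcases q with _ | q
    · simp; ring
    · simp; field_simp; ring
  · simp [radicand, div_eq_mul_inv]

lemma hasDerivAt_radicandD (hr : r ≠ 0) :
    HasDerivAt (radicandD q H C) (radicandDD q H C r) r := by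
  have h1 := ((hasDerivAt_pow (q + 1) r).inv (pow_ne_zero _ hr)).const_mul (-(q * C))
  have h2 := (hasDerivAt_pow 3 r).const_mul (4 * H)
  refine ((h1.add h2).congr_deriv ?_).congr_of_eventuallyEq (Eventually.of_forall fun x => ?_)
  · rw [radicandDD]
    simp
    field_simp
    ring
  · simp [radicandD, div_eq_mul_inv]

lemma hasDerivAt_potential (hH : 0 < H) (hC : 0 ≤ C) (hr : 0 < r) :
    HasDerivAt (potential q H C) (potentialD q H C r) r := by
  have hp := radicand_pos (q := q) hH hC hr
  have h := (hasDerivAt_pow 2 r).add ((hasDerivAt_radicand (q := q) (H := H) (C := C) hr.ne').sqrt hp.ne')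
  refine h.congr_deriv ?_
  simp [potentialD]

lemma hasDerivAt_potentialD (hH : 0 < H) (hC : 0 ≤ C) (hr : 0 < r) :
    HasDerivAt (potentialD q H C) (potentialDD q H C r) r := by
  have hp := radicand_pos (q := q) hH hC hr
  have hs := Real.sqrt_pos.2 hp
  have hd := hasDerivAt_radicand (q := q) (H := H) (C := C) hr.ne'
  have h := ((hasDerivAt_id r).const_mul 2).add
    ((hasDerivAt_radicandD (q := q) (H := H) (C := C) hr.ne').div ((hd.sqrt hp.ne').const_mul 2)
      (by positivity))
  refine h.congr_deriv ?_
  have hsq := Real.sq_sqrt hp.le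
  rw [potentialDD]
  set s := √(radicand q H C r)
  rw [← hsq]
  field_simp
  ring

/-- The term r² contributes 2, and the square root of the radicand R is convex: 2RR'' - R'² expands
into terms with nonnegative coefficients in C and H. -/
lemma two_le_potentialDD (hH : 0 < H) (hC : 0 ≤ C) (hr : 0 < r) :
    2 ≤ potentialDD q H C r := by
  have hp := radicand_pos (q := q) hH hC hr
  have hs := Real.sqrt_pos.2 hp
  have : 0 ≤ 2 * radicand q H C r * radicandDD q H C r - radicandD q H C r ^ 2 := by
    have e : 2 * radicand q H C r * radicandDD q H C r - radicandD q H C r ^ 2 =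
        (q ^ 2 + 2 * q) * (C / r ^ (q + 1)) ^ 2 + (2 * q ^ 2 + 10 * q + 24) * H * (C / r ^ q) * r ^ 2
          + 8 * H ^ 2 * r ^ 6 := by
      unfold radicand radicandD radicandDD
      field_simp
      ring
    rw [e]; positivity
  unfold potentialDD
  have := div_nonneg this (by positivity : 0 ≤ 4 * (radicand q H C r * √(radicand q H C r)))
  linarith

lemma normalComp_pos (hH : 0 < H) (hC : 0 ≤ C) (hr : 0 < r) : 0 < normalComp q H C r :=
  Real.sqrt_pos.2 (Real.sqrt_pos.2 (radicand_pos hH hC hr))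

lemma normalComp_sq : normalComp q H C r ^ 2 = √(radicand q H C r) :=
  Real.sq_sqrt (Real.sqrt_nonneg _)

lemma normalComp_pow_four (hH : 0 < H) (hC : 0 ≤ C) (hr : 0 < r) :
    normalComp q H C r ^ 4 = radicand q H C r := by
  rw [show normalComp q H C r ^ 4 = (normalComp q H C r ^ 2) ^ 2 by ring, normalComp_sq,
    Real.sq_sqrt (radicand_pos hH hC hr).le]

lemma potential_eq : potential q H C r = r ^ 2 + normalComp q H C r ^ 2 := by
  rw [normalComp_sq, potential]

lemma radicand_energyConst (hr : r ≠ 0) :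
    radicand q H (energyConst q H r) r = (1 - r ^ 2) ^ 2 := by
  unfold radicand energyConst; field_simp; ring

lemma potential_energyConst (hr : 0 < r) (hr1 : r ≤ 1) :
    potential q H (energyConst q H r) r = 1 := by
  rw [potential, radicand_energyConst hr.ne', Real.sqrt_sq (by nlinarith)]; ring

/-- The error formula of quadratic interpolation: 1 - F - D(b-x)(x-a) vanishes at a, r and b, so
Rolle's theorem applied twice gives a zero of its second derivative. It bounds the quotient below
uniformly, and identifies its limit when a and b merge. -/
lemma exists_quotient_eq {a b : ℝ} (hH : 0 < H) (hC : 0 ≤ C) (ha : 0 < a)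
    (hFa : potential q H C a = 1) (hFb : potential q H C b = 1) (har : a < r) (hrb : r < b) :
    ∃ ξ ∈ Ioo a b, (1 - potential q H C r) / ((b - r) * (r - a)) = potentialDD q H C ξ / 2 := by
  set D := (1 - potential q H C r) / ((b - r) * (r - a)) with hD
  have hDr : 1 - potential q H C r - D * ((b - r) * (r - a)) = 0 := by
    have : (b - r) * (r - a) ≠ 0 := mul_ne_zero (by linarith) (by linarith)
    rw [hD, div_mul_cancel₀ _ this, sub_self]
  let h : ℝ → ℝ := fun x => 1 - potential q H C x - D * ((b - x) * (x - a))
  let h' : ℝ → ℝ := fun x => -potentialD q H C x - D * (a + b - 2 * x)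
  let h'' : ℝ → ℝ := fun x => -potentialDD q H C x + 2 * D
  have hh : ∀ x, 0 < x → HasDerivAt h (h' x) x := fun x hx => by
    have e := ((hasDerivAt_potential (q := q) hH hC hx).const_sub 1).sub
      ((((hasDerivAt_id x).const_sub b).mul ((hasDerivAt_id x).sub_const a)).const_mul D)
    exact e.congr_deriv (by simp only [h', id]; ring)
  have hh' : ∀ x, 0 < x → HasDerivAt h' (h'' x) x := fun x hx => by
    have e := ((hasDerivAt_potentialD (q := q) hH hC hx).neg).sub
      ((((hasDerivAt_id x).const_mul 2).const_sub (a + b)).const_mul D)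
    exact e.congr_deriv (by simp [h'']; ring)
  have hcont : ∀ x y, 0 < x → ContinuousOn h (Icc x y) := fun x y hx z hz =>
    (hh z (hx.trans_le hz.1)).continuousAt.continuousWithinAt
  have hcont' : ∀ x y, 0 < x → ContinuousOn h' (Icc x y) := fun x y hx z hz =>
    (hh' z (hx.trans_le hz.1)).continuousAt.continuousWithinAt
  have h0 : h a = 0 := by simp [h, hFa]
  have h1 : h b = 0 := by simp [h, hFb]
  have h2 : h r = 0 := hDr
  obtain ⟨c, hc, hc0⟩ := exists_hasDerivAt_eq_zero har (hcont a r ha) (h0.trans h2.symm)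
    (fun x hx => hh x (ha.trans hx.1))
  obtain ⟨d, hd, hd0⟩ := exists_hasDerivAt_eq_zero hrb (hcont r b (ha.trans har)) (h2.trans h1.symm)
    (fun x hx => hh x ((ha.trans har).trans hx.1))
  obtain ⟨ξ, hξ, hξ0⟩ := exists_hasDerivAt_eq_zero (hc.2.trans hd.1) (hcont' c d (ha.trans hc.1))
    (hc0.trans hd0.symm) (fun x hx => hh' x ((ha.trans hc.1).trans hx.1))
  refine ⟨ξ, ⟨hc.1.trans hξ.1, hξ.2.trans hd.2⟩, ?_⟩
  simp only [h''] at hξ0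
  linarith

end basics

/-! ### The energy constant as a function of the turning height -/

section unimodal
variable {q : ℕ} {H τ : ℝ}

/-- `1 / √(1 + t)`, the radius `r` with `(1 - r²) / r² = t`. -/
noncomputable def radius (t : ℝ) : ℝ := 1 / √(1 + t)

lemma radius_pos {t : ℝ} (ht : 0 < t) : 0 < radius t := by unfold radius; positivity

lemma radius_sq {t : ℝ} (ht : 0 < t) : radius t ^ 2 = 1 / (1 + t) := by
  unfold radius; rw [div_pow, Real.sq_sqrt (by positivity), one_pow]

lemma radius_sq_mul {t : ℝ} (ht : 0 < t) : radius t ^ 2 * (1 + t) = 1 := by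
  rw [radius_sq ht]; field_simp

lemma radius_lt_one {t : ℝ} (ht : 0 < t) : radius t < 1 := by
  have := radius_sq_mul ht
  have h0 := radius_pos ht
  nlinarith [mul_pos (pow_pos h0 2) ht]

lemma radius_lt_radius {s t : ℝ} (hs : 0 < s) (hst : s < t) : radius t < radius s := by
  have h1 := radius_sq hs
  have h2 := radius_sq (hs.trans hst)
  refine lt_of_pow_lt_pow_left₀ 2 (radius_pos hs).le ?_
  rw [h1, h2]
  exact one_div_lt_one_div_of_lt (by linarith) (by linarith)

lemma hasDerivAt_energyConst (r : ℝ) :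
    HasDerivAt (energyConst (q + 1) H)
      (r ^ q * ((q + 1) * (1 - r ^ 2) ^ 2 - 4 * r ^ 2 * (1 - r ^ 2) - (q + 5) * H * r ^ 4)) r := by
  have h := (hasDerivAt_pow (q + 1) r).mul
    ((((hasDerivAt_pow 2 r).const_sub 1).pow 2).sub ((hasDerivAt_pow 4 r).const_mul H))
  refine h.congr_deriv ?_
  simp
  ring

lemma continuous_energyConst : Continuous (energyConst q H) := by
  unfold energyConst; fun_prop

/-- In x = 1-r² and y = r² this is a homogeneous quadratic, and the hypothesis says that x/y = τ is
a root. So `radius τ` is the critical height; τ is the value of λ² at the equilibrium. -/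
lemma energyConst_deriv_factor (hq : (q + 1) * τ ^ 2 - 4 * τ = (q + 5) * H) (r : ℝ) :
    (q + 1) * (1 - r ^ 2) ^ 2 - 4 * r ^ 2 * (1 - r ^ 2) - (q + 5) * H * r ^ 4 =
      (1 - r ^ 2 - τ * r ^ 2) * ((q + 1) * (1 - r ^ 2 + τ * r ^ 2) - 4 * r ^ 2) := by
  rw [← hq]; ring

lemma strictMonoOn_energyConst (hH : 0 < H) (hτ : 0 < τ)
    (hq : (q + 1) * τ ^ 2 - 4 * τ = (q + 5) * H) :
    StrictMonoOn (energyConst (q + 1) H) (Icc 0 (radius τ)) := by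
  refine strictMonoOn_of_deriv_pos (convex_Icc _ _) continuous_energyConst.continuousOn ?_
  intro r hr
  rw [interior_Icc] at hr
  rw [(hasDerivAt_energyConst r).deriv, energyConst_deriv_factor hq]
  have h1 := radius_sq_mul hτ
  have h2 : r ^ 2 < radius τ ^ 2 := by nlinarith [hr.1, hr.2]
  have h3 : 0 < r := hr.1
  -- The product of τ and (q+1)τ - 4 equals (q+5)H > 0. This makes the second factor of the
  -- derivative positive, so the sign is that of 1 - r² - τr².
  have h5 : 4 < (q + 1) * τ := by
    have : (0:ℝ) < (q + 5) * H := by positivity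
    nlinarith
  have h4 : 0 < 1 - r ^ 2 - τ * r ^ 2 := by nlinarith
  have h6 : (0:ℝ) < (q + 1) * (1 - r ^ 2 - τ * r ^ 2) := by positivity
  have h7 : (0:ℝ) < ((q + 1) * τ - 4) * r ^ 2 := mul_pos (by linarith) (by positivity)
  have h8 : 0 < ((q:ℝ) + 1) * τ * r ^ 2 := by positivity
  have : 0 < (q + 1) * (1 - r ^ 2 + τ * r ^ 2) - 4 * r ^ 2 := by nlinarith
  positivity

lemma strictAntiOn_energyConst (hH : 0 < H) (hτ : 0 < τ)
    (hq : (q + 1) * τ ^ 2 - 4 * τ = (q + 5) * H) :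
    StrictAntiOn (energyConst (q + 1) H) (Icc (radius τ) (radius (√H))) := by
  have hs := Real.sqrt_pos.2 hH
  refine strictAntiOn_of_deriv_neg (convex_Icc _ _) continuous_energyConst.continuousOn ?_
  intro r hr
  rw [interior_Icc] at hr
  rw [(hasDerivAt_energyConst r).deriv, energyConst_deriv_factor hq]
  have h1 := radius_sq_mul hτ
  have h3 : 0 < r := (radius_pos hτ).trans hr.1
  have h2 : radius τ ^ 2 < r ^ 2 := by
    have := radius_pos hτ
    nlinarith [hr.1, hr.2]
  have h2' : r ^ 2 < radius (√H) ^ 2 := by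
    nlinarith [hr.1, hr.2]
  have h1' := radius_sq_mul hs
  have h5 : 4 < (q + 1) * τ := by
    have : (0:ℝ) < (q + 5) * H := by positivity
    nlinarith
  have h4 : 1 - r ^ 2 - τ * r ^ 2 < 0 := by nlinarith
  have h9 : 0 < 1 - r ^ 2 := by nlinarith
  have h6 : (0:ℝ) < (q + 1) * (1 - r ^ 2) := by positivity
  have h7 : (0:ℝ) < ((q + 1) * τ - 4) * r ^ 2 := mul_pos (by linarith) (by positivity)
  have : 0 < (q + 1) * (1 - r ^ 2 + τ * r ^ 2) - 4 * r ^ 2 := by nlinarith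
  have := mul_pos (pow_pos h3 q) (mul_pos (neg_pos.2 h4) this)
  nlinarith

lemma energyConst_zero : energyConst (q + 1) H 0 = 0 := by simp [energyConst]

lemma energyConst_radius_sqrt (hH : 0 < H) : energyConst q H (radius (√H)) = 0 := by
  have hs := Real.sqrt_pos.2 hH
  have h1 := radius_sq_mul hs
  have h2 := Real.sq_sqrt hH.le
  unfold energyConst
  rw [show radius (√H) ^ 4 = (radius (√H) ^ 2) ^ 2 by ring,
    show 1 - radius (√H) ^ 2 = √H * radius (√H) ^ 2 by linarith, mul_pow, h2]
  ring

/-- From (q+1)τ² = (q+5)H + 4τ > (q+1)H. Hence the equilibrium height lies below `radius (√H)`, the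
positive height where the energy constant returns to 0. -/
lemma sqrt_lt_root (hH : 0 < H) (hτ : 0 < τ)
    (hq : (q + 1) * τ ^ 2 - 4 * τ = (q + 5) * H) : √H < τ := by
  rw [Real.sqrt_lt' hτ]
  have : (0:ℝ) < q + 1 := by positivity
  nlinarith

/-- The inverse of a continuous strictly decreasing function on a compact interval. -/
lemma exists_continuousOn_inverse {f : ℝ → ℝ} {u v : ℝ} (huv : u ≤ v)
    (hf : StrictAntiOn f (Icc u v)) (hc : ContinuousOn f (Icc u v)) :
    ∃ g : ℝ → ℝ, ContinuousOn g (Icc (f v) (f u)) ∧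
      (∀ y ∈ Icc (f v) (f u), g y ∈ Icc u v ∧ f (g y) = y) ∧ ∀ x ∈ Icc u v, g (f x) = x := by
  have him : f '' Icc u v = Icc (f v) (f u) := by
    refine Subset.antisymm ?_ (intermediate_value_Icc' huv hc)
    rintro _ ⟨x, hx, rfl⟩
    exact ⟨hf.antitoneOn hx (right_mem_Icc.2 huv) hx.2, hf.antitoneOn (left_mem_Icc.2 huv) hx hx.1⟩
  have hmaps : MapsTo f (Icc u v) (Icc (f v) (f u)) := fun x hx => him ▸ mem_image_of_mem f hx
  let e : Icc u v ≃ Icc (f v) (f u) := Equiv.ofBijective (hmaps.restrict f _ _)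
    ⟨hmaps.restrict_inj.2 hf.injOn, (MapsTo.restrict_surjective_iff hmaps).2 him.symm.subset⟩
  have he : Continuous e := hc.mapsToRestrict hmaps
  let h := Continuous.homeoOfEquivCompactToT2 he
  have hval : ∀ y : Icc (f v) (f u), f (h.symm y) = y := fun y =>
    congrArg Subtype.val (h.apply_symm_apply y)
  have hle : f v ≤ f u := hf.antitoneOn (left_mem_Icc.2 huv) (right_mem_Icc.2 huv) huv
  refine ⟨fun y => h.symm (projIcc _ _ hle y), ?_, ?_, ?_⟩
  · exact (continuous_subtype_val.comp (h.symm.continuous.comp continuous_projIcc)).continuousOn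
  · intro y hy
    refine ⟨(h.symm _).2, ?_⟩
    simp only [projIcc_of_mem hle hy, hval]
  · intro x hx
    have : projIcc _ _ hle (f x) = h ⟨x, hx⟩ := projIcc_of_mem hle (hmaps hx)
    simp [this]

/-- For each inner turning point `a`, the outer turning point with the same energy constant. -/
lemma exists_outer_turning_point (hH : 0 < H) (hτ : 0 < τ)
    (hq : (q + 1) * τ ^ 2 - 4 * τ = (q + 5) * H) :
    ∃ β : ℝ → ℝ, ContinuousOn β (Icc 0 (radius τ)) ∧ β 0 = radius (√H) ∧
      β (radius τ) = radius τ ∧ ∀ a ∈ Ioo 0 (radius τ), β a ∈ Ioo (radius τ) (radius (√H)) ∧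
        energyConst (q + 1) H (β a) = energyConst (q + 1) H a := by
  have hs := Real.sqrt_pos.2 hH
  have hlt := radius_lt_radius hs (sqrt_lt_root hH hτ hq)
  have hanti := strictAntiOn_energyConst hH hτ hq
  have hmono := strictMonoOn_energyConst hH hτ hq
  obtain ⟨g, hg, hg1, hg2⟩ := exists_continuousOn_inverse hlt.le hanti
    continuous_energyConst.continuousOn
  rw [energyConst_radius_sqrt hH] at hg hg1
  have h0 := radius_pos hτ
  have hmem : ∀ a ∈ Icc 0 (radius τ), energyConst (q + 1) H a ∈
      Icc 0 (energyConst (q + 1) H (radius τ)) := fun a ha =>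
    ⟨energyConst_zero (q := q) (H := H) ▸ hmono.monotoneOn (left_mem_Icc.2 h0.le) ha ha.1,
      hmono.monotoneOn ha (right_mem_Icc.2 h0.le) ha.2⟩
  -- Both branches of the energy constant cover the same range of values, so the inverse of the
  -- decreasing branch can be composed with the increasing one, endpoints included.
  refine ⟨fun a => g (energyConst (q + 1) H a), hg.comp continuous_energyConst.continuousOn hmem,
    ?_, hg2 _ (left_mem_Icc.2 hlt.le), fun a ha => ?_⟩
  · show g (energyConst (q + 1) H 0) = _
    rw [energyConst_zero, ← energyConst_radius_sqrt (q := q + 1) hH]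
    exact hg2 _ (right_mem_Icc.2 hlt.le)
  · have ha' := Ioo_subset_Icc_self ha
    obtain ⟨h1, h2⟩ := hg1 _ (hmem a ha')
    refine ⟨⟨lt_of_le_of_ne h1.1 fun h => ?_, lt_of_le_of_ne h1.2 fun h => ?_⟩, h2⟩
    · rw [← show radius τ = g (energyConst (q + 1) H a) from h] at h2
      exact (hmono ha' (right_mem_Icc.2 h0.le) ha.2).ne' h2
    · rw [show g (energyConst (q + 1) H a) = _ from h, energyConst_radius_sqrt hH] at h2
      have := hmono (left_mem_Icc.2 h0.le) ha' ha.1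
      rw [energyConst_zero] at this
      exact this.ne h2

end unimodal

/-! ### The half angle and its two limits -/

/-- The height of the profile curve, oscillating between `a` and `b`. -/
noncomputable def height (a b ψ : ℝ) : ℝ := (a + b) / 2 + (b - a) / 2 * sin ψ

/-- The derivative of the polar angle of the profile curve with respect to the phase `ψ`. -/
noncomputable def angleDensity (q : ℕ) (H a b ψ : ℝ) : ℝ :=
  normalComp q H (energyConst q H a) (height a b ψ) / ((1 - height a b ψ ^ 2) *
    √((1 - potential q H (energyConst q H a) (height a b ψ)) /
      ((b - height a b ψ) * (height a b ψ - a))))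

section
variable {q : ℕ} {H τ a b ψ : ℝ}

lemma abs_sin_lt_one_of_mem (hψ : ψ ∈ Ioo (-(π / 2)) (π / 2)) : -1 < sin ψ ∧ sin ψ < 1 := by
  constructor
  · rw [show (-1 : ℝ) = sin (-(π / 2)) by simp]
    exact Real.strictMonoOn_sin ⟨le_rfl, by linarith [pi_pos]⟩ (Ioo_subset_Icc_self hψ) hψ.1
  · rw [← Real.sin_pi_div_two]
    exact Real.strictMonoOn_sin (Ioo_subset_Icc_self hψ) ⟨by linarith [pi_pos], le_rfl⟩ hψ.2

lemma height_mem_Ioo (hab : a < b) (h : -1 < sin ψ ∧ sin ψ < 1) : height a b ψ ∈ Ioo a b := by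
  unfold height
  constructor <;> nlinarith

lemma height_mem_Icc (hab : a ≤ b) : height a b ψ ∈ Icc a b := by
  have h1 := neg_one_le_sin ψ
  have h2 := sin_le_one ψ
  unfold height
  constructor <;> nlinarith

/-- An inner turning point `a` and the outer turning point `b` with the same energy constant. -/
structure TurningPoints (q : ℕ) (H a b : ℝ) : Prop where
  pos : 0 < a
  lt : a < b
  lt_radius : b < radius (√H)
  energy_eq : energyConst q H b = energyConst q H a

namespace TurningPoints

lemma energy_pos (hH : 0 < H) (h : TurningPoints q H a b) : 0 < energyConst q H a := by
  have hs := Real.sqrt_pos.2 hH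
  have h1 := radius_sq_mul hs
  have h2 := Real.sq_sqrt hH.le
  have h3 : a ^ 2 < radius (√H) ^ 2 := by nlinarith [h.pos, h.lt, h.lt_radius]
  have h4 : √H * a ^ 2 < 1 - a ^ 2 := by nlinarith
  have h5 : 0 < √H * a ^ 2 := mul_pos hs (pow_pos h.pos 2)
  have h6 : (√H * a ^ 2) ^ 2 < (1 - a ^ 2) ^ 2 := pow_lt_pow_left₀ h4 h5.le two_ne_zero
  have h7 : (√H * a ^ 2) ^ 2 = H * a ^ 4 := by rw [mul_pow, h2]; ring
  exact mul_pos (pow_pos h.pos q) (by linarith)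

lemma lt_one (hH : 0 < H) (h : TurningPoints q H a b) : b < 1 :=
  h.lt_radius.trans (radius_lt_one (Real.sqrt_pos.2 hH))

lemma potential_left (hH : 0 < H) (h : TurningPoints q H a b) :
    potential q H (energyConst q H a) a = 1 :=
  potential_energyConst h.pos (h.lt.trans (h.lt_one hH)).le

lemma potential_right (hH : 0 < H) (h : TurningPoints q H a b) :
    potential q H (energyConst q H a) b = 1 := by
  rw [← h.energy_eq]
  exact potential_energyConst (h.pos.trans h.lt) (h.lt_one hH).le

lemma exists_quotient_eq (hH : 0 < H) (h : TurningPoints q H a b) {r : ℝ} (hr : r ∈ Ioo a b) :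
    ∃ ξ ∈ Ioo a b, (1 - potential q H (energyConst q H a) r) / ((b - r) * (r - a)) =
      potentialDD q H (energyConst q H a) ξ / 2 :=
  Rotational.exists_quotient_eq hH (h.energy_pos hH).le h.pos (h.potential_left hH)
    (h.potential_right hH) hr.1 hr.2

lemma one_le_quotient (hH : 0 < H) (h : TurningPoints q H a b) {r : ℝ} (hr : r ∈ Ioo a b) :
    1 ≤ (1 - potential q H (energyConst q H a) r) / ((b - r) * (r - a)) := by
  obtain ⟨ξ, hξ, e⟩ := h.exists_quotient_eq hH hr
  rw [e]
  linarith [two_le_potentialDD (q := q) hH (h.energy_pos hH).le (h.pos.trans hξ.1)]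

lemma potential_lt_one (hH : 0 < H) (h : TurningPoints q H a b) {r : ℝ} (hr : r ∈ Ioo a b) :
    potential q H (energyConst q H a) r < 1 := by
  have h1 := h.one_le_quotient hH hr
  have h2 : 0 < (b - r) * (r - a) := mul_pos (sub_pos.2 hr.2) (sub_pos.2 hr.1)
  rw [le_div_iff₀ h2] at h1
  linarith

/-- The bound depends on H only, not on the turning points: r² + g² < 1 gives g ≤ 1, the quotient
under the root is at least 1, and r stays below `radius (√H)` < 1. It is the dominating constant for
all limits of the half angle. -/
lemma norm_angleDensity_le (hH : 0 < H) (h : TurningPoints q H a b)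
    (hψ : -1 < sin ψ ∧ sin ψ < 1) : ‖angleDensity q H a b ψ‖ ≤ 1 / (1 - radius (√H) ^ 2) := by
  have hr := height_mem_Ioo h.lt hψ
  set r := height a b ψ with hrdef
  have hr0 : 0 < r := h.pos.trans hr.1
  have h1 := h.one_le_quotient hH hr
  have h2 := h.potential_lt_one hH hr
  rw [potential_eq] at h2
  have h3 := normalComp_pos (q := q) hH (h.energy_pos hH).le hr0
  have h4 : normalComp q H (energyConst q H a) r ≤ 1 := by nlinarith
  have h5 := radius_lt_one (Real.sqrt_pos.2 hH)
  have h6 := radius_pos (Real.sqrt_pos.2 hH)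
  have h7 : 0 < 1 - radius (√H) ^ 2 := by nlinarith
  have h8 : r ^ 2 < radius (√H) ^ 2 := by nlinarith [hr.2, h.lt_radius]
  have h9 := Real.one_le_sqrt.2 h1
  unfold angleDensity
  rw [← hrdef, Real.norm_eq_abs, abs_of_nonneg (by
    have : 0 < 1 - r ^ 2 := by linarith
    positivity)]
  apply div_le_div₀ zero_le_one h4 h7
  nlinarith

end TurningPoints

lemma measurable_angleDensity : Measurable (angleDensity q H a b) := by
  unfold angleDensity height potential normalComp radicand
  fun_prop

lemma continuousAt_radicand {p : ℝ × ℝ} (hp : p.2 ≠ 0) :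
    ContinuousAt (fun p : ℝ × ℝ => radicand q H p.1 p.2) p := by
  unfold radicand
  exact (continuousAt_fst.div (continuousAt_snd.pow q) (pow_ne_zero q hp)).add
    (continuousAt_const.mul (continuousAt_snd.pow 4))

lemma continuousAt_normalComp {p : ℝ × ℝ} (hp : p.2 ≠ 0) :
    ContinuousAt (fun p : ℝ × ℝ => normalComp q H p.1 p.2) p :=
  (continuousAt_radicand hp).sqrt.sqrt

lemma continuousAt_potential {p : ℝ × ℝ} (hp : p.2 ≠ 0) :
    ContinuousAt (fun p : ℝ × ℝ => potential q H p.1 p.2) p :=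
  (continuousAt_snd.pow 2).add (continuousAt_radicand hp).sqrt

lemma continuousAt_potentialDD {p : ℝ × ℝ} (hp : p.2 ≠ 0) (h : 0 < radicand q H p.1 p.2) :
    ContinuousAt (fun p : ℝ × ℝ => potentialDD q H p.1 p.2) p := by
  have h0 := continuousAt_radicand (q := q) (H := H) hp
  have h1 : ContinuousAt (fun p : ℝ × ℝ => radicandD q H p.1 p.2) p :=
    ((continuousAt_const.mul continuousAt_fst).neg.div (continuousAt_snd.pow _)
      (pow_ne_zero _ hp)).add (continuousAt_const.mul (continuousAt_snd.pow 3))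
  have h2 : ContinuousAt (fun p : ℝ × ℝ => radicandDD q H p.1 p.2) p :=
    ((continuousAt_const.mul continuousAt_fst).div (continuousAt_snd.pow _)
      (pow_ne_zero _ hp)).add (continuousAt_const.mul (continuousAt_snd.pow 2))
  exact continuousAt_const.add ((((continuousAt_const.mul h0).mul h2).sub (h1.pow 2)).div
    (continuousAt_const.mul (h0.mul h0.sqrt)) (by positivity))

lemma continuousAt_angleDensity {p : ℝ × ℝ} (hr : height p.1 p.2 ψ ≠ 0)
    (hr1 : height p.1 p.2 ψ ^ 2 < 1)
    (hden : 0 < (p.2 - height p.1 p.2 ψ) * (height p.1 p.2 ψ - p.1))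
    (hF : potential q H (energyConst q H p.1) (height p.1 p.2 ψ) < 1) :
    ContinuousAt (fun p : ℝ × ℝ => angleDensity q H p.1 p.2 ψ) p := by
  have hh : ContinuousAt (fun p : ℝ × ℝ => height p.1 p.2 ψ) p := by unfold height; fun_prop
  have hc : ContinuousAt (fun p : ℝ × ℝ => (energyConst q H p.1, height p.1 p.2 ψ)) p :=
    (continuous_energyConst.continuousAt.comp continuousAt_fst).prodMk hh
  have h1 : ContinuousAt (fun p : ℝ × ℝ =>
      normalComp q H (energyConst q H p.1) (height p.1 p.2 ψ)) p :=
    ContinuousAt.comp (g := fun x : ℝ × ℝ => normalComp q H x.1 x.2)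
      (f := fun p : ℝ × ℝ => (energyConst q H p.1, height p.1 p.2 ψ)) (continuousAt_normalComp hr) hc
  have h2 : ContinuousAt (fun p : ℝ × ℝ =>
      potential q H (energyConst q H p.1) (height p.1 p.2 ψ)) p :=
    ContinuousAt.comp (g := fun x : ℝ × ℝ => potential q H x.1 x.2)
      (f := fun p : ℝ × ℝ => (energyConst q H p.1, height p.1 p.2 ψ)) (continuousAt_potential hr) hc
  have h3 : 0 < (1 - potential q H (energyConst q H p.1) (height p.1 p.2 ψ)) /
      ((p.2 - height p.1 p.2 ψ) * (height p.1 p.2 ψ - p.1)) := div_pos (sub_pos.2 hF) hden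
  exact h1.div ((continuousAt_const.sub (hh.pow 2)).mul
    ((continuousAt_const.sub h2).div ((continuousAt_snd.sub hh).mul (hh.sub continuousAt_fst))
      hden.ne').sqrt) (mul_ne_zero (sub_pos.2 hr1).ne' (Real.sqrt_pos.2 h3).ne')

lemma ae_mem_Ioo_of_mem_uIoc :
    ∀ᵐ ψ : ℝ, ψ ∈ uIoc (-(π / 2)) (π / 2) → -1 < sin ψ ∧ sin ψ < 1 := by
  have : ∀ᵐ ψ : ℝ, ψ ≠ π / 2 := by simp [ae_iff]
  filter_upwards [this] with ψ hne hψ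
  rw [uIoc_of_le (by linarith [pi_pos])] at hψ
  exact abs_sin_lt_one_of_mem ⟨hψ.1, lt_of_le_of_ne hψ.2 hne⟩

/-- Dominated convergence. The phase ψ makes this possible: (b-r)(r-a) = ((b-a)/2 · cos ψ)² cancels
the singularity of dr/√(1-F) at the turning points and fixes the interval of integration. -/
lemma tendsto_halfAngle (hH : 0 < H) {l : Filter ℝ} [l.IsCountablyGenerated] {β : ℝ → ℝ}
    (h : ∀ᶠ a in l, TurningPoints q H a (β a)) {f : ℝ → ℝ}
    (hf : ∀ ψ, -1 < sin ψ ∧ sin ψ < 1 → Tendsto (fun a => angleDensity q H a (β a) ψ) l (𝓝 (f ψ))) :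
    Tendsto (fun a => ∫ ψ in -(π / 2)..π / 2, angleDensity q H a (β a) ψ) l
      (𝓝 (∫ ψ in -(π / 2)..π / 2, f ψ)) := by
  refine intervalIntegral.tendsto_integral_filter_of_dominated_convergence
    (fun _ => 1 / (1 - radius (√H) ^ 2))
    (Eventually.of_forall fun a => measurable_angleDensity.aestronglyMeasurable) ?_
    intervalIntegrable_const ?_
  · filter_upwards [h] with a ha
    filter_upwards [ae_mem_Ioo_of_mem_uIoc] with ψ hψ hm
    exact ha.norm_angleDensity_le hH (hψ hm)
  · filter_upwards [ae_mem_Ioo_of_mem_uIoc] with ψ hψ hm using hf ψ (hψ hm)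

lemma TurningPoints.continuousAt_angleDensity (hH : 0 < H) (h : TurningPoints q H a b)
    (hψ : -1 < sin ψ ∧ sin ψ < 1) :
    ContinuousAt (fun p : ℝ × ℝ => angleDensity q H p.1 p.2 ψ) (a, b) := by
  have hr := height_mem_Ioo h.lt hψ
  have h0 : 0 < height a b ψ := h.pos.trans hr.1
  have h1 := hr.2.trans (h.lt_one hH)
  exact Rotational.continuousAt_angleDensity (p := (a, b)) h0.ne' (by simp only; nlinarith)
    (mul_pos (sub_pos.2 hr.2) (sub_pos.2 hr.1)) (h.potential_lt_one hH hr)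

/-- The angle density of the limit as the inner turning point tends to the axis. -/
lemma angleDensity_zero (hH : 0 < H) {ψ : ℝ} (hψ : -1 < sin ψ ∧ sin ψ < 1) :
    angleDensity (q + 1) H 0 (radius (√H)) ψ =
      √√H * height 0 (radius (√H)) ψ / ((1 - height 0 (radius (√H)) ψ ^ 2) *
        √((1 - (1 + √H) * height 0 (radius (√H)) ψ ^ 2) /
          ((radius (√H) - height 0 (radius (√H)) ψ) * height 0 (radius (√H)) ψ))) := by
  have hr := height_mem_Ioo (radius_pos (Real.sqrt_pos.2 hH)) hψ
  set r := height 0 (radius (√H)) ψ with hrdef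
  have e : √(radicand (q + 1) H (energyConst (q + 1) H 0) r) = √H * r ^ 2 := by
    rw [energyConst_zero, radicand, zero_div, zero_add, Real.sqrt_mul hH.le,
      show r ^ 4 = (r ^ 2) ^ 2 by ring, Real.sqrt_sq (by positivity)]
  rw [angleDensity, ← hrdef, normalComp, potential, e, Real.sqrt_mul (Real.sqrt_nonneg _),
    Real.sqrt_sq hr.1.le, sub_zero]
  congr 5
  ring

/-- For C = 0 one has g = H^(1/4) r, so the profile is a circle of curvature H^(1/4) meeting the
axis orthogonally, and the integral is its geodesic radius. The density has an explicit primitive,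
which vanishes at the outer end because (1+√H)R² = 1. -/
lemma integral_angleDensity_zero (hH : 0 < H) :
    ∫ ψ in -(π / 2)..π / 2, angleDensity (q + 1) H 0 (radius (√H)) ψ = arctan (1 / √√H) := by
  have hs := Real.sqrt_pos.2 hH
  have hss := Real.sqrt_pos.2 hs
  have hR := radius_pos hs
  have hR2 := radius_sq_mul hs
  set R := radius (√H) with hRdef
  have hle : -(π / 2) ≤ π / 2 := by linarith [pi_pos]
  have hnn : ∀ ψ ∈ Ioo (-(π / 2)) (π / 2), 0 ≤ angleDensity (q + 1) H 0 R ψ := fun ψ hψ => by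
    have hs1 := abs_sin_lt_one_of_mem hψ
    have hr := height_mem_Ioo hR hs1
    rw [angleDensity_zero hH hs1]
    have : 0 < 1 - height 0 R ψ ^ 2 := by
      have := radius_lt_one hs
      nlinarith [hr.1, hr.2]
    have := hr.1
    positivity
  have hcont : ContinuousOn (fun ψ => -arctan (√(1 - (1 + √H) * height 0 R ψ ^ 2) / √√H))
      (Icc (-(π / 2)) (π / 2)) := by
    unfold height
    fun_prop
  have hder : ∀ ψ ∈ Ioo (-(π / 2)) (π / 2),
      HasDerivAt (fun ψ => -arctan (√(1 - (1 + √H) * height 0 R ψ ^ 2) / √√H))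
        (angleDensity (q + 1) H 0 R ψ) ψ := fun ψ hψ => by
    have hs1 := abs_sin_lt_one_of_mem hψ
    have hr := height_mem_Ioo hR hs1
    have hcos := cos_pos_of_mem_Ioo hψ
    have hd : HasDerivAt (height 0 R) (R / 2 * cos ψ) ψ := by
      have := ((hasDerivAt_sin ψ).const_mul ((R - 0) / 2)).const_add ((0 + R) / 2)
      exact this.congr_deriv (by ring)
    have hrdef : height 0 R ψ = R / 2 * (1 + sin ψ) := by unfold height; ring
    rw [angleDensity_zero hH hs1]
    set r := height 0 R ψ with hr'
    have hw : 0 < 1 - (1 + √H) * r ^ 2 := by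
      have : r ^ 2 < R ^ 2 := by nlinarith [hr.1, hr.2]
      nlinarith
    have hR1 := radius_lt_one hs
    have h1r : 0 < 1 - r ^ 2 := by nlinarith [hr.1, hr.2]
    have h2 := ((((hd.pow 2).const_mul (1 + √H)).const_sub 1).sqrt hw.ne').div_const (√√H)
    refine (h2.arctan.neg).congr_deriv ?_
    have hcos2 : cos ψ ^ 2 * (R / 2) ^ 2 = (R - r) * r := by
      rw [hrdef, Real.cos_sq']; ring
    have hq : √((1 - (1 + √H) * r ^ 2) / ((R - r) * r)) =
        √(1 - (1 + √H) * r ^ 2) / (cos ψ * (R / 2)) := by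
      rw [← hcos2, Real.sqrt_div hw.le, ← mul_pow, Real.sqrt_sq (by positivity)]
    rw [hq]
    have hwsq := Real.sq_sqrt hw.le
    have hssq := Real.sq_sqrt hs.le
    have hne : 1 + (√(1 - (1 + √H) * r ^ 2) / √√H) ^ 2 = (1 + √H) * (1 - r ^ 2) / √H := by
      rw [div_pow, hwsq, hssq]; field_simp; ring
    simp only [Nat.cast_ofNat, Nat.add_one_sub_one, pow_one, Pi.pow_apply, ← hr']
    rw [hne]
    have hw' := Real.sqrt_pos.2 hw
    set w := √(1 - (1 + √H) * r ^ 2)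
    set h := √√H
    rw [← hssq]
    field_simp
  -- Integrability comes from the nonnegativity of the density and the continuity of its primitive
  -- up to the endpoints.
  have hint : IntervalIntegrable (angleDensity (q + 1) H 0 R) volume (-(π / 2)) (π / 2) :=
    intervalIntegral.intervalIntegrable_deriv_of_nonneg (by rwa [uIcc_of_le hle])
      (by simpa [min_eq_left hle, max_eq_right hle] using hder)
      (by simpa [min_eq_left hle, max_eq_right hle] using hnn)
  rw [intervalIntegral.integral_eq_sub_of_hasDeriv_right_of_le hle hcont
    (fun ψ hψ => (hder ψ hψ).hasDerivWithinAt) hint]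
  have e1 : height 0 R (π / 2) = R := by simp [height]
  have e2 : height 0 R (-(π / 2)) = 0 := by simp [height]
  rw [e1, e2, show (1 + √H) * R ^ 2 = 1 by linarith]
  simp

/-- The equilibrium quadratic determines the second derivative of the potential there. -/
lemma potentialDD_radius (hτ : 0 < τ) (hq : (q + 1) * τ ^ 2 - 4 * τ = (q + 5) * H) :
    potentialDD (q + 1) H (energyConst (q + 1) H (radius τ)) (radius τ) =
      2 * ((1 + τ) * ((q + 1) - 2 / τ)) := by
  have h0 := radius_pos hτ
  have h1 := radius_sq_mul hτ
  have hr1 := radius_lt_one hτ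
  set r := radius τ
  have hX : 0 < 1 - r ^ 2 := by nlinarith
  have hτr : 1 - r ^ 2 = τ * r ^ 2 := by linarith
  have hrad := radicand_energyConst (q := q + 1) (H := H) h0.ne'
  have hn : (q:ℝ) + 5 ≠ 0 := by positivity
  have hHval : H = ((q + 1) * τ ^ 2 - 4 * τ) / (q + 5) := by rw [hq]; field_simp
  have hD : radicandD (q + 1) H (energyConst (q + 1) H r) r = -4 * τ * r ^ 3 := by
    have : radicandD (q + 1) H (energyConst (q + 1) H r) r =
        (-(q + 1) * ((1 - r ^ 2) ^ 2 - H * r ^ 4) + 4 * H * r ^ 4) / r := by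
      unfold radicandD energyConst
      push_cast
      field_simp
      ring
    rw [this, hτr, hHval]
    field_simp
    ring
  have hDD : radicandDD (q + 1) H (energyConst (q + 1) H r) r =
      r ^ 2 * ((q + 1) * (q + 2) * (τ ^ 2 - H) + 12 * H) := by
    have : radicandDD (q + 1) H (energyConst (q + 1) H r) r =
        ((q + 1) * (q + 2) * ((1 - r ^ 2) ^ 2 - H * r ^ 4) + 12 * H * r ^ 4) / r ^ 2 := by
      unfold radicandDD energyConst
      push_cast
      field_simp
      ring
    rw [this, hτr]
    field_simp
  rw [potentialDD, hrad, hD, hDD, Real.sqrt_sq hX.le, hτr, hHval]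
  field_simp
  ring

/-- Small oscillations: the quotient tends to F''/2 at the equilibrium, so the density tends to the
constant 1/√((1-r²)F''/2) for every phase, and (1-r²)F''/2 = (q+1)τ - 2 there. -/
lemma tendsto_halfAngle_radius (hH : 0 < H) (hτ : 0 < τ)
    (hq : (q + 1) * τ ^ 2 - 4 * τ = (q + 5) * H) {β : ℝ → ℝ}
    (hβ : Tendsto β (𝓝[<] radius τ) (𝓝 (radius τ)))
    (hT : ∀ a ∈ Ioo 0 (radius τ), TurningPoints (q + 1) H a (β a)) :
    Tendsto (fun a => ∫ ψ in -(π / 2)..π / 2, angleDensity (q + 1) H a (β a) ψ) (𝓝[<] radius τ)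
      (𝓝 (π / √((q + 1) * τ - 2))) := by
  have h0 := radius_pos hτ
  have h1 := radius_sq_mul hτ
  have hr1 := radius_lt_one hτ
  have hX : 0 < 1 - radius τ ^ 2 := by nlinarith
  have hrad := radicand_energyConst (q := q + 1) (H := H) h0.ne'
  have hpos : 0 < (q + 1) * τ - 2 := by
    have : (0:ℝ) < (q + 5) * H := by positivity
    nlinarith
  have hev : ∀ᶠ a in 𝓝[<] radius τ, a ∈ Ioo 0 (radius τ) := Ioo_mem_nhdsLT h0
  have hTe : ∀ᶠ a in 𝓝[<] radius τ, TurningPoints (q + 1) H a (β a) := hev.mono hT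
  have ha : Tendsto (fun a : ℝ => a) (𝓝[<] radius τ) (𝓝 (radius τ)) :=
    tendsto_id.mono_left nhdsWithin_le_nhds
  have hc : Tendsto (fun a => energyConst (q + 1) H a) (𝓝[<] radius τ)
      (𝓝 (energyConst (q + 1) H (radius τ))) :=
    (continuous_energyConst.tendsto _).comp ha
  set v := √(1 - radius τ ^ 2) / ((1 - radius τ ^ 2) *
    √(potentialDD (q + 1) H (energyConst (q + 1) H (radius τ)) (radius τ) / 2)) with hv
  have hval : ∫ _ in -(π / 2)..π / 2, v = π / √((q + 1) * τ - 2) := by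
    rw [intervalIntegral.integral_const, smul_eq_mul, hv, potentialDD_radius hτ hq]
    have e : √((q + 1) * τ - 2) = √(1 - radius τ ^ 2) * √(2 * ((1 + τ) * ((q + 1) - 2 / τ)) / 2) := by
      rw [← Real.sqrt_mul hX.le]
      congr 1
      rw [radius_sq hτ]; field_simp; ring
    have hs := Real.sqrt_pos.2 hX
    have hs2 : 0 < √(2 * ((1 + τ) * ((q + 1) - 2 / τ)) / 2) :=
      pos_of_mul_pos_right (e ▸ Real.sqrt_pos.2 hpos) hs.le
    rw [e]
    nth_rewrite 2 [← Real.sq_sqrt hX.le]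
    field_simp
    ring
  rw [← hval]
  refine tendsto_halfAngle hH hTe fun ψ hψ => ?_
  have hh : Tendsto (fun a => height a (β a) ψ) (𝓝[<] radius τ) (𝓝 (radius τ)) := by
    have := ((ha.add hβ).div_const 2).add (((hβ.sub ha).div_const 2).mul_const (sin ψ))
    simpa [height] using this
  have hn : Tendsto (fun a => normalComp (q + 1) H (energyConst (q + 1) H a) (height a (β a) ψ))
      (𝓝[<] radius τ) (𝓝 √(1 - radius τ ^ 2)) := by
    have := (continuousAt_normalComp (q := q + 1) (H := H)
      (p := (energyConst (q + 1) H (radius τ), radius τ)) h0.ne').tendsto.comp (hc.prodMk_nhds hh)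
    simpa only [Function.comp_def, normalComp, hrad, Real.sqrt_sq hX.le] using this
  have hquot : ∀ a ∈ Ioo 0 (radius τ), ∃ ξ ∈ Ioo a (β a),
      (1 - potential (q + 1) H (energyConst (q + 1) H a) (height a (β a) ψ)) /
        ((β a - height a (β a) ψ) * (height a (β a) ψ - a)) =
      potentialDD (q + 1) H (energyConst (q + 1) H a) ξ / 2 := fun a hm =>
    (hT a hm).exists_quotient_eq hH (height_mem_Ioo (hT a hm).lt hψ)
  choose! ξ hξ hξe using hquot
  have hξt : Tendsto ξ (𝓝[<] radius τ) (𝓝 (radius τ)) :=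
    tendsto_of_tendsto_of_tendsto_of_le_of_le' ha hβ (hev.mono fun a hm => (hξ a hm).1.le)
      (hev.mono fun a hm => (hξ a hm).2.le)
  have hD : Tendsto (fun a => (1 - potential (q + 1) H (energyConst (q + 1) H a) (height a (β a) ψ)) /
        ((β a - height a (β a) ψ) * (height a (β a) ψ - a))) (𝓝[<] radius τ)
      (𝓝 (potentialDD (q + 1) H (energyConst (q + 1) H (radius τ)) (radius τ) / 2)) := by
    have h2 := (continuousAt_potentialDD (q := q + 1) (H := H)
      (p := (energyConst (q + 1) H (radius τ), radius τ)) h0.ne' (by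
        rw [hrad]; positivity)).tendsto.comp (hc.prodMk_nhds hξt)
    refine (h2.div_const 2).congr' ?_
    filter_upwards [hev] with a hm using (hξe a hm).symm
  have hDpos : 0 < potentialDD (q + 1) H (energyConst (q + 1) H (radius τ)) (radius τ) / 2 := by
    rw [potentialDD_radius hτ hq]
    have : (q + 1) - 2 / τ = ((q + 1) * τ - 2) / τ := by field_simp
    rw [this]
    positivity
  exact hn.div (((hh.pow 2).const_sub 1).mul hD.sqrt)
    (mul_ne_zero hX.ne' (Real.sqrt_pos.2 hDpos).ne')

/-- The radicand is singular at r = 0, but at an interior phase the limiting height is positive, so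
the density is continuous at the degenerate pair (0, `radius (√H)`). -/
lemma tendsto_halfAngle_zero (hH : 0 < H) {β : ℝ → ℝ} {s : ℝ} (hs0 : 0 < s)
    (hβ : Tendsto β (𝓝[>] 0) (𝓝 (radius (√H))))
    (hT : ∀ a ∈ Ioo 0 s, TurningPoints (q + 1) H a (β a)) :
    Tendsto (fun a => ∫ ψ in -(π / 2)..π / 2, angleDensity (q + 1) H a (β a) ψ) (𝓝[>] 0)
      (𝓝 (arctan (1 / √√H))) := by
  rw [← integral_angleDensity_zero (q := q) hH]
  have hs := Real.sqrt_pos.2 hH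
  refine tendsto_halfAngle hH (eventually_of_mem (Ioo_mem_nhdsGT hs0) hT) fun ψ hψ => ?_
  have hr := height_mem_Ioo (radius_pos hs) hψ
  have hR1 := radius_lt_one hs
  have hR2 := radius_sq_mul hs
  have hlt : height 0 (radius √H) ψ ^ 2 < radius √H ^ 2 := by nlinarith [hr.1, hr.2]
  have hcont := Rotational.continuousAt_angleDensity (q := q + 1) (H := H) (ψ := ψ)
    (p := (0, radius (√H))) hr.1.ne' (by simp only; nlinarith)
    (mul_pos (sub_pos.2 hr.2) (sub_pos.2 hr.1)) (by
      simp only [energyConst_zero, potential, radicand, zero_div, zero_add]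
      rw [Real.sqrt_mul hH.le, show height 0 (radius √H) ψ ^ 4 = (height 0 (radius √H) ψ ^ 2) ^ 2 by
        ring, Real.sqrt_sq (by positivity)]
      nlinarith)
  have hpair : Tendsto (fun a => (a, β a)) (𝓝[>] 0) (𝓝 (0, radius (√H))) :=
    (tendsto_id.mono_left nhdsWithin_le_nhds).prodMk_nhds hβ
  exact Tendsto.comp (g := fun p : ℝ × ℝ => angleDensity (q + 1) H p.1 p.2 ψ)
    (f := fun a => (a, β a)) hcont.tendsto hpair

/-- The half angle of the profile curve takes all values between its two limits. -/
lemma exists_turningPoints_halfAngle_eq (hH : 0 < H) (hτ : 0 < τ)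
    (hq : (q + 1) * τ ^ 2 - 4 * τ = (q + 5) * H) {v : ℝ}
    (hv : v ∈ Ioo (arctan (1 / √√H)) (π / √((q + 1) * τ - 2)) ∨
      v ∈ Ioo (π / √((q + 1) * τ - 2)) (arctan (1 / √√H))) :
    ∃ a b, TurningPoints (q + 1) H a b ∧
      ∫ ψ in -(π / 2)..π / 2, angleDensity (q + 1) H a b ψ = v := by
  obtain ⟨β, hβ, hβ0, hβ1, hβm⟩ := exists_outer_turning_point hH hτ hq
  have h0 := radius_pos hτ
  have hT : ∀ a ∈ Ioo 0 (radius τ), TurningPoints (q + 1) H a (β a) := fun a ha =>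
    ⟨ha.1, ha.2.trans (hβm a ha).1.1, (hβm a ha).1.2, (hβm a ha).2⟩
  have t0 := tendsto_halfAngle_zero (q := q) hH h0 (by
    rw [← hβ0]
    exact (hβ 0 (left_mem_Icc.2 h0.le)).tendsto.mono_left
      (nhdsWithin_le_of_mem (Icc_mem_nhdsGT h0))) hT
  have t1 := tendsto_halfAngle_radius hH hτ hq (by
    have := (hβ (radius τ) (right_mem_Icc.2 h0.le)).tendsto.mono_left
      (nhdsWithin_le_of_mem (Icc_mem_nhdsLT h0))
    rwa [hβ1] at this) hT
  have hcont : ContinuousOn (fun a => ∫ ψ in -(π / 2)..π / 2, angleDensity (q + 1) H a (β a) ψ)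
      (Ioo 0 (radius τ)) := fun a ha => by
    have hm := Ioo_mem_nhds ha.1 ha.2
    refine ContinuousAt.continuousWithinAt (tendsto_halfAngle hH
      ((eventually_of_mem hm hT)) fun ψ hψ => ?_)
    have hb : ContinuousAt β a :=
      (hβ.mono Ioo_subset_Icc_self).continuousAt hm
    have hpair : Tendsto (fun a => (a, β a)) (𝓝 a) (𝓝 (a, β a)) := tendsto_id.prodMk_nhds hb
    exact Tendsto.comp (g := fun p : ℝ × ℝ => angleDensity (q + 1) H p.1 p.2 ψ)
      (f := fun a => (a, β a)) ((hT a ha).continuousAt_angleDensity hH hψ).tendsto hpair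
  have l0 : 𝓝[>] (0 : ℝ) ≤ 𝓟 (Ioo 0 (radius τ)) := le_principal_iff.2 (Ioo_mem_nhdsGT h0)
  have l1 : 𝓝[<] radius τ ≤ 𝓟 (Ioo 0 (radius τ)) := le_principal_iff.2 (Ioo_mem_nhdsLT h0)
  have key : v ∈ (fun a => ∫ ψ in -(π / 2)..π / 2, angleDensity (q + 1) H a (β a) ψ) ''
      Ioo 0 (radius τ) := by
    rcases hv with hv | hv
    · exact isPreconnected_Ioo.intermediate_value_Ioo l0 l1 hcont t0 t1 hv
    · exact isPreconnected_Ioo.intermediate_value_Ioo l1 l0 hcont t1 t0 hv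
  obtain ⟨a, ha, e⟩ := key
  exact ⟨a, β a, hT a ha, e⟩

end

/-! ### Closing up the profile curve -/

lemma contDiff_of_hasDerivAt {f f' : ℝ → ℝ} (h : ∀ x, HasDerivAt f (f' x) x)
    (hf' : ContDiff ℝ ∞ f') : ContDiff ℝ ∞ f := by
  refine contDiff_infty_iff_deriv.2 ⟨fun x => (h x).differentiableAt, ?_⟩
  rwa [show deriv f = f' from funext fun x => (h x).deriv]

/-- A positive smooth periodic function has a primitive that is a diffeomorphism of the line. -/
lemma exists_primitive_diffeo {w : ℝ → ℝ} {T : ℝ} (hw : ContDiff ℝ ∞ w) (hpos : ∀ x, 0 < w x)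
    (hper : Function.Periodic w T) (hT : 0 < T) :
    ∃ Θ Ψ : ℝ → ℝ, ContDiff ℝ ∞ Θ ∧ ContDiff ℝ ∞ Ψ ∧ (∀ x, HasDerivAt Θ (w x) x) ∧
      (∀ x, HasDerivAt Ψ (w (Ψ x))⁻¹ x) ∧ (∀ x, Ψ (Θ x) = x) ∧ (∀ x, Θ (Ψ x) = x) ∧
      ∀ x, Θ (x + T) = Θ x + ∫ y in 0..T, w y := by
  have hint : ∀ u v, IntervalIntegrable w volume u v := fun u v =>
    hw.continuous.intervalIntegrable u v
  let Θ : ℝ → ℝ := fun x => ∫ y in 0..x, w y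
  have hΘ : ∀ x, HasDerivAt Θ (w x) x := fun x =>
    intervalIntegral.integral_hasDerivAt_right (hint 0 x)
      (hw.continuous.stronglyMeasurableAtFilter _ _) hw.continuous.continuousAt
  have hsm : ContDiff ℝ ∞ Θ := contDiff_of_hasDerivAt hΘ hw
  have hmono : StrictMono Θ := strictMono_of_hasDerivAt_pos hΘ hpos
  have hsurj : Function.Surjective Θ := hsm.continuous.surjective
    (hper.tendsto_atTop_intervalIntegral_of_pos' (hint _ _) hpos hT)
    (hper.tendsto_atBot_intervalIntegral_of_pos' (hint _ _) hpos hT)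
  let e := (hmono.orderIsoOfSurjective Θ hsurj).toHomeomorph
  have he : ∀ x, e x = Θ x := fun _ => rfl
  have hright : ∀ x, Θ (e.symm x) = x := fun x => e.apply_symm_apply x
  refine ⟨Θ, e.symm, hsm, e.contDiff_symm_deriv (fun x => (hpos x).ne') hΘ hsm, hΘ, fun x => ?_,
    fun x => e.symm_apply_apply x, hright, fun x => ?_⟩
  · exact HasDerivAt.of_local_left_inverse e.symm.continuous.continuousAt (hΘ _) (hpos _).ne'
      (Eventually.of_forall hright)
  · have h1 := intervalIntegral.integral_add_adjacent_intervals (hint 0 x) (hint x (x + T))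
    have h2 := hper.intervalIntegral_add_eq x 0
    rw [zero_add] at h2
    rw [← h2]
    exact h1.symm

/-- The singularity of a divided difference is removable for analytic functions. This makes the
quotient, and with it the phase parametrization, smooth across the turning points. -/
lemma analyticAt_dslope {f : ℝ → ℝ} {a x : ℝ} (ha : AnalyticAt ℝ f a) (hx : AnalyticAt ℝ f x) :
    AnalyticAt ℝ (dslope f a) x := by
  rcases eq_or_ne x a with rfl | hne
  · obtain ⟨p, hp⟩ := ha
    exact ⟨_, hp.has_fpower_series_dslope_fslope⟩
  · have : AnalyticAt ℝ (fun y => (y - a)⁻¹ * (f y - f a)) x :=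
      ((analyticAt_id.sub analyticAt_const).inv (sub_ne_zero.2 hne)).mul (hx.sub analyticAt_const)
    refine this.congr ?_
    filter_upwards [isOpen_ne.mem_nhds hne] with y hy
    rw [dslope_of_ne _ hy, slope_def_field]
    field_simp

section
variable {q : ℕ} {H C a b r : ℝ}

lemma analyticAt_radicand (hr : r ≠ 0) : AnalyticAt ℝ (radicand q H C) r := by
  have : radicand q H C = fun r => C / r ^ q + H * r ^ 4 := rfl
  rw [this]
  exact (analyticAt_const.div (analyticAt_id.pow q) (pow_ne_zero q hr)).add
    (analyticAt_const.mul (analyticAt_id.pow 4))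

lemma analyticAt_sqrt {f : ℝ → ℝ} {x : ℝ} (hf : AnalyticAt ℝ f x) (h : 0 < f x) :
    AnalyticAt ℝ (fun y => √(f y)) x :=
  (Real.contDiffAt_sqrt h.ne').analyticAt.fun_comp hf

lemma analyticAt_normalComp (hH : 0 < H) (hC : 0 ≤ C) (hr : 0 < r) :
    AnalyticAt ℝ (normalComp q H C) r := by
  have h := radicand_pos (q := q) hH hC hr
  exact analyticAt_sqrt (analyticAt_sqrt (analyticAt_radicand hr.ne') h) (Real.sqrt_pos.2 h)

lemma analyticAt_potential (hH : 0 < H) (hC : 0 ≤ C) (hr : 0 < r) :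
    AnalyticAt ℝ (potential q H C) r :=
  (analyticAt_id.pow 2).add
    (analyticAt_sqrt (analyticAt_radicand hr.ne') (radicand_pos hH hC hr))

/-- The function `D` with `1 - potential r = (b - r) (r - a) D r`. -/
noncomputable def quotient (q : ℕ) (H a b : ℝ) : ℝ → ℝ :=
  dslope (dslope (potential q H (energyConst q H a)) a) b

namespace TurningPoints

lemma analyticAt_quotient (hH : 0 < H) (h : TurningPoints q H a b) (hr : 0 < r) :
    AnalyticAt ℝ (quotient q H a b) r := by
  have hF : ∀ x, 0 < x → AnalyticAt ℝ (potential q H (energyConst q H a)) x := fun x hx =>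
    analyticAt_potential hH (h.energy_pos hH).le hx
  exact analyticAt_dslope (analyticAt_dslope (hF a h.pos) (hF b (h.pos.trans h.lt)))
    (analyticAt_dslope (hF a h.pos) (hF r hr))

lemma one_sub_potential (hH : 0 < H) (h : TurningPoints q H a b) (r : ℝ) :
    1 - potential q H (energyConst q H a) r = (b - r) * (r - a) * quotient q H a b r := by
  have h1 := sub_smul_dslope (potential q H (energyConst q H a)) a r
  have h2 := sub_smul_dslope (dslope (potential q H (energyConst q H a)) a) b r
  have h3 : dslope (potential q H (energyConst q H a)) a b = 0 := by
    rw [dslope_of_ne _ h.lt.ne', slope_def_field, h.potential_left hH, h.potential_right hH]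
    simp
  rw [h3, smul_eq_mul] at h2
  rw [h.potential_left hH, smul_eq_mul] at h1
  unfold quotient
  linear_combination h1 + (r - a) * h2

lemma quotient_eq (hH : 0 < H) (h : TurningPoints q H a b) (hr : r ∈ Ioo a b) :
    quotient q H a b r =
      (1 - potential q H (energyConst q H a) r) / ((b - r) * (r - a)) := by
  rw [h.one_sub_potential hH, mul_div_cancel_left₀]
  exact mul_ne_zero (sub_pos.2 hr.2).ne' (sub_pos.2 hr.1).ne'

lemma quotient_pos (hH : 0 < H) (h : TurningPoints q H a b) (hr : r ∈ Icc a b) :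
    0 < quotient q H a b r := by
  have hcl : r ∈ closure (Ioo a b) := by rwa [closure_Ioo h.lt.ne]
  have hc : ContinuousWithinAt (quotient q H a b) (Ioo a b) r :=
    (h.analyticAt_quotient hH (h.pos.trans_le hr.1)).continuousAt.continuousWithinAt
  have : quotient q H a b r ∈ closure (Ici 1) := hc.mem_closure hcl fun x hx => by
    rw [mem_Ici, h.quotient_eq hH hx]
    exact h.one_le_quotient hH hx
  rw [isClosed_Ici.closure_eq, mem_Ici] at this
  linarith

end TurningPoints

/-- The data, as functions of the polar angle `t`, of a closed profile curve
`(r t, √(1 - r²) cos t, √(1 - r²) sin t)` in the unit 2-sphere: the height `r`, its derivative `p`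
with respect to arc length, minus the height `g` of the unit normal, and the curvature `μ`; the
hypersurface generated by the curve has principal curvatures `g / r` (with multiplicity `n - 1`)
and `μ`. The last fields say that its fourth mean curvature is `H`, and that `r` is not constant. -/
structure AngularProfile (n : ℕ) (H : ℝ) (r p g μ : ℝ → ℝ) : Prop where
  smooth_r : ContDiff ℝ ∞ r
  smooth_p : ContDiff ℝ ∞ p
  smooth_g : ContDiff ℝ ∞ g
  r_pos : ∀ t, 0 < r t
  g_pos : ∀ t, 0 < g t
  unit : ∀ t, r t ^ 2 + p t ^ 2 + g t ^ 2 = 1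
  deriv_r : ∀ t, HasDerivAt r ((1 - r t ^ 2) / g t * p t) t
  deriv_p : ∀ t, HasDerivAt p (-((1 - r t ^ 2) / g t * (r t + μ t * g t))) t
  deriv_g : ∀ t, HasDerivAt g ((1 - r t ^ 2) / g t * (μ t * p t)) t
  periodic_r : Function.Periodic r (2 * π)
  periodic_p : Function.Periodic p (2 * π)
  periodic_g : Function.Periodic g (2 * π)
  curvature : ∀ t, (n : ℝ) * H = (n - 4) * (g t / r t) ^ 4 + 4 * (g t / r t) ^ 3 * μ t
  curvature_lt : ∀ t, H < (g t / r t) ^ 4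
  nonconstant : ∃ t₁ t₂, g t₁ / r t₁ ≠ g t₂ / r t₂

/-- Differentiating r² + p² + g² = 1 determines the derivative of p only where cos ψ ≠ 0; density
and continuity give the rest. -/
lemma dense_cos_ne_zero : Dense {ψ : ℝ | cos ψ ≠ 0} := by
  have : {ψ : ℝ | cos ψ = 0}.Countable := by
    refine (countable_range fun k : ℤ => (2 * (k : ℝ) + 1) * π / 2).mono fun ψ hψ => ?_
    obtain ⟨k, hk⟩ := Real.cos_eq_zero_iff.1 hψ
    exact ⟨k, hk.symm⟩
  exact this.dense_compl ℝ

lemma hasDerivAt_normalComp (hH : 0 < H) (hC : 0 ≤ C) (hr : 0 < r) :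
    HasDerivAt (normalComp q H C) (radicandD q H C r / (4 * normalComp q H C r ^ 3)) r := by
  have hp := radicand_pos (q := q) hH hC hr
  have hs := Real.sqrt_pos.2 hp
  have h := ((hasDerivAt_radicand (q := q) (H := H) (C := C) hr.ne').sqrt hp.ne').sqrt hs.ne'
  refine h.congr_deriv ?_
  have hg := normalComp_pos (q := q) hH hC hr
  rw [← normalComp_sq]
  have e : √(normalComp q H C r ^ 2) = normalComp q H C r := Real.sqrt_sq hg.le
  rw [e]
  field_simp
  ring

lemma normalComp_div_pow_four (hH : 0 < H) (hC : 0 ≤ C) (hr : 0 < r) :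
    (normalComp q H C r / r) ^ 4 = C / r ^ (q + 4) + H := by
  rw [div_pow, normalComp_pow_four hH hC hr, radicand]
  field_simp
  ring

/-- The mean curvature equation with n = q+4 and μ = dg/dr, which integrates to the formula defining
`radicand`. -/
lemma curvature_identity (hH : 0 < H) (hC : 0 ≤ C) (hr : 0 < r) :
    ((q : ℝ) + 4) * H = q * (normalComp q H C r / r) ^ 4 +
      4 * (normalComp q H C r / r) ^ 3 * (radicandD q H C r / (4 * normalComp q H C r ^ 3)) := by
  have hg := normalComp_pos (q := q) hH hC hr
  rw [normalComp_div_pow_four hH hC hr, radicandD]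
  field_simp
  ring

lemma hasDerivAt_height (ψ : ℝ) : HasDerivAt (height a b) ((b - a) / 2 * cos ψ) ψ :=
  ((hasDerivAt_sin ψ).const_mul ((b - a) / 2)).const_add ((a + b) / 2)

lemma periodic_height : Function.Periodic (height a b) (2 * π) := fun ψ => by
  simp [height]

lemma contDiff_height : ContDiff ℝ ∞ (height a b) := by
  unfold height; fun_prop

lemma contDiff_comp_height {f : ℝ → ℝ} (hab : a ≤ b) (hf : ∀ x ∈ Icc a b, AnalyticAt ℝ f x) :
    ContDiff ℝ ∞ (fun ψ => f (height a b ψ)) :=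
  contDiff_iff_contDiffAt.2 fun ψ =>
    ((hf _ (height_mem_Icc hab)).contDiffAt).comp ψ contDiff_height.contDiffAt

lemma integral_symm_of_comp_sin {f : ℝ → ℝ} (hf : Continuous f)
    (hper : Function.Periodic f (2 * π)) (hsymm : ∀ ψ, f (π - ψ) = f ψ) :
    ∫ ψ in 0..2 * π, f ψ = 2 * ∫ ψ in -(π / 2)..π / 2, f ψ := by
  have h1 := hper.intervalIntegral_add_eq 0 (-(π / 2))
  have h2 := intervalIntegral.integral_add_adjacent_intervals
    (hf.intervalIntegrable (μ := volume) (-(π / 2)) (π / 2))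
    (hf.intervalIntegrable (π / 2) (-(π / 2) + 2 * π))
  have h3 := intervalIntegral.integral_comp_sub_left (a := -(π / 2)) (b := π / 2) f π
  simp only [hsymm] at h3
  rw [zero_add] at h1
  rw [h1, ← h2, show -(π / 2) + 2 * π = π - -(π / 2) by ring]
  nth_rewrite 3 [show π / 2 = π - π / 2 by ring]
  rw [← h3]
  ring

/-- A profile curve whose half angle is `π / k` closes up. -/
lemma TurningPoints.exists_angularProfile (hH : 0 < H) (h : TurningPoints q H a b) {k : ℕ}
    (hk : 0 < k) (hK : ∫ ψ in -(π / 2)..π / 2, angleDensity q H a b ψ = π / k) :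
    ∃ r p g μ, AngularProfile (q + 4) H r p g μ := by
  set C := energyConst q H a with hCdef
  have hC : 0 < C := h.energy_pos hH
  have hmem : ∀ ψ, height a b ψ ∈ Icc a b := fun ψ => height_mem_Icc h.lt.le
  have hrpos : ∀ ψ, 0 < height a b ψ := fun ψ => h.pos.trans_le (hmem ψ).1
  have hrlt : ∀ ψ, 0 < 1 - height a b ψ ^ 2 := fun ψ => by
    have := (hmem ψ).2.trans_lt (h.lt_one hH)
    nlinarith [hrpos ψ]
  have hQpos : ∀ ψ, 0 < quotient q H a b (height a b ψ) := fun ψ => h.quotient_pos hH (hmem ψ)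
  -- As functions of the phase: G is g, S = dψ/ds, P = dr/ds, m = dg/dr is the curvature μ, and w =
  -- dt/dψ is the density of the polar angle.
  let G : ℝ → ℝ := fun ψ => normalComp q H C (height a b ψ)
  let S : ℝ → ℝ := fun ψ => √(quotient q H a b (height a b ψ))
  let P : ℝ → ℝ := fun ψ => (b - a) / 2 * cos ψ * S ψ
  let m : ℝ → ℝ := fun ψ => radicandD q H C (height a b ψ) / (4 * G ψ ^ 3)
  let w : ℝ → ℝ := fun ψ => G ψ / ((1 - height a b ψ ^ 2) * S ψ)
  have hGpos : ∀ ψ, 0 < G ψ := fun ψ => normalComp_pos hH hC.le (hrpos ψ)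
  have hSpos : ∀ ψ, 0 < S ψ := fun ψ => Real.sqrt_pos.2 (hQpos ψ)
  have hwpos : ∀ ψ, 0 < w ψ := fun ψ => div_pos (hGpos ψ) (mul_pos (hrlt ψ) (hSpos ψ))
  have hGs : ContDiff ℝ ∞ G := contDiff_comp_height h.lt.le fun x hx =>
    analyticAt_normalComp hH hC.le (h.pos.trans_le hx.1)
  have hSs : ContDiff ℝ ∞ S := contDiff_comp_height (f := fun x => √(quotient q H a b x)) h.lt.le
    fun x hx => analyticAt_sqrt (h.analyticAt_quotient hH (h.pos.trans_le hx.1))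
      (h.quotient_pos hH hx)
  have hPs : ContDiff ℝ ∞ P := (contDiff_const.mul contDiff_cos).mul hSs
  have hws : ContDiff ℝ ∞ w := hGs.div ((contDiff_const.sub (contDiff_height.pow 2)).mul hSs)
    fun ψ => (mul_pos (hrlt ψ) (hSpos ψ)).ne'
  have hGper : Function.Periodic G (2 * π) := fun ψ => by simp only [G, periodic_height ψ]
  have hSper : Function.Periodic S (2 * π) := fun ψ => by simp only [S, periodic_height ψ]
  have hPper : Function.Periodic P (2 * π) := fun ψ => by simp only [P, hSper ψ, cos_periodic ψ]
  have hwper : Function.Periodic w (2 * π) := fun ψ => by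
    simp only [w, hSper ψ, hGper ψ, periodic_height ψ]
  have hGder : ∀ ψ, HasDerivAt G (m ψ * ((b - a) / 2 * cos ψ)) ψ := fun ψ =>
    (hasDerivAt_normalComp hH hC.le (hrpos ψ)).comp ψ (hasDerivAt_height ψ)
  have hunit : ∀ ψ, height a b ψ ^ 2 + P ψ ^ 2 + G ψ ^ 2 = 1 := fun ψ => by
    have e1 := h.one_sub_potential hH (height a b ψ)
    rw [potential_eq] at e1
    have e2 : S ψ ^ 2 = quotient q H a b (height a b ψ) := Real.sq_sqrt (hQpos ψ).le
    have e3 : ((b - a) / 2 * cos ψ) ^ 2 = (b - height a b ψ) * (height a b ψ - a) := by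
      rw [mul_pow, Real.cos_sq']; unfold height; ring
    have e4 : P ψ ^ 2 = (b - height a b ψ) * (height a b ψ - a) * quotient q H a b (height a b ψ) := by
      rw [← e2, ← e3, ← mul_pow]
    rw [e4, ← e1]; simp only [G]; ring
  -- The derivative of `hunit` has a factor (b-a) cos ψ; it is cancelled where cos ψ ≠ 0, and the
  -- identity extends by continuity of both sides.
  have hPd : ∀ ψ, deriv P ψ = -((height a b ψ + m ψ * G ψ) / S ψ) := by
    have hcont : Continuous fun ψ => -((height a b ψ + m ψ * G ψ) / S ψ) := by
      have hm : Continuous m := by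
        have : Continuous fun ψ => radicandD q H C (height a b ψ) :=
          continuous_iff_continuousAt.2 fun ψ =>
            (hasDerivAt_radicandD (hrpos ψ).ne').continuousAt.comp
              contDiff_height.continuous.continuousAt
        exact this.div (continuous_const.mul (hGs.continuous.pow 3)) fun ψ =>
          (mul_pos four_pos (pow_pos (hGpos ψ) 3)).ne'
      exact ((contDiff_height.continuous.add (hm.mul hGs.continuous)).div hSs.continuous
        fun ψ => (hSpos ψ).ne').neg
    refine congrFun (Continuous.ext_on dense_cos_ne_zero
      (hPs.continuous_deriv (by simp)) hcont fun ψ hψ => ?_)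
    have hd := (((hasDerivAt_height (a := a) (b := b) ψ).pow 2).add
      ((hPs.differentiable (by simp) ψ).hasDerivAt.pow 2)).add ((hGder ψ).pow 2)
    have hz := hd.unique ((hasDerivAt_const ψ (1 : ℝ)).congr_of_eventuallyEq
      (Eventually.of_forall hunit))
    have hS := hSpos ψ
    have hcos : cos ψ ≠ 0 := hψ
    have hba : b - a ≠ 0 := (sub_pos.2 h.lt).ne'
    have hz' : (b - a) * cos ψ * (S ψ * deriv P ψ + height a b ψ + m ψ * G ψ) = 0 := by
      simp only [Nat.cast_ofNat, Nat.add_one_sub_one, pow_one] at hz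
      rw [show P ψ = (b - a) / 2 * cos ψ * S ψ from rfl] at hz
      linear_combination hz
    have hz'' := (mul_eq_zero.1 hz').resolve_left (mul_ne_zero hba hcos)
    field_simp
    linarith
  have hPder : ∀ ψ, HasDerivAt P (-((height a b ψ + m ψ * G ψ) / S ψ)) ψ := fun ψ => by
    rw [← hPd ψ]; exact (hPs.differentiable (by simp) ψ).hasDerivAt
  -- Θ is the polar angle as a function of the phase and Ψ is its inverse, so composing with Ψ gives
  -- functions of the polar angle.
  obtain ⟨Θ, Ψ, -, hΨs, -, hΨ, hleft, hright, hΘper⟩ :=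
    exists_primitive_diffeo hws hwpos hwper two_pi_pos
  have hL : ∫ ψ in 0..2 * π, w ψ = 2 * π / k := by
    rw [integral_symm_of_comp_sin hws.continuous hwper (fun ψ => by
      simp only [w, G, S, height, Real.sin_pi_sub]),
      mul_div_assoc, ← hK]
    congr 1
    refine intervalIntegral.integral_congr_ae ?_
    filter_upwards [ae_mem_Ioo_of_mem_uIoc] with ψ hψ hm
    have hr := height_mem_Ioo h.lt (hψ hm)
    simp only [w, G, S, angleDensity]
    rw [h.quotient_eq hH hr]
  -- A full oscillation advances the angle by 2π/k, so one turn is k full phases; every function of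
  -- period 2π in the phase has period 2π in the angle.
  have hΨper : ∀ t, Ψ (t + 2 * π) = Ψ t + k * (2 * π) := fun t => by
    have hiter : ∀ (j : ℕ) ψ, Θ (ψ + j * (2 * π)) = Θ ψ + j * (2 * π / k) := by
      intro j
      induction j with
      | zero => simp
      | succ j ih =>
        intro ψ
        have : ψ + ((j + 1 : ℕ) : ℝ) * (2 * π) = ψ + j * (2 * π) + 2 * π := by push_cast; ring
        rw [this, hΘper, ih, hL]; push_cast; ring
    have hk' : (k : ℝ) ≠ 0 := by positivity
    have := hiter k (Ψ t)
    rw [hright, mul_div_cancel₀ _ hk'] at this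
    rw [← this, hleft]
  have hper : ∀ {f : ℝ → ℝ}, Function.Periodic f (2 * π) →
      Function.Periodic (fun t => f (Ψ t)) (2 * π) := fun {f} hf t => by
    simp only [hΨper t]
    exact hf.nat_mul k (Ψ t)
  refine ⟨fun t => height a b (Ψ t), fun t => P (Ψ t), fun t => G (Ψ t), fun t => m (Ψ t),
    contDiff_height.comp hΨs, hPs.comp hΨs, hGs.comp hΨs, fun t => hrpos _, fun t => hGpos _,
    fun t => hunit _, fun t => ?_, fun t => ?_, fun t => ?_, hper periodic_height, hper hPper,
    hper hGper, fun t => ?_, fun t => ?_, ?_⟩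
  · refine ((hasDerivAt_height (Ψ t)).comp t (hΨ t)).congr_deriv ?_
    have h1 := hGpos (Ψ t)
    have h2 := hSpos (Ψ t)
    have h3 := hrlt (Ψ t)
    simp only [w, P]
    field_simp
  · refine ((hPder (Ψ t)).comp t (hΨ t)).congr_deriv ?_
    have h1 := hGpos (Ψ t)
    have h2 := hSpos (Ψ t)
    have h3 := hrlt (Ψ t)
    simp only [w]
    field_simp
  · refine ((hGder (Ψ t)).comp t (hΨ t)).congr_deriv ?_
    have h1 := hGpos (Ψ t)
    have h2 := hSpos (Ψ t)
    have h3 := hrlt (Ψ t)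
    simp only [w, P]
    field_simp
  · have := curvature_identity (q := q) hH hC.le (hrpos (Ψ t))
    push_cast
    rw [this]
    simp only [G, m]
    ring
  · rw [normalComp_div_pow_four hH hC.le (hrpos _)]
    have := hrpos (Ψ t)
    have : 0 < C / height a b (Ψ t) ^ (q + 4) := by positivity
    linarith
  -- The two turning points: λ⁴ = C/r^(q+4) + H takes different values at r = a and r = b.
  · refine ⟨Θ (-(π / 2)), Θ (π / 2), fun he => ?_⟩
    have e1 : height a b (π / 2) = b := by simp [height]; ring
    have e2 : height a b (-(π / 2)) = a := by simp [height]; ring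
    simp only [hleft, G, e1, e2] at he
    have he4 := congrArg (· ^ 4) he
    simp only [normalComp_div_pow_four hH hC.le h.pos,
      normalComp_div_pow_four hH hC.le (h.pos.trans h.lt)] at he4
    have hlt : a ^ (q + 4) < b ^ (q + 4) := pow_lt_pow_left₀ h.lt h.pos.le (by omega)
    have := div_lt_div_of_pos_left hC (pow_pos h.pos (q + 4)) hlt
    linarith

end

/-! ### Hypersurfaces of revolution in polar coordinates -/

section embedding
variable {n : ℕ}

/-- The identification of `ℝⁿ × ℝ × ℝ` with `ℝ^(n+2)`. -/
noncomputable def join (n : ℕ) : (Euc n × ℝ × ℝ) →L[ℝ] Euc (n + 2) :=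
  LinearMap.toContinuousLinearMap
    { toFun := fun x => WithLp.toLp 2 (Fin.append (x.1 : Fin n → ℝ) ![x.2.1, x.2.2])
      map_add' := fun x y => by
        ext i
        refine Fin.addCases (fun i => ?_) (fun i => ?_) i
        · simp
        · fin_cases i <;> simp
      map_smul' := fun c x => by
        ext i
        refine Fin.addCases (fun i => ?_) (fun i => ?_) i
        · simp
        · fin_cases i <;> simp }

@[simp] lemma join_castAdd (x : Euc n × ℝ × ℝ) (i : Fin n) :
    join n x (Fin.castAdd 2 i) = x.1 i := by
  simp [join]

@[simp] lemma join_natAdd_zero (x : Euc n × ℝ × ℝ) : join n x (Fin.natAdd n 0) = x.2.1 := by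
  simp [join, Fin.append_right]

@[simp] lemma join_natAdd_one (x : Euc n × ℝ × ℝ) : join n x (Fin.natAdd n 1) = x.2.2 := by
  simp [join, Fin.append_right]

lemma inner_join (x y : Euc n × ℝ × ℝ) :
    inner ℝ (join n x) (join n y) = inner ℝ x.1 y.1 + x.2.1 * y.2.1 + x.2.2 * y.2.2 := by
  simp only [PiLp.inner_apply, Fin.sum_univ_add, Fin.sum_univ_two, join_castAdd, join_natAdd_zero,
    join_natAdd_one]
  simp
  ring

/-- The projection of `ℝ^(n+2)` onto the first `n` coordinates. -/
noncomputable def radialPart (n : ℕ) : Euc (n + 2) →L[ℝ] Euc n :=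
  LinearMap.toContinuousLinearMap
    { toFun := fun p => WithLp.toLp 2 fun i => p (Fin.castAdd 2 i)
      map_add' := fun x y => by ext i; simp
      map_smul' := fun c x => by ext i; simp }

/-- The last two coordinates of a point of `ℝ^(n+2)`, as a complex number. -/
noncomputable def axialPart (n : ℕ) : Euc (n + 2) →L[ℝ] ℂ :=
  LinearMap.toContinuousLinearMap
    { toFun := fun p => ⟨p (Fin.natAdd n 0), p (Fin.natAdd n 1)⟩
      map_add' := fun x y => by apply Complex.ext <;> simp
      map_smul' := fun c x => by apply Complex.ext <;> simp }

@[simp] lemma radialPart_join (x : Euc n × ℝ × ℝ) : radialPart n (join n x) = x.1 := by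
  ext i; simp [radialPart]

@[simp] lemma axialPart_join (x : Euc n × ℝ × ℝ) : axialPart n (join n x) = ⟨x.2.1, x.2.2⟩ := by
  simp [axialPart]

lemma join_injective : Function.Injective (join n) := fun x y h => by
  have h1 := congrArg (radialPart n) h
  have h2 := congrArg (axialPart n) h
  simp only [radialPart_join, axialPart_join, Complex.mk.injEq] at h1 h2
  exact Prod.ext h1 (Prod.ext h2.1 h2.2)

end embedding

section revolve
variable {n : ℕ} {z : ℝ → ℝ × ℝ × ℝ} {z' : ℝ × ℝ × ℝ} {u : Euc n}

/-- The hypersurface of revolution generated by the curve `z`, parametrized in polar coordinates. -/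
noncomputable def revolve (n : ℕ) (z : ℝ → ℝ × ℝ × ℝ) (u : Euc n) : Euc (n + 2) :=
  join n (((z ‖u‖).1 / ‖u‖) • u, (z ‖u‖).2)

lemma hasFDerivAt_norm (hu : u ≠ 0) :
    HasFDerivAt (fun v : Euc n => ‖v‖) (innerSL ℝ (‖u‖⁻¹ • u)) u := by
  have h := ((hasStrictFDerivAt_norm_sq u).hasFDerivAt).sqrt (pow_ne_zero 2 (norm_ne_zero_iff.2 hu))
  simp only [Real.sqrt_sq (norm_nonneg _)] at h
  refine h.congr_fderiv ?_
  ext v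
  simp
  field_simp

/-- The differential of `revolve n z` at a point where `z` has derivative `z'`. -/
noncomputable def revolveD (z₀ : ℝ) (z' : ℝ × ℝ × ℝ) (u : Euc n) : Euc n →L[ℝ] Euc (n + 2) :=
  join n ∘L ((z'.1 • (innerSL ℝ (‖u‖⁻¹ • u)).smulRight (‖u‖⁻¹ • u) + (z₀ / ‖u‖) •
    (ContinuousLinearMap.id ℝ (Euc n) - (innerSL ℝ (‖u‖⁻¹ • u)).smulRight (‖u‖⁻¹ • u))).prod
      ((innerSL ℝ (‖u‖⁻¹ • u)).smulRight z'.2))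

lemma revolveD_apply (z₀ : ℝ) (z' : ℝ × ℝ × ℝ) (u v : Euc n) :
    revolveD z₀ z' u v = join n (z'.1 • inner ℝ (‖u‖⁻¹ • u) v • (‖u‖⁻¹ • u) +
      (z₀ / ‖u‖) • (v - inner ℝ (‖u‖⁻¹ • u) v • (‖u‖⁻¹ • u)), inner ℝ (‖u‖⁻¹ • u) v • z'.2) := by
  simp only [revolveD, ContinuousLinearMap.comp_apply, ContinuousLinearMap.prod_apply,
    add_apply, smul_apply,
    sub_apply, ContinuousLinearMap.smulRight_apply, innerSL_apply_apply,
    ContinuousLinearMap.id_apply]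

lemma hasFDerivAt_revolve (hu : u ≠ 0) (hz : HasDerivAt z z' ‖u‖) :
    HasFDerivAt (revolve n z) (revolveD (z ‖u‖).1 z' u) u := by
  have hu' : ‖u‖ ≠ 0 := norm_ne_zero_iff.2 hu
  have hn := hasFDerivAt_norm hu
  have hz1 : HasDerivAt (fun t => (z t).1) z'.1 ‖u‖ :=
    HasFDerivAt.comp_hasDerivAt ‖u‖ (hasFDerivAt_fst (p := z ‖u‖)) hz
  have hz2 : HasDerivAt (fun t => (z t).2) z'.2 ‖u‖ :=
    HasFDerivAt.comp_hasDerivAt ‖u‖ (hasFDerivAt_snd (p := z ‖u‖)) hz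
  have h1 : HasDerivAt (fun t => (z t).1 / t) _ ‖u‖ := hz1.div (hasDerivAt_id ‖u‖) hu'
  have h2 := (h1.comp_hasFDerivAt u hn).smul (hasFDerivAt_id u)
  have h3 := hz2.hasFDerivAt.comp u hn
  refine (((join n).hasFDerivAt).comp u (h2.prodMk h3)).congr_fderiv ?_
  ext1 v
  rw [revolveD_apply, ContinuousLinearMap.comp_apply]
  congr 1
  refine Prod.ext ?_ ?_
  · simp only [ContinuousLinearMap.prod_apply, add_apply,
      smul_apply, ContinuousLinearMap.smulRight_apply, innerSL_apply_apply,
      ContinuousLinearMap.id_apply, id, Function.comp_apply, smul_sub, smul_smul, smul_eq_mul]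
    generalize inner ℝ (‖u‖⁻¹ • u) v = α
    match_scalars
    · simp
    · field_simp
      ring
  · simp [real_inner_smul_left, mul_smul]

lemma contDiffAt_revolve (hz : ContDiff ℝ ∞ z) (hu : u ≠ 0) : ContDiffAt ℝ ∞ (revolve n z) u := by
  have hn : ContDiffAt ℝ ∞ (fun v : Euc n => ‖v‖) u := contDiffAt_norm ℝ hu
  have hzn : ContDiffAt ℝ ∞ (fun v : Euc n => z ‖v‖) u := hz.contDiffAt.comp u hn
  exact (join n).contDiff.contDiffAt.comp u
    (((hzn.fst.div hn (norm_ne_zero_iff.2 hu)).smul contDiffAt_id).prodMk hzn.snd)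

lemma revolve_smul {t : ℝ} (ht : 0 < t) {φ : Euc n} (hφ : ‖φ‖ = 1) :
    revolve n z (t • φ) = join n ((z t).1 • φ, (z t).2) := by
  have : ‖t • φ‖ = t := by rw [norm_smul, hφ, mul_one, Real.norm_of_nonneg ht.le]
  rw [revolve, this, smul_smul, div_mul_cancel₀ _ ht.ne']

lemma exists_polar (hu : u ≠ 0) : ∃ φ : Euc n, ‖φ‖ = 1 ∧ u = ‖u‖ • φ :=
  ⟨‖u‖⁻¹ • u, norm_smul_inv_norm hu, by rw [smul_inv_smul₀ (norm_ne_zero_iff.2 hu)]⟩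

lemma revolveD_radial {t : ℝ} (ht : 0 < t) {φ : Euc n} (hφ : ‖φ‖ = 1) (z₀ : ℝ) :
    revolveD z₀ z' (t • φ) φ = join n (z'.1 • φ, z'.2) := by
  have h1 : ‖t • φ‖ = t := by rw [norm_smul, hφ, mul_one, Real.norm_of_nonneg ht.le]
  have h2 : (inner ℝ φ φ : ℝ) = 1 := by rw [real_inner_self_eq_norm_sq, hφ, one_pow]
  rw [revolveD_apply, h1, inv_smul_smul₀ ht.ne', h2]
  simp

lemma revolveD_tangential {t : ℝ} (ht : 0 < t) {φ b : Euc n} (hφ : ‖φ‖ = 1)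
    (hb : inner ℝ φ b = 0) (z₀ : ℝ) :
    revolveD z₀ z' (t • φ) b = join n ((z₀ / t) • b, 0) := by
  have h1 : ‖t • φ‖ = t := by rw [norm_smul, hφ, mul_one, Real.norm_of_nonneg ht.le]
  rw [revolveD_apply, h1, inv_smul_smul₀ ht.ne', hb]
  simp

/-- Every vector is the sum of its radial and its tangential part. -/
lemma exists_radial_decomposition {φ : Euc n} (hφ : ‖φ‖ = 1) (v : Euc n) :
    ∃ (α : ℝ) (b : Euc n), inner ℝ φ b = 0 ∧ v = α • φ + b := by
  have h2 : (inner ℝ φ φ : ℝ) = 1 := by rw [real_inner_self_eq_norm_sq, hφ, one_pow]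
  refine ⟨inner ℝ φ v, v - (inner ℝ φ v : ℝ) • φ, ?_, by simp⟩
  rw [inner_sub_right, inner_smul_right, h2]; ring

lemma revolveD_injective {t : ℝ} (ht : 0 < t) {φ : Euc n} (hφ : ‖φ‖ = 1) {z₀ : ℝ} (hz₀ : z₀ ≠ 0)
    (hz' : z' ≠ 0) : Function.Injective (revolveD z₀ z' (t • φ)) := by
  have h2 : (inner ℝ φ φ : ℝ) = 1 := by rw [real_inner_self_eq_norm_sq, hφ, one_pow]
  refine (injective_iff_map_eq_zero _).2 fun v hv => ?_
  obtain ⟨α, b, hb, rfl⟩ := exists_radial_decomposition hφ v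
  rw [map_add, map_smul, revolveD_radial ht hφ, revolveD_tangential ht hφ hb, ← map_smul,
    ← map_add] at hv
  have h0 := join_injective (hv.trans (map_zero (join n)).symm)
  have e1 := congrArg Prod.fst h0
  have e2 := congrArg Prod.snd h0
  simp only [Prod.smul_mk, Prod.mk_add_mk, Prod.fst_zero, Prod.snd_zero, add_zero] at e1 e2
  have e3 := congrArg (fun w => inner ℝ φ w) e1
  simp only [inner_add_right, inner_smul_right, h2, hb, inner_zero_right] at e3
  have hα : α = 0 := by
    by_contra hα
    have a1 : z'.1 = 0 := by simpa [hα] using e3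
    exact hz' (Prod.ext a1 ((smul_eq_zero.1 e2).resolve_left hα))
  subst hα
  simp only [zero_smul, zero_add, smul_eq_zero, div_eq_zero_iff, hz₀, ht.ne', or_self,
    false_or] at e1 ⊢
  exact e1

end revolve

/-! ### The moving frame of the profile curve -/

/-- The profile curve with height `r t` and polar angle `t`. -/
noncomputable def profileCurve (r : ℝ → ℝ) (t : ℝ) : ℝ × ℝ × ℝ :=
  (r t, √(1 - r t ^ 2) * cos t, √(1 - r t ^ 2) * sin t)

/-- The unit normal of the profile curve in the 2-sphere. -/
noncomputable def profileNormal (r p g : ℝ → ℝ) (t : ℝ) : ℝ × ℝ × ℝ :=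
  (-g t, (g t * r t * cos t - p t * sin t) / √(1 - r t ^ 2),
    (g t * r t * sin t + p t * cos t) / √(1 - r t ^ 2))

/-- The derivative of the profile curve with respect to the polar angle. -/
noncomputable def profileTangent (r p g : ℝ → ℝ) (t : ℝ) : ℝ × ℝ × ℝ :=
  ((1 - r t ^ 2) / g t * p t,
    -(√(1 - r t ^ 2) * r t * p t / g t) * cos t - √(1 - r t ^ 2) * sin t,
    -(√(1 - r t ^ 2) * r t * p t / g t) * sin t + √(1 - r t ^ 2) * cos t)

namespace AngularProfile
variable {n : ℕ} {H : ℝ} {r p g μ : ℝ → ℝ}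

lemma one_sub_sq_pos (h : AngularProfile n H r p g μ) (t : ℝ) : 0 < 1 - r t ^ 2 := by
  have := h.unit t
  have := h.g_pos t
  nlinarith [sq_nonneg (p t)]

lemma rho_pos (h : AngularProfile n H r p g μ) (t : ℝ) : 0 < √(1 - r t ^ 2) :=
  Real.sqrt_pos.2 (h.one_sub_sq_pos t)

lemma rho_sq (h : AngularProfile n H r p g μ) (t : ℝ) : √(1 - r t ^ 2) ^ 2 = 1 - r t ^ 2 :=
  Real.sq_sqrt (h.one_sub_sq_pos t).le

lemma contDiff_rho (h : AngularProfile n H r p g μ) : ContDiff ℝ ∞ fun t => √(1 - r t ^ 2) :=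
  (contDiff_const.sub (h.smooth_r.pow 2)).sqrt fun t => (h.one_sub_sq_pos t).ne'

lemma hasDerivAt_rho (h : AngularProfile n H r p g μ) (t : ℝ) :
    HasDerivAt (fun t => √(1 - r t ^ 2)) (-(√(1 - r t ^ 2) * r t * p t / g t)) t := by
  have hd := (((h.deriv_r t).pow 2).const_sub 1).sqrt (h.one_sub_sq_pos t).ne'
  refine hd.congr_deriv ?_
  have h1 := h.rho_pos t
  have h2 := h.g_pos t
  have h3 := h.rho_sq t
  simp only [Nat.cast_ofNat, Nat.add_one_sub_one, pow_one, Pi.pow_apply]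
  set s := √(1 - r t ^ 2)
  rw [← h3]
  field_simp

lemma contDiff_curve (h : AngularProfile n H r p g μ) : ContDiff ℝ ∞ (profileCurve r) :=
  h.smooth_r.prodMk ((h.contDiff_rho.mul contDiff_cos).prodMk (h.contDiff_rho.mul contDiff_sin))

lemma contDiff_normal (h : AngularProfile n H r p g μ) : ContDiff ℝ ∞ (profileNormal r p g) :=
  h.smooth_g.neg.prodMk (((((h.smooth_g.mul h.smooth_r).mul contDiff_cos).sub
    (h.smooth_p.mul contDiff_sin)).div h.contDiff_rho fun t => (h.rho_pos t).ne').prodMk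
    ((((h.smooth_g.mul h.smooth_r).mul contDiff_sin).add
    (h.smooth_p.mul contDiff_cos)).div h.contDiff_rho fun t => (h.rho_pos t).ne'))

lemma hasDerivAt_curve (h : AngularProfile n H r p g μ) (t : ℝ) :
    HasDerivAt (profileCurve r) (profileTangent r p g t) t :=
  (h.deriv_r t).prodMk ((((h.hasDerivAt_rho t).mul (hasDerivAt_cos t)).congr_deriv (by ring)).prodMk
    ((h.hasDerivAt_rho t).mul (hasDerivAt_sin t)))

/-- The Weingarten equation in the 2-sphere: μ is the geodesic curvature of the profile curve. -/
lemma hasDerivAt_normal (h : AngularProfile n H r p g μ) (t : ℝ) :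
    HasDerivAt (profileNormal r p g) (-μ t • profileTangent r p g t) t := by
  have h1 := h.rho_pos t
  have h2 := h.g_pos t
  have h3 := h.rho_sq t
  have hu := h.unit t
  refine (((h.deriv_g t).neg.congr_deriv ?_).prodMk
    (((((((h.deriv_g t).mul (h.deriv_r t)).mul (hasDerivAt_cos t)).sub
      ((h.deriv_p t).mul (hasDerivAt_sin t))).div (h.hasDerivAt_rho t) h1.ne').congr_deriv ?_).prodMk
    (((((h.deriv_g t).mul (h.deriv_r t)).mul (hasDerivAt_sin t)).add
      ((h.deriv_p t).mul (hasDerivAt_cos t))).div (h.hasDerivAt_rho t) h1.ne' |>.congr_deriv ?_)))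
  · simp only [profileTangent]; ring
  all_goals
    simp only [profileTangent, smul_eq_mul, Pi.mul_apply, Pi.sub_apply, Pi.add_apply]
    set s := √(1 - r t ^ 2)
    have hr2 : r t ^ 2 = 1 - s ^ 2 := by linarith
    have hp2 : p t ^ 2 = s ^ 2 - g t ^ 2 := by linarith
    rw [← h3]
    field_simp
    -- The two remaining goals are the cosine and the sine components, each with its own
    -- combination.
    first
    | linear_combination p t * g t * cos t * hr2 - r t * sin t * hp2
    | linear_combination p t * g t * sin t * hr2 + r t * cos t * hp2

lemma curve_periodic (h : AngularProfile n H r p g μ) :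
    Function.Periodic (profileCurve r) (2 * π) := fun t => by
  simp only [profileCurve, h.periodic_r t, cos_periodic t, sin_periodic t]

lemma normal_periodic (h : AngularProfile n H r p g μ) :
    Function.Periodic (profileNormal r p g) (2 * π) := fun t => by
  simp only [profileNormal, h.periodic_r t, h.periodic_p t, h.periodic_g t, cos_periodic t,
    sin_periodic t]

lemma curve_unit (h : AngularProfile n H r p g μ) (t : ℝ) :
    (profileCurve r t).1 ^ 2 + (profileCurve r t).2.1 ^ 2 + (profileCurve r t).2.2 ^ 2 = 1 := by
  simp only [profileCurve, mul_pow, h.rho_sq]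
  linear_combination (1 - r t ^ 2) * sin_sq_add_cos_sq t

lemma normal_unit (h : AngularProfile n H r p g μ) (t : ℝ) :
    (profileNormal r p g t).1 ^ 2 + (profileNormal r p g t).2.1 ^ 2 +
      (profileNormal r p g t).2.2 ^ 2 = 1 := by
  have h1 := (h.one_sub_sq_pos t).ne'
  simp only [profileNormal, div_pow, h.rho_sq]
  field_simp
  linear_combination (g t ^ 2 * r t ^ 2 + p t ^ 2) * sin_sq_add_cos_sq t + h.unit t

lemma curve_inner_normal (h : AngularProfile n H r p g μ) (t : ℝ) :
    (profileCurve r t).1 * (profileNormal r p g t).1 +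
      (profileCurve r t).2.1 * (profileNormal r p g t).2.1 +
      (profileCurve r t).2.2 * (profileNormal r p g t).2.2 = 0 := by
  have h1 := (h.rho_pos t).ne'
  simp only [profileCurve, profileNormal]
  field_simp
  linear_combination (g t * r t) * sin_sq_add_cos_sq t

lemma tangent_inner_normal (h : AngularProfile n H r p g μ) (t : ℝ) :
    (profileTangent r p g t).1 * (profileNormal r p g t).1 +
      (profileTangent r p g t).2.1 * (profileNormal r p g t).2.1 +
      (profileTangent r p g t).2.2 * (profileNormal r p g t).2.2 = 0 := by
  have h1 := (h.rho_pos t).ne'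
  have h2 := (h.g_pos t).ne'
  simp only [profileTangent, profileNormal]
  field_simp
  linear_combination (g t * p t * (1 - r t ^ 2)) * sin_sq_add_cos_sq t

/-- The speed is ds/dt, the inverse of dt/ds = g/(1-r²). -/
lemma tangent_norm_sq (h : AngularProfile n H r p g μ) (t : ℝ) :
    (profileTangent r p g t).1 ^ 2 + (profileTangent r p g t).2.1 ^ 2 +
      (profileTangent r p g t).2.2 ^ 2 = ((1 - r t ^ 2) / g t) ^ 2 := by
  have h2 := (h.g_pos t).ne'
  have h3 := h.rho_sq t
  have hu := h.unit t
  simp only [profileTangent]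
  set s := √(1 - r t ^ 2)
  have hr2 : r t ^ 2 = 1 - s ^ 2 := by linarith
  have hp2 : p t ^ 2 = s ^ 2 - g t ^ 2 := by linarith
  rw [← h3]
  have hc := sin_sq_add_cos_sq t
  field_simp
  linear_combination s ^ 2 * (p t ^ 2 * r t ^ 2 + g t ^ 2) * hc + s ^ 2 * p t ^ 2 * hr2 + s ^ 2 * hp2

end AngularProfile

/-! ### Polar charts: embeddedness, connectedness and compactness -/

section chart
variable {n : ℕ}

/-- A local inverse of the polar parametrization, with polar angle in `(θ - π, θ + π]`. -/
noncomputable def unroll (n : ℕ) (θ : ℝ) (q : Euc (n + 2)) : Euc n :=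
  (θ + (Complex.exp (-(θ * Complex.I)) * axialPart n q).arg) •
    (‖radialPart n q‖⁻¹ • radialPart n q)

/-- The set where `unroll n θ` is smooth. -/
def chartDomain (n : ℕ) (θ : ℝ) : Set (Euc (n + 2)) :=
  {q | radialPart n q ≠ 0 ∧ Complex.exp (-(θ * Complex.I)) * axialPart n q ∈ Complex.slitPlane}

lemma isOpen_chartDomain (θ : ℝ) : IsOpen (chartDomain n θ) :=
  (isOpen_ne_fun (radialPart n).continuous continuous_const).inter
    (Complex.isOpen_slitPlane.preimage (continuous_const.mul (axialPart n).continuous))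

lemma differentiableAt_unroll {θ : ℝ} {q : Euc (n + 2)} (hq : q ∈ chartDomain n θ) :
    DifferentiableAt ℝ (unroll n θ) q := by
  have h1 : DifferentiableAt ℝ (fun q => ‖radialPart n q‖⁻¹ • radialPart n q) q :=
    (((radialPart n).differentiableAt.norm ℝ hq.1).inv (norm_ne_zero_iff.2 hq.1)).smul
      (radialPart n).differentiableAt
  have h2 : DifferentiableAt ℝ (fun q =>
      Complex.log (Complex.exp (-(θ * Complex.I)) * axialPart n q)) q :=
    DifferentiableAt.comp (f := fun q => Complex.exp (-(θ * Complex.I)) * axialPart n q) q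
      ((Complex.differentiableAt_log hq.2).restrictScalars ℝ)
      ((axialPart n).differentiableAt.const_mul _)
  have h3 : DifferentiableAt ℝ (fun q =>
      (Complex.exp (-(θ * Complex.I)) * axialPart n q).arg) q := by
    have := Complex.imCLM.differentiableAt.comp q h2
    simpa [Function.comp_def, Complex.log_im] using this
  exact (h3.const_add θ).smul h1

lemma rotate_axialPart (θ ρ t : ℝ) (v : Euc n) :
    Complex.exp (-(θ * Complex.I)) * axialPart n (join n (v, ρ * cos t, ρ * sin t)) =
      ρ * (Complex.cos ((t - θ : ℝ) : ℂ) + Complex.sin ((t - θ : ℝ) : ℂ) * Complex.I) := by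
  have h1 : axialPart n (join n (v, ρ * cos t, ρ * sin t)) = ρ * Complex.exp (t * Complex.I) := by
    rw [axialPart_join, Complex.exp_mul_I, ← Complex.ofReal_cos, ← Complex.ofReal_sin]
    apply Complex.ext <;> simp [Complex.cos_ofReal_re, Complex.sin_ofReal_re]
  rw [h1, ← Complex.exp_mul_I, mul_left_comm, ← Complex.exp_add]
  push_cast
  ring_nf

lemma unroll_join {θ ρ t c : ℝ} (hρ : 0 < ρ) (hc : 0 < c) {φ : Euc n} (hφ : ‖φ‖ = 1)
    (ht : t - θ ∈ Ioc (-π) π) :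
    unroll n θ (join n (c • φ, ρ * cos t, ρ * sin t)) = t • φ := by
  rw [unroll, rotate_axialPart, Complex.arg_mul_cos_add_sin_mul_I hρ ht, radialPart_join,
    norm_smul, hφ, mul_one, Real.norm_of_nonneg hc.le, inv_smul_smul₀ hc.ne']
  congr 1
  ring

lemma join_mem_chartDomain_iff {θ ρ t c : ℝ} (hρ : 0 < ρ) (hc : 0 < c) {φ : Euc n} (hφ : ‖φ‖ = 1)
    (ht : t - θ ∈ Ioc (-π) π) :
    join n (c • φ, ρ * cos t, ρ * sin t) ∈ chartDomain n θ ↔ t - θ < π := by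
  have h0 : φ ≠ 0 := norm_ne_zero_iff.1 (by rw [hφ]; exact one_ne_zero)
  rw [chartDomain, mem_ofPred_eq, rotate_axialPart, Complex.mem_slitPlane_iff_arg,
    Complex.arg_mul_cos_add_sin_mul_I hρ ht, radialPart_join]
  refine ⟨fun h => lt_of_le_of_ne ht.2 h.2.1, fun h => ⟨smul_ne_zero hc.ne' h0, h.ne, ?_⟩⟩
  rw [← Complex.exp_mul_I]
  exact mul_ne_zero (Complex.ofReal_ne_zero.2 hρ.ne') (Complex.exp_ne_zero _)

end chart

/-- The hypersurface of revolution generated by the profile curve with height function `r`. -/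
noncomputable def surface (n : ℕ) (r : ℝ → ℝ) : Set (Euc (n + 2)) :=
  revolve n (profileCurve r) '' {0}ᶜ

/-- The domain of a polar chart. -/
def annulus (n : ℕ) (θ : ℝ) : Set (Euc n) := {u | ‖u‖ ∈ Ioo (θ - π) (θ + π)}

lemma isOpen_annulus (n : ℕ) (θ : ℝ) : IsOpen (annulus n θ) := isOpen_Ioo.preimage continuous_norm

lemma ne_zero_of_mem_annulus {n : ℕ} {θ : ℝ} (hθ : π ≤ θ) {u : Euc n} (hu : u ∈ annulus n θ) :
    u ≠ 0 := norm_pos_iff.1 (by have := hu.1; linarith)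

lemma hasFDerivAt_inner_left {n d : ℕ} {x ν : Euc n → Euc d} {u : Euc n} (b : Euc n)
    (hx : ContDiffAt ℝ ∞ x u) {ν' : Euc n →L[ℝ] Euc d} (hν : HasFDerivAt ν ν' u) :
    HasFDerivAt (fun w => inner ℝ (fderiv ℝ x w b) (ν w))
      ((fderivInnerCLM ℝ (fderiv ℝ x u b, ν u)).comp
        (((fderiv ℝ (fderiv ℝ x) u).flip b).prod ν')) u := by
  have h1 : HasFDerivAt (fderiv ℝ x) (fderiv ℝ (fderiv ℝ x) u) u :=
    ((hx.fderiv_right (m := ∞) (by simp)).differentiableAt (by simp)).hasFDerivAt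
  have h2 : HasFDerivAt (fun w => fderiv ℝ x w b) ((fderiv ℝ (fderiv ℝ x) u).flip b) u := by
    have := h1.clm_apply (hasFDerivAt_const b u)
    refine this.congr_fderiv ?_
    ext1 v
    simp
  exact h2.inner ℝ hν

/-- Weingarten's formula: the second fundamental form in the direction of a field that is normal
along the immersion `x`, in terms of the derivative of the field. -/
lemma inner_second_fderiv {n d : ℕ} {x ν : Euc n → Euc d} {u : Euc n} (a b : Euc n)
    (hx : ContDiffAt ℝ ∞ x u) {ν' : Euc n →L[ℝ] Euc d} (hν : HasFDerivAt ν ν' u)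
    (h0 : ∀ᶠ w in 𝓝 u, inner ℝ (fderiv ℝ x w b) (ν w) = 0) :
    inner ℝ (fderiv ℝ (fderiv ℝ x) u a b) (ν u) = -inner ℝ (fderiv ℝ x u b) (ν' a) := by
  have h1 := hasFDerivAt_inner_left b hx hν
  have h2 := h1.unique ((hasFDerivAt_const (0 : ℝ) u).congr_of_eventuallyEq h0)
  have h3 := congrArg (fun L : Euc n →L[ℝ] ℝ => L a) h2
  simp only [ContinuousLinearMap.comp_apply, ContinuousLinearMap.prod_apply, fderivInnerCLM_apply,
    ContinuousLinearMap.flip_apply, zero_apply] at h3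
  linarith

namespace AngularProfile
variable {n : ℕ} {H : ℝ} {r p g μ : ℝ → ℝ}

lemma unroll_revolve (h : AngularProfile n H r p g μ) {θ : ℝ} {u : Euc n} (hu : u ≠ 0)
    (ht : ‖u‖ - θ ∈ Ioc (-π) π) : unroll n θ (revolve n (profileCurve r) u) = u := by
  obtain ⟨φ, hφ, e⟩ := exists_polar hu
  have hpos := norm_pos_iff.2 hu
  generalize ‖u‖ = t at *
  subst e
  rw [revolve_smul hpos hφ]
  exact unroll_join (h.rho_pos t) (h.r_pos t) hφ ht

lemma revolve_mem_chartDomain (h : AngularProfile n H r p g μ) {θ : ℝ} {u : Euc n} (hu : u ≠ 0)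
    (ht : u ∈ annulus n θ) : revolve n (profileCurve r) u ∈ chartDomain n θ := by
  obtain ⟨φ, hφ, e⟩ := exists_polar hu
  have hpos := norm_pos_iff.2 hu
  simp only [annulus, mem_ofPred_eq] at ht
  generalize ‖u‖ = t at *
  subst e
  rw [revolve_smul hpos hφ]
  exact (join_mem_chartDomain_iff (h.rho_pos t) (h.r_pos t) hφ
    ⟨by linarith [ht.1], by linarith [ht.2]⟩).2 (by linarith [ht.2])

/-- On the domain of a polar chart, the chart inverts the parametrization up to a multiple of the
period. -/
lemma unroll_mem_annulus (h : AngularProfile n H r p g μ) {θ : ℝ} (hθ : π ≤ θ) {u : Euc n}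
    (hu : u ≠ 0) (hm : revolve n (profileCurve r) u ∈ chartDomain n θ) :
    unroll n θ (revolve n (profileCurve r) u) ∈ annulus n θ ∧
      ∀ ζ : ℝ → ℝ × ℝ × ℝ, Function.Periodic ζ (2 * π) →
        revolve n ζ (unroll n θ (revolve n (profileCurve r) u)) = revolve n ζ u := by
  obtain ⟨φ, hφ, e⟩ := exists_polar hu
  have hpos := norm_pos_iff.2 hu
  generalize ‖u‖ = t at *
  subst e
  obtain ⟨m, hmem, -⟩ := existsUnique_sub_zsmul_mem_Ioc two_pi_pos t (θ - π)
  simp only [zsmul_eq_mul] at hmem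
  have hper : ∀ ζ : ℝ → ℝ × ℝ × ℝ, Function.Periodic ζ (2 * π) → ζ (t - m * (2 * π)) = ζ t :=
    fun ζ hζ => hζ.sub_int_mul_eq m
  set s := t - m * (2 * π)
  have hs : 0 < s := by linarith [hmem.1]
  have hs2 : s - θ ∈ Ioc (-π) π := ⟨by linarith [hmem.1], by linarith [hmem.2]⟩
  have hz := hper _ h.curve_periodic
  have e : revolve n (profileCurve r) (t • φ) =
      join n (r s • φ, √(1 - r s ^ 2) * cos s, √(1 - r s ^ 2) * sin s) := by
    rw [revolve_smul hpos hφ, ← hz]; rfl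
  rw [e] at hm ⊢
  rw [unroll_join (h.rho_pos s) (h.r_pos s) hφ hs2]
  -- The representative s lies in a half-open interval; its right end is excluded because argument π
  -- lies on the cut of the slit plane.
  have hlt := (join_mem_chartDomain_iff (h.rho_pos s) (h.r_pos s) hφ hs2).1 hm
  refine ⟨?_, fun ζ hζ => ?_⟩
  · rw [annulus, mem_ofPred_eq, norm_smul, hφ, mul_one, Real.norm_of_nonneg hs.le]
    exact ⟨hmem.1, by linarith⟩
  · rw [revolve_smul hs hφ, revolve_smul hpos hφ, hper ζ hζ]

/-- Each point of the surface is the center of a polar chart. -/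
lemma exists_large_preimage {u : Euc n} (hu : u ≠ 0) :
    ∃ u' : Euc n, u' ≠ 0 ∧ ‖u'‖ = ‖u‖ + 2 * π ∧ ∀ ζ : ℝ → ℝ × ℝ × ℝ,
      Function.Periodic ζ (2 * π) → revolve n ζ u' = revolve n ζ u := by
  obtain ⟨φ, hφ, e⟩ := exists_polar hu
  have hpos := norm_pos_iff.2 hu
  generalize ‖u‖ = t at *
  subst e
  have h2 : 0 < t + 2 * π := by linarith [pi_pos]
  have h0 : φ ≠ 0 := norm_ne_zero_iff.1 (by rw [hφ]; exact one_ne_zero)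
  refine ⟨(t + 2 * π) • φ, smul_ne_zero h2.ne' h0, ?_, fun ζ hζ => ?_⟩
  · rw [norm_smul, hφ, mul_one, Real.norm_of_nonneg h2.le]
  · rw [revolve_smul h2 hφ, revolve_smul hpos hφ, hζ t]

lemma join_mem_surface (h : AngularProfile n H r p g μ) (t : ℝ) {φ : Euc n} (hφ : ‖φ‖ = 1) :
    join n ((profileCurve r t).1 • φ, (profileCurve r t).2) ∈ surface n r := by
  obtain ⟨m, hmem, -⟩ := existsUnique_sub_zsmul_mem_Ioc two_pi_pos t 0
  simp only [zsmul_eq_mul] at hmem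
  have h0 : φ ≠ 0 := norm_ne_zero_iff.1 (by rw [hφ]; exact one_ne_zero)
  refine ⟨(t - m * (2 * π)) • φ, smul_ne_zero hmem.1.ne' h0, ?_⟩
  rw [revolve_smul hmem.1 hφ, h.curve_periodic.sub_int_mul_eq m]

/-- Preimages of one point lie on a ray and their norms differ by a multiple of 2π. So every
2π-periodic curve, the normal in particular, gives a well-defined field on the surface. -/
lemma revolve_eq_of_eq (h : AngularProfile n H r p g μ) {u v : Euc n} (hu : u ≠ 0) (hv : v ≠ 0)
    (e : revolve n (profileCurve r) u = revolve n (profileCurve r) v) {ζ : ℝ → ℝ × ℝ × ℝ}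
    (hζ : Function.Periodic ζ (2 * π)) : revolve n ζ u = revolve n ζ v := by
  obtain ⟨u', hu', hn, hp⟩ := exists_large_preimage hu
  have hm : revolve n (profileCurve r) u ∈ chartDomain n ‖u'‖ := by
    rw [← hp _ h.curve_periodic]
    exact h.revolve_mem_chartDomain hu' ⟨by linarith [pi_pos], by linarith [pi_pos]⟩
  have hθ : π ≤ ‖u'‖ := by linarith [pi_pos, norm_nonneg u]
  rw [← (h.unroll_mem_annulus hθ hu hm).2 ζ hζ, ← (h.unroll_mem_annulus hθ hv (e ▸ hm)).2 ζ hζ, e]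

lemma tangent_ne_zero (h : AngularProfile n H r p g μ) (t : ℝ) : profileTangent r p g t ≠ 0 :=
  fun e => by
  have h1 := h.tangent_norm_sq t
  have h2 := div_pos (h.one_sub_sq_pos t) (h.g_pos t)
  rw [e] at h1
  have := pow_pos h2 2
  simp at h1
  simp [← h1] at this

lemma fderiv_revolve (h : AngularProfile n H r p g μ) {u : Euc n} (hu : u ≠ 0) :
    fderiv ℝ (revolve n (profileCurve r)) u = revolveD (r ‖u‖) (profileTangent r p g ‖u‖) u :=
  (hasFDerivAt_revolve hu (h.hasDerivAt_curve ‖u‖)).fderiv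

/-- The annulus covers exactly one period of the polar angle, except for one slice, and `unroll n θ`
inverts the parametrization there. The condition π ≤ θ keeps the annulus away from the origin. -/
lemma isLocalParam (h : AngularProfile n H r p g μ) {θ : ℝ} (hθ : π ≤ θ) :
    IsLocalParam n (surface n r) (annulus n θ) (revolve n (profileCurve r)) where
  isOpen_source := isOpen_annulus n θ
  smooth u hu :=
    (contDiffAt_revolve h.contDiff_curve (ne_zero_of_mem_annulus hθ hu)).contDiffWithinAt
  immersion u hu := by
    have h0 := ne_zero_of_mem_annulus hθ hu
    rw [h.fderiv_revolve h0]
    obtain ⟨φ, hφ, e⟩ := exists_polar h0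
    have hpos := norm_pos_iff.2 h0
    generalize ‖u‖ = t at *
    subst e
    exact revolveD_injective hpos hφ (h.r_pos t).ne' (h.tangent_ne_zero t)
  injOn u hu v hv e := by
    have h1 := h.unroll_revolve (ne_zero_of_mem_annulus hθ hu) (θ := θ)
      ⟨by linarith [hu.1], by linarith [hu.2]⟩
    have h2 := h.unroll_revolve (ne_zero_of_mem_annulus hθ hv) (θ := θ)
      ⟨by linarith [hv.1], by linarith [hv.2]⟩
    rw [← h1, e, h2]
  relOpen W hW hWU := by
    refine ⟨chartDomain n θ ∩ unroll n θ ⁻¹' W, ?_, ?_⟩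
    · exact ContinuousOn.isOpen_inter_preimage (fun q hq =>
        (differentiableAt_unroll hq).continuousAt.continuousWithinAt) (isOpen_chartDomain θ) hW
    · ext q
      constructor
      · rintro ⟨u, hu, rfl⟩
        have h0 := ne_zero_of_mem_annulus hθ (hWU hu)
        refine ⟨⟨u, h0, rfl⟩, h.revolve_mem_chartDomain h0 (hWU hu), ?_⟩
        have h1 := h.unroll_revolve h0 (θ := θ)
          ⟨by linarith [(hWU hu).1], by linarith [(hWU hu).2]⟩
        rwa [mem_preimage, h1]
      · rintro ⟨⟨u, h0, rfl⟩, hq, hW'⟩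
        exact ⟨_, hW', (h.unroll_mem_annulus hθ h0 hq).2 _ h.curve_periodic⟩

lemma revolve_unit (h : AngularProfile n H r p g μ) {u : Euc n} (hu : u ≠ 0) :
    ‖revolve n (profileCurve r) u‖ = 1 := by
  obtain ⟨φ, hφ, e⟩ := exists_polar hu
  have hpos := norm_pos_iff.2 hu
  generalize ‖u‖ = t at *
  subst e
  have h2 : (inner ℝ φ φ : ℝ) = 1 := by rw [real_inner_self_eq_norm_sq, hφ, one_pow]
  rw [← sq_eq_sq₀ (norm_nonneg _) zero_le_one, ← real_inner_self_eq_norm_sq, revolve_smul hpos hφ,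
    inner_join, real_inner_smul_left, real_inner_smul_right, h2]
  linear_combination h.curve_unit t

lemma isEmbeddedHypersurface (h : AngularProfile n H r p g μ) :
    IsEmbeddedHypersurface n (surface n r) := by
  refine ⟨?_, ?_⟩
  · rintro _ ⟨u, hu, rfl⟩
    simpa using h.revolve_unit hu
  · rintro _ ⟨u, hu, rfl⟩
    obtain ⟨u', -, hn, hp⟩ := exists_large_preimage hu
    have hθ : π ≤ ‖u'‖ := by linarith [pi_pos, norm_nonneg u]
    exact ⟨_, _, h.isLocalParam hθ, u', ⟨by linarith [pi_pos], by linarith [pi_pos]⟩,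
      hp _ h.curve_periodic⟩

lemma isConnected_surface (h : AngularProfile n H r p g μ) (hn : 2 ≤ n) :
    IsConnected (surface n r) := by
  refine (isConnected_compl_singleton_of_one_lt_rank ?_ (0 : Euc n)).image _ fun u hu =>
    (contDiffAt_revolve h.contDiff_curve hu).continuousAt.continuousWithinAt
  rw [← Module.finrank_eq_rank, finrank_euclideanSpace_fin]
  exact_mod_cast hn

lemma isCompact_surface (h : AngularProfile n H r p g μ) : IsCompact (surface n r) := by
  -- One full period of radii, chosen away from the origin, where polar coordinates are singular.
  have hK : IsCompact {u : Euc n | ‖u‖ ∈ Icc (2 * π) (4 * π)} := by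
    refine Metric.isCompact_of_isClosed_isBounded (isClosed_Icc.preimage continuous_norm) ?_
    exact (Metric.isBounded_closedBall (x := (0 : Euc n)) (r := 4 * π)).subset fun u hu => by
      simpa using hu.2
  have h0 : ∀ u ∈ {u : Euc n | ‖u‖ ∈ Icc (2 * π) (4 * π)}, u ≠ 0 := fun u hu =>
    norm_pos_iff.1 (two_pi_pos.trans_le hu.1)
  have e : surface n r = revolve n (profileCurve r) '' {u : Euc n | ‖u‖ ∈ Icc (2 * π) (4 * π)} := by
    refine Subset.antisymm ?_ (image_mono h0)
    rintro _ ⟨u, hu, rfl⟩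
    obtain ⟨φ, hφ, e⟩ := exists_polar hu
    have hpos := norm_pos_iff.2 hu
    generalize ‖u‖ = t at *
    subst e
    obtain ⟨m, hmem, -⟩ := existsUnique_sub_zsmul_mem_Ioc two_pi_pos t (2 * π)
    simp only [zsmul_eq_mul] at hmem
    have hs : 0 < t - m * (2 * π) := two_pi_pos.trans hmem.1
    refine ⟨(t - m * (2 * π)) • φ, ?_, ?_⟩
    · rw [mem_ofPred_eq, norm_smul, hφ, mul_one, Real.norm_of_nonneg hs.le]
      exact ⟨hmem.1.le, by linarith [hmem.2]⟩
    · rw [revolve_smul hs hφ, revolve_smul hpos hφ, h.curve_periodic.sub_int_mul_eq m]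
  rw [e]
  exact hK.image_of_continuousOn fun u hu =>
    (contDiffAt_revolve h.contDiff_curve (h0 u hu)).continuousAt.continuousWithinAt

end AngularProfile

/-! ### Principal curvatures and the fourth mean curvature -/

/-- The principal curvatures of a rotational hypersurface: the first one is `m`, the others are
`l`. -/
noncomputable def rotCurvatures {n : ℕ} [NeZero n] (m l : ℝ) (i : Fin n) : ℝ :=
  if i = 0 then m else l

/-- The subsets are split according to whether they contain the index 0, which carries the
exceptional curvature. -/
lemma sum_powersetCard_rotCurvatures {n : ℕ} [NeZero n] (d : ℕ) (m l : ℝ) :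
    ∑ s ∈ Finset.powersetCard (d + 1) (Finset.univ : Finset (Fin n)),
      ∏ i ∈ s, rotCurvatures m l i =
      ((n - 1).choose (d + 1) : ℝ) * l ^ (d + 1) + ((n - 1).choose d : ℝ) * (m * l ^ d) := by
  have hu : (Finset.univ : Finset (Fin n)) = insert 0 (Finset.univ.erase 0) :=
    (Finset.insert_erase (Finset.mem_univ 0)).symm
  have hcard : (Finset.univ.erase (0 : Fin n)).card = n - 1 := by
    rw [Finset.card_erase_of_mem (Finset.mem_univ _), Finset.card_univ, Fintype.card_fin]
  have hl : ∀ s ⊆ Finset.univ.erase (0 : Fin n), ∏ i ∈ s, rotCurvatures m l i = l ^ s.card := by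
    intro s hs
    exact Finset.prod_eq_pow_card fun i hi => if_neg (Finset.ne_of_mem_erase (hs hi))
  have h0 : ∀ s ⊆ Finset.univ.erase (0 : Fin n), (0 : Fin n) ∉ s := fun s hs h =>
    Finset.notMem_erase 0 _ (hs h)
  rw [hu, Finset.powersetCard_succ_insert (Finset.notMem_erase _ _), Finset.sum_union,
    Finset.sum_image]
  · congr 1
    · rw [Finset.sum_congr rfl fun s hs => by
        rw [hl s (Finset.mem_powersetCard.1 hs).1, (Finset.mem_powersetCard.1 hs).2],
        Finset.sum_const, Finset.card_powersetCard, hcard, nsmul_eq_mul]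
    · rw [Finset.sum_congr rfl fun s hs => by
        rw [Finset.prod_insert (h0 s (Finset.mem_powersetCard.1 hs).1),
          hl s (Finset.mem_powersetCard.1 hs).1, (Finset.mem_powersetCard.1 hs).2],
        Finset.sum_const, Finset.card_powersetCard, hcard, nsmul_eq_mul]
      simp [rotCurvatures]
  · intro s hs t ht e
    have hs' := h0 s (Finset.mem_powersetCard.1 (Finset.mem_coe.1 hs)).1
    have ht' := h0 t (Finset.mem_powersetCard.1 (Finset.mem_coe.1 ht)).1
    rw [← Finset.erase_insert hs', ← Finset.erase_insert ht']
    exact congrArg (fun w => Finset.erase w 0) e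
  · rw [Finset.disjoint_left]
    intro s hs hs'
    obtain ⟨t, -, rfl⟩ := Finset.mem_image.1 hs'
    exact h0 _ (Finset.mem_powersetCard.1 hs).1 (Finset.mem_insert_self _ _)

/-- These ratios turn the elementary symmetric function of degree 4 into the form of
`AngularProfile.curvature`. -/
lemma choose_four_mul (n : ℕ) (hn : 4 ≤ n) :
    (n : ℝ) * ((n - 1).choose 4 : ℝ) = (n - 4) * (n.choose 4 : ℝ) ∧
      (n : ℝ) * ((n - 1).choose 3 : ℝ) = 4 * (n.choose 4 : ℝ) := by
  obtain ⟨m, rfl⟩ : ∃ m, n = m + 1 := ⟨n - 1, by omega⟩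
  have h1 := Nat.add_one_mul_choose_eq m 3
  have h2 := Nat.choose_succ_succ m 3
  simp only [Nat.add_sub_cancel, Nat.succ_eq_add_one] at *
  have h1' : ((m : ℝ) + 1) * (m.choose 3 : ℝ) = ((m + 1).choose 4 : ℝ) * 4 := by exact_mod_cast h1
  have h2' : ((m + 1).choose 4 : ℝ) = (m.choose 3 : ℝ) + (m.choose 4 : ℝ) := by exact_mod_cast h2
  push_cast
  constructor
  · linear_combination -h1' - ((m : ℝ) + 1) * h2'
  · linear_combination h1'

/-- The unit normal field of the rotational hypersurface. -/
noncomputable def surfaceNormal (n : ℕ) (r p g : ℝ → ℝ) (q : Euc (n + 2)) : Euc (n + 2) :=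
  open Classical in
  if hq : q ∈ surface n r then revolve n (profileNormal r p g) hq.choose else 0

namespace AngularProfile
variable {n : ℕ} {H : ℝ} {r p g μ : ℝ → ℝ}

lemma surfaceNormal_revolve (h : AngularProfile n H r p g μ) {u : Euc n} (hu : u ≠ 0) :
    surfaceNormal n r p g (revolve n (profileCurve r) u) = revolve n (profileNormal r p g) u := by
  have hq : revolve n (profileCurve r) u ∈ surface n r := ⟨u, hu, rfl⟩
  rw [surfaceNormal, dif_pos hq]
  exact h.revolve_eq_of_eq hq.choose_spec.1 hu hq.choose_spec.2 h.normal_periodic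

lemma inner_fderiv_normal (h : AngularProfile n H r p g μ) {u : Euc n} (hu : u ≠ 0) (v : Euc n) :
    inner ℝ (fderiv ℝ (revolve n (profileCurve r)) u v)
      (revolve n (profileNormal r p g) u) = 0 := by
  rw [h.fderiv_revolve hu]
  obtain ⟨φ, hφ, e⟩ := exists_polar hu
  have hpos := norm_pos_iff.2 hu
  generalize ‖u‖ = t at *
  subst e
  have h2 : (inner ℝ φ φ : ℝ) = 1 := by rw [real_inner_self_eq_norm_sq, hφ, one_pow]
  obtain ⟨α, b, hb, rfl⟩ := exists_radial_decomposition hφ v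
  rw [map_add, map_smul, revolveD_radial hpos hφ, revolveD_tangential hpos hφ hb,
    revolve_smul hpos hφ, inner_add_left, real_inner_smul_left, inner_join, inner_join]
  simp only [real_inner_smul_left, real_inner_smul_right, h2, real_inner_comm φ b, hb,
    Prod.fst_zero, Prod.snd_zero]
  linear_combination α * h.tangent_inner_normal t

lemma normal_unit_revolve (h : AngularProfile n H r p g μ) {u : Euc n} (hu : u ≠ 0) :
    ‖revolve n (profileNormal r p g) u‖ = 1 ∧
      inner ℝ (revolve n (profileCurve r) u) (revolve n (profileNormal r p g) u) = 0 := by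
  obtain ⟨φ, hφ, e⟩ := exists_polar hu
  have hpos := norm_pos_iff.2 hu
  generalize ‖u‖ = t at *
  subst e
  have h2 : (inner ℝ φ φ : ℝ) = 1 := by rw [real_inner_self_eq_norm_sq, hφ, one_pow]
  rw [← sq_eq_sq₀ (norm_nonneg _) zero_le_one, ← real_inner_self_eq_norm_sq, revolve_smul hpos hφ,
    revolve_smul hpos hφ, inner_join, inner_join]
  simp only [real_inner_smul_left, real_inner_smul_right, h2]
  constructor
  · linear_combination h.normal_unit t
  · linear_combination h.curve_inner_normal t

/-- Around each point of the surface there is a chart inverse that is differentiable. -/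
lemma exists_chartDomain (h : AngularProfile n H r p g μ) {q : Euc (n + 2)}
    (hq : q ∈ surface n r) : ∃ θ : ℝ, q ∈ chartDomain n θ ∧
      ∀ q' ∈ surface n r ∩ chartDomain n θ, unroll n θ q' ≠ 0 ∧
        revolve n (profileCurve r) (unroll n θ q') = q' ∧
        surfaceNormal n r p g q' = revolve n (profileNormal r p g) (unroll n θ q') := by
  obtain ⟨u, hu, rfl⟩ := hq
  obtain ⟨u', hu', hn, hp⟩ := exists_large_preimage hu
  have hθ : π ≤ ‖u'‖ := by linarith [pi_pos, norm_nonneg u]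
  refine ⟨‖u'‖, ?_, ?_⟩
  · rw [← hp _ h.curve_periodic]
    exact h.revolve_mem_chartDomain hu' ⟨by linarith [pi_pos], by linarith [pi_pos]⟩
  · rintro _ ⟨⟨v, hv, rfl⟩, hc⟩
    obtain ⟨h1, h2⟩ := h.unroll_mem_annulus hθ hv hc
    exact ⟨ne_zero_of_mem_annulus hθ h1, h2 _ h.curve_periodic,
      (h.surfaceNormal_revolve hv).trans (h2 _ h.normal_periodic).symm⟩

lemma isUnitNormalField (h : AngularProfile n H r p g μ) :
    IsUnitNormalField n (surface n r) (surfaceNormal n r p g) where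
  continuousOn q hq := by
    obtain ⟨θ, hθ, hc⟩ := h.exists_chartDomain hq
    have hcont : ContinuousAt (fun q => revolve n (profileNormal r p g) (unroll n θ q)) q :=
      ContinuousAt.comp (g := revolve n (profileNormal r p g))
        (contDiffAt_revolve h.contDiff_normal (hc q ⟨hq, hθ⟩).1).continuousAt
        (differentiableAt_unroll hθ).continuousAt
    refine hcont.continuousWithinAt.congr_of_eventuallyEq ?_ (hc q ⟨hq, hθ⟩).2.2
    filter_upwards [self_mem_nhdsWithin,
      nhdsWithin_le_nhds ((isOpen_chartDomain θ).mem_nhds hθ)] with q' h1 h2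
    exact (hc q' ⟨h1, h2⟩).2.2
  norm_eq_one := by
    rintro _ ⟨u, hu, rfl⟩
    rw [h.surfaceNormal_revolve hu]
    exact (h.normal_unit_revolve hu).1
  tangent_sphere := by
    rintro _ ⟨u, hu, rfl⟩
    rw [h.surfaceNormal_revolve hu]
    exact (h.normal_unit_revolve hu).2
  normal U x hx u hu v := by
    have hxU : ∀ w ∈ U, x w ∈ surface n r := by
      obtain ⟨V, -, hV⟩ := hx.relOpen U hx.isOpen_source subset_rfl
      exact fun w hw => (hV ▸ mem_image_of_mem x hw : x w ∈ surface n r ∩ V).1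
    obtain ⟨θ, hθ, hc⟩ := h.exists_chartDomain (hxU u hu)
    have hU := hx.isOpen_source.mem_nhds hu
    have hxd : DifferentiableAt ℝ x u :=
      ((hx.smooth u hu).contDiffAt hU).differentiableAt (by simp)
    obtain ⟨h1, h2, h3⟩ := hc (x u) ⟨hxU u hu, hθ⟩
    -- An arbitrary parametrization factors locally through the polar one by means of `unroll`, so
    -- its differential takes values among the tangent vectors already known to be normal to the
    -- field.
    have hchart : HasFDerivAt (fun w => revolve n (profileCurve r) (unroll n θ (x w)))
        ((fderiv ℝ (revolve n (profileCurve r)) (unroll n θ (x u))).comp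
          (fderiv ℝ (fun w => unroll n θ (x w)) u)) u :=
      HasFDerivAt.comp (g := revolve n (profileCurve r)) u
        ((contDiffAt_revolve h.contDiff_curve h1).differentiableAt (by simp)).hasFDerivAt
        (DifferentiableAt.comp (g := unroll n θ) u (differentiableAt_unroll hθ) hxd).hasFDerivAt
    have heq : x =ᶠ[𝓝 u] fun w => revolve n (profileCurve r) (unroll n θ (x w)) := by
      filter_upwards [hU, hxd.continuousAt ((isOpen_chartDomain θ).mem_nhds hθ)] with w hw hw'
      exact (hc (x w) ⟨hxU w hw, hw'⟩).2.1.symm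
    rw [(hchart.congr_of_eventuallyEq heq).fderiv, h3]
    exact h.inner_fderiv_normal h1 _

lemma exists_principalFrame [NeZero n] (h : AngularProfile n H r p g μ) {u : Euc n} (hu : u ≠ 0) :
    ∃ e, IsPrincipalFrame (revolve n (profileCurve r)) u (revolve n (profileNormal r p g) u) e
      (rotCurvatures (μ ‖u‖) (g ‖u‖ / r ‖u‖)) := by
  have hD := h.fderiv_revolve hu
  have hN := hasFDerivAt_revolve hu (h.hasDerivAt_normal ‖u‖)
  have hx := contDiffAt_revolve h.contDiff_curve hu
  have hev : ∀ v : Euc n, ∀ᶠ w in 𝓝 u, inner ℝ (fderiv ℝ (revolve n (profileCurve r)) w v)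
      (revolve n (profileNormal r p g) w) = 0 := fun v => by
    filter_upwards [isOpen_ne.mem_nhds hu] with w hw using h.inner_fderiv_normal hw v
  obtain ⟨φ, hφ, e⟩ := exists_polar hu
  have hpos := norm_pos_iff.2 hu
  generalize ‖u‖ = t at *
  have hr := h.r_pos t
  have hg := h.g_pos t
  have hσ : 0 < (1 - r t ^ 2) / g t := div_pos (h.one_sub_sq_pos t) hg
  set σ := (1 - r t ^ 2) / g t with hσdef
  -- An orthonormal basis of the parameter space whose vector of index 0 is the radial direction φ.
  obtain ⟨b, hb⟩ := Orthonormal.exists_orthonormalBasis_extension_of_card_eq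
    (𝕜 := ℝ) (E := Euc n) (ι := Fin n) (v := fun _ => φ) (s := {0}) (by simp) (by
      refine ⟨fun i => by simpa using hφ, fun i j hij => ?_⟩
      exact (hij (Subtype.ext (i.2.trans j.2.symm))).elim)
  have hb0 : b 0 = φ := hb 0 rfl
  have horth : ∀ i j, inner ℝ (b i) (b j) = if i = j then (1 : ℝ) else 0 :=
    orthonormal_iff_ite.1 b.orthonormal
  -- The differential stretches the radial direction by the speed σ and the tangential directions by
  -- r/t; the factors undo this.
  let f : Fin n → Euc n := fun i => if i = 0 then σ⁻¹ • φ else (t / r t) • b i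
  have hf0 : f 0 = σ⁻¹ • φ := if_pos rfl
  have hfi : ∀ i, i ≠ 0 → f i = (t / r t) • b i := fun i hi => if_neg hi
  have hφi : ∀ i, i ≠ 0 → inner ℝ φ (b i) = 0 := fun i hi => by
    rw [← hb0, horth, if_neg hi.symm]
  have hD0 : fderiv ℝ (revolve n (profileCurve r)) u (f 0) =
      join n (σ⁻¹ • ((profileTangent r p g t).1 • φ, (profileTangent r p g t).2)) := by
    rw [hD, hf0, map_smul, e, revolveD_radial hpos hφ, map_smul]
  have hDi : ∀ i, i ≠ 0 → fderiv ℝ (revolve n (profileCurve r)) u (f i) = join n (b i, 0) := by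
    intro i hi
    rw [hD, hfi i hi, map_smul, e, revolveD_tangential hpos hφ (hφi i hi), ← map_smul]
    congr 1
    simp only [Prod.smul_mk, smul_zero, smul_smul]
    rw [div_mul_div_cancel₀ hr.ne', div_self hpos.ne', one_smul]
  have hon : ∀ i j, inner ℝ (fderiv ℝ (revolve n (profileCurve r)) u (f i))
      (fderiv ℝ (revolve n (profileCurve r)) u (f j)) = if i = j then (1 : ℝ) else 0 := by
    have h2 : (inner ℝ φ φ : ℝ) = 1 := by rw [real_inner_self_eq_norm_sq, hφ, one_pow]
    have h0i : ∀ i, i ≠ 0 → inner ℝ (fderiv ℝ (revolve n (profileCurve r)) u (f 0))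
        (fderiv ℝ (revolve n (profileCurve r)) u (f i)) = 0 := fun i hi => by
      rw [hD0, hDi i hi, inner_join]
      simp [real_inner_smul_left, hφi i hi]
    intro i j
    by_cases hi : i = 0
    · by_cases hj : j = 0
      · subst hi hj
        rw [hD0, inner_join, if_pos rfl]
        simp only [Prod.smul_mk, Prod.smul_fst, Prod.smul_snd, smul_eq_mul, real_inner_smul_left,
          real_inner_smul_right, h2]
        have := h.tangent_norm_sq t
        rw [← hσdef] at this
        have e1 : σ⁻¹ ^ 2 * σ ^ 2 = 1 := by field_simp
        linear_combination σ⁻¹ ^ 2 * this + e1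
      · subst hi
        rw [h0i j hj, if_neg (Ne.symm hj)]
    · by_cases hj : j = 0
      · subst hj
        rw [real_inner_comm, h0i i hi, if_neg hi]
      · rw [hDi i hi, hDi j hj, inner_join, horth]
        simp
  -- Each frame vector is principal: N' = -μγ' in the radial direction, and the r-component -g =
  -- -(g/r)·r gives the curvature g/r in the tangential directions.
  have hND : ∀ i, revolveD (profileNormal r p g t).1 (-μ t • profileTangent r p g t) u (f i) =
      -(rotCurvatures (μ t) (g t / r t) i • fderiv ℝ (revolve n (profileCurve r)) u (f i)) := by
    intro i
    by_cases hi : i = 0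
    · subst hi
      rw [hD0, hf0, map_smul, e, revolveD_radial hpos hφ, rotCurvatures, if_pos rfl, ← map_smul,
        ← map_smul, ← map_neg]
      congr 1
      simp only [Prod.smul_mk, Prod.smul_fst, Prod.smul_snd, smul_smul, smul_eq_mul, Prod.neg_mk,
        ← neg_smul]
      congr 2 <;> ring
    · rw [hDi i hi, hfi i hi, map_smul, e, revolveD_tangential hpos hφ (hφi i hi), rotCurvatures,
        if_neg hi, ← map_smul (join n), ← map_smul (join n), ← map_neg]
      congr 1
      simp only [profileNormal, Prod.smul_mk, smul_smul, smul_zero, Prod.neg_mk, neg_zero,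
        ← neg_smul]
      congr 2
      field_simp
  refine ⟨f, orthonormal_iff_ite.2 hon, fun i j => ?_⟩
  rw [inner_second_fderiv (f i) (f j) hx hN (hev _), hND, inner_neg_right, neg_neg,
    real_inner_smul_right, hon]
  by_cases hij : i = j
  · rw [if_pos hij, if_pos hij.symm, mul_one]
  · rw [if_neg hij, if_neg (Ne.symm hij), mul_zero]

lemma hasConstantMeanCurvature (h : AngularProfile n H r p g μ) (hn : 4 ≤ n) :
    HasConstantMeanCurvature n 4 (surface n r) H := by
  have : NeZero n := ⟨by omega⟩
  refine ⟨_, h.isUnitNormalField, ?_⟩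
  rintro _ ⟨u, hu, rfl⟩
  obtain ⟨u', hu', hn', hp⟩ := exists_large_preimage hu
  have hθ : π ≤ ‖u'‖ := by linarith [pi_pos, norm_nonneg u]
  obtain ⟨e, he⟩ := h.exists_principalFrame hu'
  rw [← hp _ h.curve_periodic]
  refine ⟨_, _, u', e, _, h.isLocalParam hθ, ⟨by linarith [pi_pos], by linarith [pi_pos]⟩, rfl,
    (h.surfaceNormal_revolve hu').symm ▸ he, ?_⟩
  rw [sum_powersetCard_rotCurvatures 3]
  obtain ⟨h1, h2⟩ := choose_four_mul n hn
  have hn0 : (n : ℝ) ≠ 0 := by positivity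
  have hc := h.curvature ‖u'‖
  apply mul_left_cancel₀ hn0
  set l := g ‖u'‖ / r ‖u'‖
  linear_combination (n.choose 4 : ℝ) * hc - l ^ 4 * h1 - μ ‖u'‖ * l ^ 3 * h2

end AngularProfile

/-! ### The rotational form in arc length -/

namespace AngularProfile
variable {n : ℕ} {H : ℝ} {r p g μ : ℝ → ℝ}

lemma isRotational (h : AngularProfile n H r p g μ) : IsRotational n (surface n r) := by
  have hσpos : ∀ t, 0 < (1 - r t ^ 2) / g t := fun t => div_pos (h.one_sub_sq_pos t) (h.g_pos t)
  -- S is the arc length as a function of the polar angle and τ its inverse.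
  obtain ⟨S, τ, -, hτs, -, hτ, hleft, hright, -⟩ := exists_primitive_diffeo
    (w := fun t => (1 - r t ^ 2) / g t) (T := 2 * π)
    ((contDiff_const.sub (h.smooth_r.pow 2)).div h.smooth_g fun t => (h.g_pos t).ne') hσpos
    (fun t => by simp only [h.periodic_r t, h.periodic_g t]) two_pi_pos
  let e : Euc 1 := EuclideanSpace.single 0 1
  have he : (inner ℝ e e : ℝ) = 1 := by simp [e]
  -- The isometric identification of triples with ℝ³ is `join` for n = 1, so the inner product
  -- formula applies again.
  let L : (ℝ × ℝ × ℝ) →L[ℝ] Euc 3 := (join 1).comp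
    (((ContinuousLinearMap.fst ℝ ℝ (ℝ × ℝ)).smulRight e).prod (ContinuousLinearMap.snd ℝ ℝ (ℝ × ℝ)))
  have hL : ∀ w, L w = join 1 (w.1 • e, w.2) := fun w => rfl
  have hnorm : ∀ w, ‖L w‖ ^ 2 = w.1 ^ 2 + w.2.1 ^ 2 + w.2.2 ^ 2 := fun w => by
    rw [← real_inner_self_eq_norm_sq, hL, inner_join, real_inner_smul_left, real_inner_smul_right,
      he]
    ring
  have hder : ∀ s, HasDerivAt (fun s => L (profileCurve r (τ s)))
      (L (((1 - r (τ s) ^ 2) / g (τ s))⁻¹ • profileTangent r p g (τ s))) s := fun s =>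
    L.hasFDerivAt.comp_hasDerivAt s ((h.hasDerivAt_curve (τ s)).scomp s (hτ s))
  have c0 : ∀ w, L w 0 = w.1 := fun w => by
    rw [hL, show (0 : Fin 3) = Fin.castAdd 2 (0 : Fin 1) from rfl, join_castAdd]
    simp [e]
  have c1 : ∀ w, L w 1 = w.2.1 := fun w => join_natAdd_zero _
  have c2 : ∀ w, L w 2 = w.2.2 := fun w => join_natAdd_one _
  refine ⟨fun s => L (profileCurve r (τ s)), L.contDiff.comp (h.contDiff_curve.comp hτs),
    fun s => ?_, fun s => ?_, fun s => ?_, ?_⟩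
  · rw [← sq_eq_sq₀ (norm_nonneg _) zero_le_one, hnorm, h.curve_unit, one_pow]
  · rw [(hder s).deriv, map_smul, norm_smul, Real.norm_of_nonneg (inv_nonneg.2 (hσpos _).le)]
    have : ‖L (profileTangent r p g (τ s))‖ = (1 - r (τ s) ^ 2) / g (τ s) := by
      rw [← sq_eq_sq₀ (norm_nonneg _) (hσpos _).le, hnorm, h.tangent_norm_sq]
    rw [this, inv_mul_cancel₀ (hσpos _).ne']
  · rw [c0]; exact h.r_pos _
  · ext q
    simp only [mem_ofPred_eq, c0, c1, c2]
    constructor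
    · rintro ⟨u, hu, rfl⟩
      obtain ⟨φ, hφ, e⟩ := exists_polar hu
      refine ⟨S ‖u‖, φ, hφ, ?_⟩
      have hpos := norm_pos_iff.2 hu
      generalize ‖u‖ = t at *
      subst e
      rw [hleft, revolve_smul hpos hφ]
      exact ⟨fun i => by rw [join_castAdd]; rfl, join_natAdd_zero _, join_natAdd_one _⟩
    · rintro ⟨s, φ, hφ, h1, h2, h3⟩
      convert h.join_mem_surface (τ s) hφ
      ext i
      refine Fin.addCases (fun i => ?_) (fun i => ?_) i
      · rw [h1, join_castAdd]; rfl
      · fin_cases i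
        · exact h2.trans
            (join_natAdd_zero ((profileCurve r (τ s)).1 • φ, (profileCurve r (τ s)).2)).symm
        · exact h3.trans
            (join_natAdd_one ((profileCurve r (τ s)).1 • φ, (profileCurve r (τ s)).2)).symm

end AngularProfile

/-! ### The Gauss equation and the intrinsic scalar curvature -/

section gauss
variable {n d d' : ℕ} {x : Euc n → Euc d} {x' : Euc n → Euc d'} {U : Set (Euc n)} {u : Euc n}

lemma fderiv_inner_fderiv (b : Euc n) {ν : Euc n → Euc d}
    (hx : ContDiffAt ℝ ∞ x u) (hν : DifferentiableAt ℝ ν u) (a : Euc n) :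
    fderiv ℝ (fun w => inner ℝ (fderiv ℝ x w b) (ν w)) u a =
      inner ℝ (fderiv ℝ x u b) (fderiv ℝ ν u a) +
        inner ℝ (fderiv ℝ (fderiv ℝ x) u a b) (ν u) := by
  rw [(hasFDerivAt_inner_left b hx hν.hasFDerivAt).fderiv]
  simp [fderivInnerCLM_apply]

lemma second_fderiv_symm (hx : ContDiffAt ℝ ∞ x u) (a b : Euc n) :
    fderiv ℝ (fderiv ℝ x) u a b = fderiv ℝ (fderiv ℝ x) u b a :=
  (hx.isSymmSndFDerivAt (by
    rw [minSmoothness_of_isRCLikeNormedField]; exact WithTop.coe_le_coe.2 (le_top : (2 : ℕ∞) ≤ ⊤))).eq a b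

lemma contDiffAt_fderiv_apply (hx : ContDiffAt ℝ ∞ x u) (b : Euc n) :
    ContDiffAt ℝ ∞ (fun w => fderiv ℝ x w b) u :=
  (hx.fderiv_right (m := ∞) (by simp)).clm_apply contDiffAt_const

lemma fderiv_fderiv_apply (hx : ContDiffAt ℝ ∞ x u) (a b : Euc n) :
    fderiv ℝ (fun w => fderiv ℝ x w b) u a = fderiv ℝ (fderiv ℝ x) u a b := by
  have h1 : HasFDerivAt (fderiv ℝ x) (fderiv ℝ (fderiv ℝ x) u) u :=
    ((hx.fderiv_right (m := ∞) (by simp)).differentiableAt (by simp)).hasFDerivAt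
  rw [(h1.clm_apply (hasFDerivAt_const b u)).fderiv]
  simp

lemma inner_map_eq_of_norm_map_eq {A : Euc n →L[ℝ] Euc d} {B : Euc n →L[ℝ] Euc d'}
    (h : ∀ v, ‖B v‖ = ‖A v‖) (a b : Euc n) : inner ℝ (A a) (A b) = inner ℝ (B a) (B b) := by
  rw [real_inner_eq_norm_add_mul_self_sub_norm_mul_self_sub_norm_mul_self_div_two,
    real_inner_eq_norm_add_mul_self_sub_norm_mul_self_sub_norm_mul_self_div_two,
    ← map_add, ← map_add, h, h, h]

/-- Koszul's formula: the tangential part of the second derivative of an immersion is determined by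
the induced metric. -/
lemma inner_second_fderiv_fderiv_eq (hU : IsOpen U) (hx : ContDiffOn ℝ ∞ x U)
    (hx' : ContDiffOn ℝ ∞ x' U) (h : ∀ w ∈ U, ∀ v, ‖fderiv ℝ x' w v‖ = ‖fderiv ℝ x w v‖)
    (hu : u ∈ U) (a b c : Euc n) :
    inner ℝ (fderiv ℝ (fderiv ℝ x) u a b) (fderiv ℝ x u c) =
      inner ℝ (fderiv ℝ (fderiv ℝ x') u a b) (fderiv ℝ x' u c) := by
  have hxu := hx.contDiffAt (hU.mem_nhds hu)
  have hxu' := hx'.contDiffAt (hU.mem_nhds hu)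
  -- The metric coefficients of the two immersions agree near u, hence so do their derivatives. The
  -- three cyclic versions are then solved for a single term.
  have key : ∀ a b c : Euc n,
      inner ℝ (fderiv ℝ x u b) (fderiv ℝ (fderiv ℝ x) u a c) +
        inner ℝ (fderiv ℝ (fderiv ℝ x) u a b) (fderiv ℝ x u c) =
      inner ℝ (fderiv ℝ x' u b) (fderiv ℝ (fderiv ℝ x') u a c) +
        inner ℝ (fderiv ℝ (fderiv ℝ x') u a b) (fderiv ℝ x' u c) := by
    intro a b c
    have e1 := fderiv_inner_fderiv b hxu
      ((contDiffAt_fderiv_apply hxu c).differentiableAt (by simp)) a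
    have e2 := fderiv_inner_fderiv b hxu'
      ((contDiffAt_fderiv_apply hxu' c).differentiableAt (by simp)) a
    rw [fderiv_fderiv_apply hxu] at e1
    rw [fderiv_fderiv_apply hxu'] at e2
    rw [← e1, ← e2]
    congr 1
    refine Filter.EventuallyEq.fderiv_eq ?_
    filter_upwards [hU.mem_nhds hu] with w hw
    exact inner_map_eq_of_norm_map_eq (h w hw) b c
  have k1 := key a b c
  have k2 := key b a c
  have k3 := key c a b
  rw [second_fderiv_symm hxu b a, second_fderiv_symm hxu' b a] at k2
  rw [second_fderiv_symm hxu c a, second_fderiv_symm hxu c b, second_fderiv_symm hxu' c a,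
    second_fderiv_symm hxu' c b] at k3
  simp only [real_inner_comm (fderiv ℝ x u c), real_inner_comm (fderiv ℝ x' u c)] at *
  simp only [real_inner_comm _ (fderiv ℝ x u a), real_inner_comm _ (fderiv ℝ x u b),
    real_inner_comm _ (fderiv ℝ x' u a), real_inner_comm _ (fderiv ℝ x' u b)] at *
  linarith

/-- The curvature of an immersion, before the tangential parts are removed, is determined by the
induced metric. -/
lemma inner_second_fderiv_sub_eq (hU : IsOpen U) (hx : ContDiffOn ℝ ∞ x U)
    (hx' : ContDiffOn ℝ ∞ x' U) (h : ∀ w ∈ U, ∀ v, ‖fderiv ℝ x' w v‖ = ‖fderiv ℝ x w v‖)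
    (hu : u ∈ U) (a b c e : Euc n) :
    inner ℝ (fderiv ℝ (fderiv ℝ x) u a c) (fderiv ℝ (fderiv ℝ x) u b e) -
        inner ℝ (fderiv ℝ (fderiv ℝ x) u b c) (fderiv ℝ (fderiv ℝ x) u a e) =
      inner ℝ (fderiv ℝ (fderiv ℝ x') u a c) (fderiv ℝ (fderiv ℝ x') u b e) -
        inner ℝ (fderiv ℝ (fderiv ℝ x') u b c) (fderiv ℝ (fderiv ℝ x') u a e) := by
  -- Differentiating the Koszul identity in the direction b produces a third derivative of the
  -- immersion, symmetric in a and b; it drops out of the antisymmetrized identity.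
  have general : ∀ {d : ℕ} {x : Euc n → Euc d}, ContDiffOn ℝ ∞ x U → ∀ a b : Euc n,
      fderiv ℝ (fun w => inner ℝ (fderiv ℝ (fderiv ℝ x) w a c) (fderiv ℝ x w e)) u b =
        inner ℝ (fderiv ℝ (fderiv ℝ x) u a c) (fderiv ℝ (fderiv ℝ x) u b e) +
        inner ℝ (fderiv ℝ (fderiv ℝ (fun w => fderiv ℝ x w c)) u b a) (fderiv ℝ x u e) := by
    intro d x hx a b
    have hxu := hx.contDiffAt (hU.mem_nhds hu)
    have e1 := fderiv_inner_fderiv a (contDiffAt_fderiv_apply hxu c)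
      ((contDiffAt_fderiv_apply hxu e).differentiableAt (by simp)) b
    rw [fderiv_fderiv_apply hxu, fderiv_fderiv_apply hxu] at e1
    rw [← e1]
    congr 1
    refine Filter.EventuallyEq.fderiv_eq ?_
    filter_upwards [hU.mem_nhds hu] with w hw
    rw [fderiv_fderiv_apply (hx.contDiffAt (hU.mem_nhds hw))]
  have heq : ∀ a b : Euc n,
      fderiv ℝ (fun w => inner ℝ (fderiv ℝ (fderiv ℝ x) w a c) (fderiv ℝ x w e)) u b =
      fderiv ℝ (fun w => inner ℝ (fderiv ℝ (fderiv ℝ x') w a c) (fderiv ℝ x' w e)) u b := by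
    intro a b
    congr 1
    refine Filter.EventuallyEq.fderiv_eq ?_
    filter_upwards [hU.mem_nhds hu] with w hw
    exact inner_second_fderiv_fderiv_eq hU hx hx' h hw a c e
  have s1 := second_fderiv_symm
    (contDiffAt_fderiv_apply (hx.contDiffAt (hU.mem_nhds hu)) c) a b
  have s2 := second_fderiv_symm
    (contDiffAt_fderiv_apply (hx'.contDiffAt (hU.mem_nhds hu)) c) a b
  have g1 := heq a b
  have g2 := heq b a
  rw [general hx, general hx'] at g1 g2
  rw [s1, s2] at g2
  linarith

/-- The scalar curvature at `u` of the immersion `x`, computed from the Gauss equation in a frame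
`e` for which the vectors `dx (e i)` are orthonormal. -/
noncomputable def scalarCurvature (x : Euc n → Euc d) (u : Euc n) (e : Fin n → Euc n) : ℝ :=
  ∑ i, ∑ j, (inner ℝ (fderiv ℝ (fderiv ℝ x) u (e i) (e i)) (fderiv ℝ (fderiv ℝ x) u (e j) (e j)) -
      inner ℝ (fderiv ℝ (fderiv ℝ x) u (e j) (e i)) (fderiv ℝ (fderiv ℝ x) u (e i) (e j)) -
    ∑ k, (inner ℝ (fderiv ℝ (fderiv ℝ x) u (e i) (e i)) (fderiv ℝ x u (e k)) *
        inner ℝ (fderiv ℝ (fderiv ℝ x) u (e j) (e j)) (fderiv ℝ x u (e k)) -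
      inner ℝ (fderiv ℝ (fderiv ℝ x) u (e j) (e i)) (fderiv ℝ x u (e k)) *
        inner ℝ (fderiv ℝ (fderiv ℝ x) u (e i) (e j)) (fderiv ℝ x u (e k))))

/-- The scalar curvature is intrinsic. -/
lemma scalarCurvature_eq (hU : IsOpen U) (hx : ContDiffOn ℝ ∞ x U)
    (hx' : ContDiffOn ℝ ∞ x' U) (h : ∀ w ∈ U, ∀ v, ‖fderiv ℝ x' w v‖ = ‖fderiv ℝ x w v‖)
    (hu : u ∈ U) (e : Fin n → Euc n) : scalarCurvature x u e = scalarCurvature x' u e := by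
  unfold scalarCurvature
  simp only [inner_second_fderiv_fderiv_eq hU hx hx' h hu,
    inner_second_fderiv_sub_eq hU hx hx' h hu]

/-- Gauss equation: the scalar curvature in terms of the second fundamental form with respect to an
orthonormal frame `ν` of the normal space. -/
lemma scalarCurvature_eq_sum [NeZero n] {m : ℕ} (hd : n + m = d) (hx : ContDiffAt ℝ ∞ x u)
    {e : Fin n → Euc n} {ν : Fin m → Euc d}
    (ho : Orthonormal ℝ (Sum.elim (fun i => fderiv ℝ x u (e i)) ν)) :
    scalarCurvature x u e = ∑ k, ((∑ i, inner ℝ (fderiv ℝ (fderiv ℝ x) u (e i) (e i)) (ν k)) ^ 2 -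
      ∑ i, ∑ j, inner ℝ (fderiv ℝ (fderiv ℝ x) u (e i) (e j)) (ν k) ^ 2) := by
  have hcard : Fintype.card (Fin n ⊕ Fin m) = Module.finrank ℝ (Euc d) := by simp [hd]
  let B := basisOfOrthonormalOfCardEqFinrank ho hcard
  have hB : ∀ i, B i = Sum.elim (fun i => fderiv ℝ x u (e i)) ν i := fun i => by simp [B]
  let b : OrthonormalBasis (Fin n ⊕ Fin m) ℝ (Euc d) := B.toOrthonormalBasis (by
    rw [show ⇑B = _ from funext hB]; exact ho)
  have hb : ∀ i, b i = Sum.elim (fun i => fderiv ℝ x u (e i)) ν i := fun i => by simp [b, hB]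
  -- Parseval in the adapted basis: the tangential part is exactly what `scalarCurvature` subtracts,
  -- so the normal part remains.
  have hpars : ∀ v w : Euc d, inner ℝ v w =
      ∑ i, inner ℝ v (fderiv ℝ x u (e i)) * inner ℝ w (fderiv ℝ x u (e i)) +
        ∑ k, inner ℝ v (ν k) * inner ℝ w (ν k) := fun v w => by
    rw [← b.sum_inner_mul_inner v w, Fintype.sum_sum_type]
    simp only [hb, Sum.elim_inl, Sum.elim_inr, real_inner_comm w]
  have step : ∀ i j : Fin n,
      inner ℝ (fderiv ℝ (fderiv ℝ x) u (e i) (e i)) (fderiv ℝ (fderiv ℝ x) u (e j) (e j)) -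
      inner ℝ (fderiv ℝ (fderiv ℝ x) u (e j) (e i)) (fderiv ℝ (fderiv ℝ x) u (e i) (e j)) -
      ∑ k, (inner ℝ (fderiv ℝ (fderiv ℝ x) u (e i) (e i)) (fderiv ℝ x u (e k)) *
        inner ℝ (fderiv ℝ (fderiv ℝ x) u (e j) (e j)) (fderiv ℝ x u (e k)) -
      inner ℝ (fderiv ℝ (fderiv ℝ x) u (e j) (e i)) (fderiv ℝ x u (e k)) *
        inner ℝ (fderiv ℝ (fderiv ℝ x) u (e i) (e j)) (fderiv ℝ x u (e k))) =
      ∑ k, (inner ℝ (fderiv ℝ (fderiv ℝ x) u (e i) (e i)) (ν k) *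
        inner ℝ (fderiv ℝ (fderiv ℝ x) u (e j) (e j)) (ν k) -
      inner ℝ (fderiv ℝ (fderiv ℝ x) u (e i) (e j)) (ν k) ^ 2) := by
    intro i j
    rw [hpars, hpars (fderiv ℝ (fderiv ℝ x) u (e j) (e i)), second_fderiv_symm hx (e j) (e i)]
    simp only [Finset.sum_sub_distrib, pow_two]
    ring
  unfold scalarCurvature
  simp only [step]
  rw [Finset.sum_congr rfl fun i _ => Finset.sum_comm, Finset.sum_comm]
  refine Finset.sum_congr rfl fun k _ => ?_
  rw [pow_two, Finset.sum_mul_sum]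
  simp only [Finset.sum_sub_distrib]

end gauss

/-! ### Scalar curvature of products of round spheres -/

section products
variable {n d m : ℕ} {x : Euc n → Euc d} {U : Set (Euc n)} {u : Euc n}

/-- The scalar curvature of a product of round spheres, the `k`-th of radius `a k` in the range of
the orthogonal projection `P k`, is constant. -/
lemma scalarCurvature_product [NeZero n] (hd : n + m = d) {P : Fin m → Euc d →L[ℝ] Euc d}
    (hsymm : ∀ k v w, inner ℝ (P k v) w = inner ℝ v (P k w))
    (hproj : ∀ k l v, P k (P l v) = if k = l then P k v else 0) {a : Fin m → ℝ}
    (ha : ∀ k, 0 < a k) (hU : IsOpen U) (hx : ContDiffOn ℝ ∞ x U)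
    (hxa : ∀ k, ∀ w ∈ U, inner ℝ (P k (x w)) (x w) = a k ^ 2) (hu : u ∈ U) {e : Fin n → Euc n}
    (he : Orthonormal ℝ fun i => fderiv ℝ x u (e i)) :
    scalarCurvature x u e = ∑ k, ((LinearMap.trace ℝ _ (P k : Euc d →ₗ[ℝ] Euc d) - 1) ^ 2 -
      (LinearMap.trace ℝ _ (P k : Euc d →ₗ[ℝ] Euc d) - 1)) / a k ^ 2 := by
  have hxd : ∀ w ∈ U, ContDiffAt ℝ ∞ x w := fun w hw => hx.contDiffAt (hU.mem_nhds hw)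
  have hxf : ∀ w ∈ U, HasFDerivAt x (fderiv ℝ x w) w := fun w hw =>
    ((hxd w hw).differentiableAt (by simp)).hasFDerivAt
  have hPx : ∀ k, ∀ w ∈ U, HasFDerivAt (fun w => P k (x w)) ((P k).comp (fderiv ℝ x w)) w :=
    fun k w hw => (P k).hasFDerivAt.comp w (hxf w hw)
  have htan : ∀ k, ∀ w ∈ U, ∀ b, inner ℝ (fderiv ℝ x w b) (P k (x w)) = 0 := by
    intro k w hw b
    have h1 := (hPx k w hw).inner ℝ (hxf w hw)
    have h2 := h1.unique ((hasFDerivAt_const (a k ^ 2) w).congr_of_eventuallyEq (by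
      filter_upwards [hU.mem_nhds hw] with y hy using hxa k y hy))
    have h3 := congrArg (fun L : Euc n →L[ℝ] ℝ => L b) h2
    simp only [ContinuousLinearMap.comp_apply, ContinuousLinearMap.prod_apply,
      fderivInnerCLM_apply, zero_apply] at h3
    rw [hsymm, real_inner_comm] at h3
    rw [hsymm] at h3
    have := real_inner_comm (fderiv ℝ x w b) (P k (x w))
    linarith [hsymm k (x w) (fderiv ℝ x w b), real_inner_comm (x w) (P k (fderiv ℝ x w b)),
      hsymm k (fderiv ℝ x w b) (x w)]
  have hsecond : ∀ k i j, inner ℝ (fderiv ℝ (fderiv ℝ x) u (e i) (e j)) (P k (x u)) =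
      -inner ℝ (fderiv ℝ x u (e j)) (P k (fderiv ℝ x u (e i))) := fun k i j =>
    inner_second_fderiv (e i) (e j) (hxd u hu) (hPx k u hu) (by
      filter_upwards [hU.mem_nhds hu] with w hw using htan k w hw _)
  -- The normal space is spanned by the unit position vectors of the factors, and the second
  -- fundamental form in the k-th direction is -P k / a k on tangent vectors.
  let ν : Fin m → Euc d := fun k => (a k)⁻¹ • P k (x u)
  have hν : ∀ k l, inner ℝ (ν k) (ν l) = if k = l then (1 : ℝ) else 0 := by
    intro k l
    have := (ha k).ne'
    simp only [ν, real_inner_smul_left, real_inner_smul_right]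
    rw [real_inner_comm, hsymm, real_inner_comm, hproj]
    by_cases h : l = k
    · subst h
      rw [if_pos rfl, if_pos rfl, hxa l u hu]
      field_simp
    · rw [if_neg h, if_neg (Ne.symm h)]
      simp
  have hXν : ∀ i k, inner ℝ (fderiv ℝ x u (e i)) (ν k) = 0 := fun i k => by
    simp only [ν, real_inner_smul_right, htan k u hu, mul_zero]
  have hX := orthonormal_iff_ite.1 he
  have ho : Orthonormal ℝ (Sum.elim (fun i => fderiv ℝ x u (e i)) ν) := by
    rw [orthonormal_iff_ite]
    rintro (i | k) (j | l)
    · simpa using hX i j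
    · simpa using hXν i l
    · simpa [real_inner_comm] using hXν j k
    · simpa using hν k l
  have hcard : Fintype.card (Fin n ⊕ Fin m) = Module.finrank ℝ (Euc d) := by simp [hd]
  let B := basisOfOrthonormalOfCardEqFinrank ho hcard
  have hB : ∀ i, B i = Sum.elim (fun i => fderiv ℝ x u (e i)) ν i := fun i => by simp [B]
  let b : OrthonormalBasis (Fin n ⊕ Fin m) ℝ (Euc d) := B.toOrthonormalBasis (by
    rw [show ⇑B = _ from funext hB]; exact ho)
  have hb : ∀ i, b i = Sum.elim (fun i => fderiv ℝ x u (e i)) ν i := fun i => by simp [b, hB]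
  have hPν : ∀ k l, P k (ν l) = if k = l then ν l else 0 := by
    intro k l
    simp only [ν, map_smul, hproj]
    split_ifs with h
    · rw [h]
    · simp
  -- In the adapted basis only ν k among the normal vectors is seen by P k, so the trace on the
  -- tangent space is the full trace minus 1, that is, the dimension of the k-th sphere.
  have htrace : ∀ k, LinearMap.trace ℝ _ (P k : Euc d →ₗ[ℝ] Euc d) =
      ∑ i, inner ℝ (fderiv ℝ x u (e i)) (P k (fderiv ℝ x u (e i))) + 1 := by
    intro k
    rw [LinearMap.trace_eq_sum_inner _ b, Fintype.sum_sum_type]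
    simp only [hb, Sum.elim_inl, Sum.elim_inr, ContinuousLinearMap.coe_coe]
    congr 1
    rw [Finset.sum_eq_single k]
    · rw [hPν, if_pos rfl, hν, if_pos rfl]
    · intro l _ hl
      rw [hPν, if_neg (Ne.symm hl), inner_zero_right]
    · simp
  -- On the tangent space P k is still a projection, because it maps tangent vectors to tangent
  -- vectors; so the squared norm of the second fundamental form is again a trace.
  have hsq : ∀ k i, ∑ j, inner ℝ (fderiv ℝ x u (e j)) (P k (fderiv ℝ x u (e i))) ^ 2 =
      inner ℝ (fderiv ℝ x u (e i)) (P k (fderiv ℝ x u (e i))) := by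
    intro k i
    have h1 := b.sum_inner_mul_inner (P k (fderiv ℝ x u (e i))) (P k (fderiv ℝ x u (e i)))
    rw [Fintype.sum_sum_type] at h1
    simp only [hb, Sum.elim_inl, Sum.elim_inr] at h1
    have h2 : ∀ l, inner ℝ (ν l) (P k (fderiv ℝ x u (e i))) = 0 := fun l => by
      rw [← hsymm, hPν]
      split_ifs
      · rw [real_inner_comm, hXν]
      · exact inner_zero_left _
    simp only [h2, mul_zero, Finset.sum_const_zero, add_zero] at h1
    rw [hsymm, hproj, if_pos rfl] at h1
    rw [← h1]
    refine Finset.sum_congr rfl fun j _ => ?_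
    rw [real_inner_comm (fderiv ℝ x u (e j)), pow_two]
  rw [scalarCurvature_eq_sum hd (hxd u hu) ho]
  refine Finset.sum_congr rfl fun k _ => ?_
  simp only [ν, real_inner_smul_right, hsecond, mul_pow, neg_sq, ← Finset.mul_sum, hsq]
  rw [htrace]
  simp only [Finset.sum_neg_distrib]
  have := (ha k).ne'
  field_simp
  ring

/-- The orthogonal projection of `ℝ^d` onto the coordinates that satisfy `q`. -/
noncomputable def coordProj (d : ℕ) (q : Fin d → Prop) [DecidablePred q] : Euc d →L[ℝ] Euc d :=
  LinearMap.toContinuousLinearMap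
    { toFun := fun v => WithLp.toLp 2 fun i => if q i then v i else 0
      map_add' := fun x y => by ext i; simp; split_ifs <;> simp
      map_smul' := fun c x => by ext i; simp }

lemma coordProj_apply (q : Fin d → Prop) [DecidablePred q] (v : Euc d) (i : Fin d) :
    coordProj d q v i = if q i then v i else 0 := rfl

lemma coordProj_symm (q : Fin d → Prop) [DecidablePred q] (v w : Euc d) :
    inner ℝ (coordProj d q v) w = inner ℝ v (coordProj d q w) := by
  simp only [PiLp.inner_apply, coordProj_apply]
  refine Finset.sum_congr rfl fun i _ => ?_
  split_ifs <;> simp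

lemma inner_coordProj_self (q : Fin d → Prop) [DecidablePred q] (v : Euc d) :
    inner ℝ (coordProj d q v) v = ∑ i, if q i then v i ^ 2 else 0 := by
  simp only [PiLp.inner_apply, coordProj_apply]
  refine Finset.sum_congr rfl fun i _ => ?_
  split_ifs <;> simp [pow_two]

/-- All immersions with values in a round sphere have the same scalar curvature. -/
lemma scalarCurvature_sphere [NeZero n] {ρ : ℝ} (hρ : 0 < ρ) : ∃ c : ℝ,
    ∀ (x : Euc n → Euc (n + 1)) (U : Set (Euc n)) (u : Euc n) (e : Fin n → Euc n), IsOpen U →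
      ContDiffOn ℝ ∞ x U → (∀ w ∈ U, x w ∈ Metric.sphere (0 : Euc (n + 1)) ρ) → u ∈ U →
      Orthonormal ℝ (fun i => fderiv ℝ x u (e i)) → scalarCurvature x u e = c := by
  refine ⟨_, fun x U u e hU hx hxU hu he => scalarCurvature_product (m := 1) rfl
    (P := fun _ => ContinuousLinearMap.id ℝ _) (a := fun _ => ρ) (fun _ _ _ => rfl)
    (fun k l v => by rw [if_pos (Subsingleton.elim k l)]; rfl) (fun _ => hρ) hU hx
    (fun _ w hw => ?_) hu he⟩
  rw [ContinuousLinearMap.id_apply, real_inner_self_eq_norm_sq, mem_sphere_zero_iff_norm.1 (hxU w hw)]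

/-- All immersions with values in a Clifford hypersurface have the same scalar curvature. -/
lemma scalarCurvature_clifford [NeZero n] (l : ℕ) {a b : ℝ} (ha : 0 < a) (hb : 0 < b) : ∃ c : ℝ,
    ∀ (x : Euc n → Euc (n + 2)) (U : Set (Euc n)) (u : Euc n) (e : Fin n → Euc n), IsOpen U →
      ContDiffOn ℝ ∞ x U → (∀ w ∈ U, x w ∈ cliffordHypersurface n l a b) → u ∈ U →
      Orthonormal ℝ (fun i => fderiv ℝ x u (e i)) → scalarCurvature x u e = c := by
  refine ⟨_, fun x U u e hU hx hxU hu he => scalarCurvature_product (m := 2) rfl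
    (P := ![coordProj (n + 2) fun i => (i : ℕ) ≤ l, coordProj (n + 2) fun i => ¬ (i : ℕ) ≤ l])
    (a := ![a, b]) (fun k v w => ?_) (fun k k' v => ?_) (fun k => ?_) hU hx
    (fun k w hw => ?_) hu he⟩
  · fin_cases k <;> exact coordProj_symm _ v w
  · fin_cases k <;> fin_cases k' <;> ext i <;> simp [coordProj_apply] <;> grind
  · fin_cases k
    exacts [ha, hb]
  · fin_cases k
    · exact (inner_coordProj_self _ _).trans (hxU w hw).1
    · refine (inner_coordProj_self _ _).trans (Eq.trans ?_ (hxU w hw).2)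
      simp only [ite_not]

end products

/-! ### Nontriviality of the hypersurface -/

namespace AngularProfile
variable {n : ℕ} {H : ℝ} {r p g μ : ℝ → ℝ}

lemma sum_rotCurvatures [NeZero n] (m l : ℝ) :
    ∑ i : Fin n, rotCurvatures m l i = m + (n - 1) * l := by
  have h1 : ∀ i : Fin n, rotCurvatures m l i = l + if i = 0 then m - l else 0 := fun i => by
    unfold rotCurvatures; split_ifs <;> ring
  simp only [h1, Finset.sum_add_distrib, Finset.sum_const, Finset.card_univ, Fintype.card_fin,
    Finset.sum_ite_eq', Finset.mem_univ, if_true, nsmul_eq_mul]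
  ring

/-- The Gauss equation with the normal frame formed by the position vector and the normal field. The
position vector has second fundamental form minus the metric and contributes n(n-1). -/
lemma scalarCurvature_revolve [NeZero n] (h : AngularProfile n H r p g μ) {u : Euc n} (hu : u ≠ 0)
    {e : Fin n → Euc n} (he : IsPrincipalFrame (revolve n (profileCurve r)) u
      (revolve n (profileNormal r p g) u) e (rotCurvatures (μ ‖u‖) (g ‖u‖ / r ‖u‖))) :
    scalarCurvature (revolve n (profileCurve r)) u e = n * (n - 1) +
      (n - 1) * (2 * (g ‖u‖ / r ‖u‖) * μ ‖u‖ + (n - 2) * (g ‖u‖ / r ‖u‖) ^ 2) := by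
  have hx := contDiffAt_revolve (n := n) h.contDiff_curve hu
  have hX := orthonormal_iff_ite.1 he.orthonormal
  have hxx : ∀ w : Euc n, w ≠ 0 → ∀ v, inner ℝ (fderiv ℝ (revolve n (profileCurve r)) w v)
      (revolve n (profileCurve r) w) = 0 := by
    intro w hw v
    have hd : HasFDerivAt (revolve n (profileCurve r)) _ w :=
      ((contDiffAt_revolve h.contDiff_curve hw).differentiableAt (by simp)).hasFDerivAt
    have h2 := (hd.inner ℝ hd).unique ((hasFDerivAt_const (1 : ℝ) w).congr_of_eventuallyEq (by
      filter_upwards [isOpen_ne.mem_nhds hw] with y hy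
      rw [real_inner_self_eq_norm_sq, h.revolve_unit hy, one_pow]))
    have h3 := congrArg (fun L : Euc n →L[ℝ] ℝ => L v) h2
    simp only [ContinuousLinearMap.comp_apply, ContinuousLinearMap.prod_apply,
      fderivInnerCLM_apply, zero_apply] at h3
    linarith [real_inner_comm (fderiv ℝ (revolve n (profileCurve r)) w v)
      (revolve n (profileCurve r) w)]
  have hsec : ∀ i j, inner ℝ (fderiv ℝ (fderiv ℝ (revolve n (profileCurve r))) u (e i) (e j))
      (revolve n (profileCurve r) u) = if i = j then (-1 : ℝ) else 0 := by
    intro i j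
    rw [inner_second_fderiv (e i) (e j) hx (hx.differentiableAt (by simp)).hasFDerivAt (by
      filter_upwards [isOpen_ne.mem_nhds hu] with w hw using hxx w hw _), hX]
    by_cases hij : i = j
    · rw [if_pos hij, if_pos hij.symm]
    · rw [if_neg hij, if_neg (Ne.symm hij), neg_zero]
  obtain ⟨hN1, hN2⟩ := h.normal_unit_revolve hu
  have ho : Orthonormal ℝ (Sum.elim (fun i => fderiv ℝ (revolve n (profileCurve r)) u (e i))
      ![revolve n (profileCurve r) u, revolve n (profileNormal r p g) u]) := by
    rw [orthonormal_iff_ite]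
    rintro (i | k) (j | l)
    · simpa using hX i j
    · fin_cases l
      · simpa using hxx u hu (e i)
      · simpa using h.inner_fderiv_normal hu (e i)
    · fin_cases k
      · simpa [real_inner_comm] using hxx u hu (e j)
      · simpa [real_inner_comm] using h.inner_fderiv_normal hu (e j)
    · fin_cases k <;> fin_cases l
      · simp [h.revolve_unit hu]
      · simpa using hN2
      · simpa [real_inner_comm] using hN2
      · simp [hN1]
  have hκ : ∀ i : Fin n, rotCurvatures (μ ‖u‖) (g ‖u‖ / r ‖u‖) i ^ 2 =
      rotCurvatures (μ ‖u‖ ^ 2) ((g ‖u‖ / r ‖u‖) ^ 2) i := fun i => by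
    unfold rotCurvatures; split_ifs <;> rfl
  rw [scalarCurvature_eq_sum rfl hx ho, Fin.sum_univ_two]
  simp only [Matrix.cons_val_zero, Matrix.cons_val_one, hsec, he.diagonal, if_true,
    ite_pow, zero_pow two_ne_zero, Finset.sum_ite_eq, Finset.mem_univ, hκ, sum_rotCurvatures,
    Finset.sum_const, Finset.card_univ, Fintype.card_fin, nsmul_eq_mul]
  ring

/-- The scalar curvature of the surface is not constant, as a function of the polar angle. -/
lemma scalarCurvature_nonconstant (h : AngularProfile n H r p g μ) (hn : 5 ≤ n) (c : ℝ)
    (hc : ∀ t, (n : ℝ) * (n - 1) + (n - 1) * (2 * (g t / r t) * μ t + (n - 2) * (g t / r t) ^ 2) = c) :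
    False := by
  obtain ⟨t₁, t₂, hne⟩ := h.nonconstant
  have hn1 : (n : ℝ) - 1 ≠ 0 := by
    have : (5 : ℝ) ≤ n := by exact_mod_cast hn
    linarith
  have hn0 : (n : ℝ) ≠ 0 := by
    have : (5 : ℝ) ≤ n := by exact_mod_cast hn
    linarith
  have hpos : ∀ t, 0 < g t / r t := fun t => div_pos (h.g_pos t) (h.r_pos t)
  -- Elimination of μ by the mean curvature equation: constancy of the scalar curvature means that
  -- λ² + H/λ² is constant.
  have key : ∀ t, (g t / r t) ^ 2 * (c - n * (n - 1)) * 2 =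
      (n - 1) * (n * (H + (g t / r t) ^ 4)) := fun t => by
    rw [← hc t]
    linear_combination (-(n : ℝ) + 1) * h.curvature t
  have h1 := hpos t₁
  have h2 := hpos t₂
  have h3 := h.curvature_lt t₁
  have h4 := h.curvature_lt t₂
  have k1 := key t₁
  have k2 := key t₂
  set l₁ := g t₁ / r t₁
  set l₂ := g t₂ / r t₂
  have e : ((n : ℝ) - 1) * n * ((l₁ ^ 2 - l₂ ^ 2) * (l₁ ^ 2 * l₂ ^ 2 - H)) = 0 := by
    linear_combination l₁ ^ 2 * k2 - l₂ ^ 2 * k1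
  rcases mul_eq_zero.1 ((mul_eq_zero.1 e).resolve_left (mul_ne_zero hn1 hn0)) with e | e
  · exact hne ((sq_eq_sq₀ h1.le h2.le).1 (by linarith))
  -- Two different values of λ² with the same λ² + H/λ² have product H, which contradicts λ⁴ > H at
  -- both points.
  · have h5 : H ^ 2 < l₁ ^ 4 * l₂ ^ 4 := by
      have : l₁ ^ 4 * l₂ ^ 4 = H ^ 2 := by
        have : l₁ ^ 2 * l₂ ^ 2 = H := by linarith
        rw [← this]; ring
      have h6 : 0 < H := by
        have : l₁ ^ 2 * l₂ ^ 2 = H := by linarith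
        rw [← this]; positivity
      nlinarith
    have h6 : l₁ ^ 2 * l₂ ^ 2 = H := by linarith
    rw [← h6] at h5
    exact h5.ne (by ring)

/-- An isometry f turns a polar chart x into an immersion f ∘ x into S with the same metric. Its
scalar curvature is constant over S, while that of x varies with the polar angle. -/
lemma not_areIsometric (h : AngularProfile n H r p g μ) (hn : 5 ≤ n) {d : ℕ} {S : Set (Euc d)}
    (hS : ∃ c : ℝ, ∀ (x : Euc n → Euc d) (U : Set (Euc n)) (u : Euc n) (e : Fin n → Euc n),
      IsOpen U → ContDiffOn ℝ ∞ x U → (∀ w ∈ U, x w ∈ S) → u ∈ U →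
      Orthonormal ℝ (fun i => fderiv ℝ x u (e i)) → scalarCurvature x u e = c) :
    ¬ AreIsometric n (surface n r) S := by
  have : NeZero n := ⟨by omega⟩
  rintro ⟨f, hf, hiso⟩
  obtain ⟨c, hc⟩ := hS
  refine h.scalarCurvature_nonconstant hn c fun t => ?_
  -- The angle is shifted by a multiple of 2π so that it is the radius of a point with a polar chart
  -- centered there.
  obtain ⟨m, hmem, -⟩ := existsUnique_sub_zsmul_mem_Ioc two_pi_pos t π
  simp only [zsmul_eq_mul] at hmem
  obtain ⟨φ, hφ⟩ : ∃ φ : Euc n, ‖φ‖ = 1 := ⟨EuclideanSpace.single 0 1, by simp⟩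
  have hs : 0 < t - m * (2 * π) := pi_pos.trans hmem.1
  have hφ0 : φ ≠ 0 := norm_ne_zero_iff.1 (by rw [hφ]; exact one_ne_zero)
  have hnorm : ‖(t - m * (2 * π)) • φ‖ = t - m * (2 * π) := by
    rw [norm_smul, hφ, mul_one, Real.norm_of_nonneg hs.le]
  set u := (t - m * (2 * π)) • φ with hu
  have hu0 : u ≠ 0 := smul_ne_zero hs.ne' hφ0
  have hθ : π ≤ ‖u‖ := hnorm ▸ hmem.1.le
  have hmemU : u ∈ annulus n ‖u‖ := ⟨by linarith [pi_pos], by linarith [pi_pos]⟩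
  have hP := h.isLocalParam hθ
  obtain ⟨hsm, hmet⟩ := hiso _ _ hP
  obtain ⟨e, he⟩ := h.exists_principalFrame hu0
  have h1 := scalarCurvature_eq hP.isOpen_source hP.smooth hsm hmet hmemU e
  have h2 := hc _ _ u e hP.isOpen_source hsm
    (fun w hw => hf.mapsTo ⟨w, ne_zero_of_mem_annulus hθ hw, rfl⟩) hmemU (by
      rw [orthonormal_iff_ite]
      intro i j
      rw [← inner_map_eq_of_norm_map_eq (hmet u hmemU)]
      exact orthonormal_iff_ite.1 he.orthonormal i j)
  rw [h.scalarCurvature_revolve hu0 he, h2, hnorm] at h1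
  -- The periodicity of μ is not part of the data; it follows from that of g and r through the mean
  -- curvature equation.
  have hμ : 4 * (g t / r t) ^ 3 * (μ (t - m * (2 * π)) - μ t) = 0 := by
    have c1 := h.curvature t
    have c2 := h.curvature (t - m * (2 * π))
    rw [h.periodic_g.sub_int_mul_eq m, h.periodic_r.sub_int_mul_eq m] at c2
    linear_combination c1 - c2
  have hpos := div_pos (h.g_pos t) (h.r_pos t)
  have hμ' := (mul_eq_zero.1 hμ).resolve_left (by positivity)
  rw [h.periodic_g.sub_int_mul_eq m, h.periodic_r.sub_int_mul_eq m, sub_eq_zero.1 hμ'] at h1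
  exact h1

lemma isNontrivialHypersurface (h : AngularProfile n H r p g μ) (hn : 5 ≤ n) :
    IsNontrivialHypersurface n (surface n r) := by
  have : NeZero n := ⟨by omega⟩
  exact ⟨fun ρ hρ => h.not_areIsometric hn (scalarCurvature_sphere hρ),
    fun l a b _ _ ha hb _ => h.not_areIsometric hn (scalarCurvature_clifford l ha hb)⟩

end AngularProfile

/-! ### Matching π/k with the two limits -/

/-- There is a closed profile curve whose half angle is `π / k`. -/
lemma exists_angularProfile {q k : ℕ} (hk : 3 ≤ k) {H : ℝ} (hH : 0 < H)
    (h : 1 / tan (π / k) ^ 4 < H ∧ H < ((k : ℝ) ^ 4 - 4) / ((q + 5) * (q + 1)) ∨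
      ((k : ℝ) ^ 4 - 4) / ((q + 5) * (q + 1)) < H ∧ H < 1 / tan (π / k) ^ 4) :
    ∃ r p g μ, AngularProfile (q + 5) H r p g μ := by
  have hk0 : (0 : ℝ) < k := by positivity
  have hk3 : (3 : ℝ) ≤ k := by exact_mod_cast hk
  have hv0 : 0 < π / k := by positivity
  have hv : π / k < π / 2 := div_lt_div_of_pos_left pi_pos two_pos (by linarith)
  have hT := tan_pos_of_pos_of_lt_pi_div_two hv0 hv
  have harc : arctan (tan (π / k)) = π / k := arctan_tan (by linarith [pi_pos]) hv
  set T := tan (π / k)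
  have hh : 0 < √√H := Real.sqrt_pos.2 (Real.sqrt_pos.2 hH)
  have hh4 : √√H ^ 4 = H := by
    rw [show √√H ^ 4 = (√√H ^ 2) ^ 2 by ring, Real.sq_sqrt (Real.sqrt_nonneg _),
      Real.sq_sqrt hH.le]
  have hT4 : 1 / T ^ 4 = (1 / T) ^ 4 := by rw [div_pow, one_pow]
  have hq : (0 : ℝ) < (q + 5) * (q + 1) := by positivity
  -- With n = q+5, s² = 4 + n(n-4)H, and τ = (2+s)/(q+1) is the positive root of the equilibrium
  -- quadratic, so (q+1)τ - 2 = s.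
  set s := √(4 + (q + 5) * (q + 1) * H) with hs
  have hs2 : s ^ 2 = 4 + (q + 5) * (q + 1) * H := Real.sq_sqrt (by positivity)
  have hspos : 0 < s := Real.sqrt_pos.2 (by positivity)
  have hτ : 0 < (2 + s) / (q + 1) := by positivity
  have hτe : ((q : ℝ) + 1) * ((2 + s) / (q + 1)) - 2 = s := by field_simp; ring
  have hτq : ((q : ℝ) + 1) * ((2 + s) / (q + 1)) ^ 2 - 4 * ((2 + s) / (q + 1)) = (q + 5) * H := by
    field_simp
    linear_combination hs2
  have hval : π / k ∈ Ioo (arctan (1 / √√H)) (π / √s) ∨ π / k ∈ Ioo (π / √s) (arctan (1 / √√H)) := by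
    -- Comparing H with 1/tan⁴(π/k) compares π/k with arctan(H^(-1/4)); comparing n(n-4)H with k⁴ -
    -- 4 compares π/k with π/√s.
    rcases h with ⟨h1, h2⟩ | ⟨h1, h2⟩
    · left
      constructor
      · rw [← harc]
        refine arctan_strictMono ((one_div_lt hh hT).2 ?_)
        exact lt_of_pow_lt_pow_left₀ 4 hh.le (by rw [hh4, ← hT4]; exact h1)
      · refine div_lt_div_of_pos_left pi_pos (Real.sqrt_pos.2 hspos) ?_
        rw [Real.sqrt_lt' hk0]
        refine lt_of_pow_lt_pow_left₀ 2 (by positivity) ?_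
        rw [lt_div_iff₀ hq] at h2
        rw [hs2]
        linarith
    · right
      constructor
      · refine div_lt_div_of_pos_left pi_pos hk0 ?_
        rw [Real.lt_sqrt hk0.le]
        refine lt_of_pow_lt_pow_left₀ 2 hspos.le ?_
        rw [div_lt_iff₀ hq] at h1
        rw [hs2]
        linarith
      · rw [← harc]
        refine arctan_strictMono ((lt_one_div hT hh).2 ?_)
        exact lt_of_pow_lt_pow_left₀ 4 (by positivity) (by rw [hh4, ← hT4]; exact h2)
  obtain ⟨a, b, hab, hK⟩ := exists_turningPoints_halfAngle_eq hH hτ hτq (hτe.symm ▸ hval)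
  exact hab.exists_angularProfile hH (by omega) hK

end Rotational

theorem theorem5p1 (n k : ℕ) (hn : 5 ≤ n) (hk : 3 ≤ k) (H : ℝ)
    (hlow : min (1 / Real.tan (Real.pi / (k : ℝ)) ^ 4)
      (((k : ℝ) ^ 4 - 4) / ((n : ℝ) * ((n : ℝ) - 4))) < H)
    (hupp : H < max (1 / Real.tan (Real.pi / (k : ℝ)) ^ 4)
      (((k : ℝ) ^ 4 - 4) / ((n : ℝ) * ((n : ℝ) - 4)))) :
    0 < H ∧ ∃ M : Set (Euc (n + 2)),
      IsCompact M ∧ IsConnected M ∧ IsEmbeddedHypersurface n M ∧ IsRotational n M ∧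
        HasConstantMeanCurvature n 4 M H ∧ IsNontrivialHypersurface n M := by
  -- The exponent n-4 is then q+1 ≥ 1, which makes the energy constant vanish on the axis.
  obtain ⟨q, rfl⟩ : ∃ q, n = q + 5 := ⟨n - 5, by omega⟩
  have hk3 : (3 : ℝ) ≤ k := by exact_mod_cast hk
  have hk4 : (3 : ℝ) ^ 4 ≤ (k : ℝ) ^ 4 := pow_le_pow_left₀ (by norm_num) hk3 4
  have hT : 0 < Real.tan (Real.pi / k) :=
    Real.tan_pos_of_pos_of_lt_pi_div_two (by positivity)
      (div_lt_div_of_pos_left Real.pi_pos two_pos (by linarith))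
  have hn4 : ((q + 5 : ℕ) : ℝ) * (((q + 5 : ℕ) : ℝ) - 4) = (q + 5) * (q + 1) := by
    push_cast; ring
  rw [hn4] at hlow hupp
  -- Both bounds are positive: k ≥ 3 gives tan(π/k) > 0 and k⁴ > 4.
  have hH : 0 < H := lt_trans (lt_min (by positivity) (div_pos (by linarith) (by positivity))) hlow
  refine ⟨hH, ?_⟩
  obtain ⟨r, p, g, μ, h⟩ := Rotational.exists_angularProfile (q := q) hk hH (by
    rcases min_lt_iff.1 hlow with h1 | h1 <;> rcases lt_max_iff.1 hupp with h2 | h2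
    · exact absurd h1 h2.not_gt
    · exact Or.inl ⟨h1, h2⟩
    · exact Or.inr ⟨h1, h2⟩
    · exact absurd h1 h2.not_gt)
  exact ⟨Rotational.surface (q + 5) r, h.isCompact_surface, h.isConnected_surface (by omega),
    h.isEmbeddedHypersurface, h.isRotational, h.hasConstantMeanCurvature (by omega),
    h.isNontrivialHypersurface hn⟩
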